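/- Let $K$ be an imaginary quadratic field with ring of integers $\mathcal O_K$ and $K\neq\mathbb{Q}(\sqrt{-3})$, embedded in $\mathbb{C}$. Let $\text{Möb}$ be the group of all Möbius transformations and reflections of $\widehat{\mathbb C}=\mathbb C\cup\{\infty\}$, i.e. the maps $z\mapsto\gamma(z)$ and $z\mapsto\gamma(\overline z)$ with $\gamma\in\mathrm{SL}_2(\mathbb C)$, and let $\mathfrak c$ be complex conjugation. *Packings.* An oriented circle is a circle in $\widehat{\mathbb C}$ with a choice of one of the two components of its complement as its interior; the other one is its exterior. Let $\widehat{\mathcal S}_K$ be the set of oriented circles (of either orientation) whose underlying circle is $M(\widehat{\mathbb R})$ for some $M\in\mathrm{PSL}_2(\mathcal O_K)$. Two circles of $\widehat{\mathcal S}_K$ are immediately tangent if they have exactly one common point, their interiors are disjoint, and there is no $D\in\widehat{\mathcal S}_K$ such that their union meets both the interior and the exterior of $D$. A $K$-Apollonian packing is a minimal non-empty subset of $\widehat{\mathcal S}_K$ that is closed under immediate tangency. The fundamental packing $\mathcal P_K$ is the one that contains $\widehat{\mathbb R}$ oriented so that its interior is the upper half plane; it consists of the circles reached from this one by finitely many immediate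 tangencies. The closure $\overline{\mathcal P_K}$ is the closure in $\widehat{\mathbb C}$ of the union of its circles. *Weak Apollonian groups.* A weak $K$-Apollonian group is a finitely generated Kleinian (that is, discrete) group $\mathcal A<\langle\mathrm{PSL}_2(\mathcal O_K),\mathfrak c\rangle<\text{Möb}$ whose limit set, the set of accumulation points of the orbit of $0$, is $\overline{\mathcal P_K}$. *The group $\mathrm O_M$.* Let $M(b',b,r,m)=-b'b+r^2+m^2$ on $\mathbb R^4$, and identify $(b',b,r,m)$ with the Hermitian matrix $T=\begin{pmatrix} b'&r+mi\\ r-mi&b\end{pmatrix}$, so that $M=-\det T$. Let $\mathrm O_M$ and $\mathrm{SO}_M$ be the real orthogonal and special orthogonal groups of $M$. Let $\rho:\text{Möb}\to\mathrm O_M$ be the injective homomorphism under which $z\mapsto\gamma(z)$ acts by $T\mapsto\gamma T\gamma^\dagger$ for $\gamma\in\mathrm{SL}_2(\mathbb C)$, and $\mathfrak c$ acts by $T\mapsto\overline T$. Let $L_K=\{(b',b,r,m): b',b\in\mathbb Z,\ r+mi\in\mathcal O_K\}$ be the lattice of Hermitian matrices with entries in $\mathcal O_K$. For a subgroup $G<\mathrm{GL}_4(\mathbb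 R)$ write $G(\mathbb Z)=\{g\in G: gL_K=L_K\}$. A subgroup $X$ of $\mathrm{GL}_4(\mathbb R)(\mathbb Z)$ with Zariski closure $G$ in $\mathrm{GL}_4(\mathbb R)$ is called thin if it has infinite index in $G(\mathbb Z)$. **Theorem.** Let $\mathcal A$ be any weak $K$-Apollonian group. Then $\rho(\mathcal A)$ is contained in $\mathrm O_M(\mathbb Z)$ and is thin. Its Zariski closure is either $\mathrm O_M$ or $\mathrm{SO}_M$, and it has infinite index in $\mathrm O_M(\mathbb Z)$. -/

import Mathlib

open scoped Matrix MatrixGroups OnePoint NumberField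

noncomputable section

namespace Apollonian

/-! ### Zariski closure and thin groups of real matrices -/

section Thin

variable {n : Type*} [Fintype n] [DecidableEq n]

/-- The value of a polynomial in the entries of an `n × n` matrix at an invertible matrix `g`. -/
def evalAt (g : GL n ℝ) (p : MvPolynomial (n × n) ℝ) : ℝ :=
  MvPolynomial.eval (fun ij : n × n => (g : Matrix n n ℝ) ij.1 ij.2) p

theorem exists_translate (x y : GL n ℝ) (p : MvPolynomial (n × n) ℝ) :
    ∃ q : MvPolynomial (n × n) ℝ, ∀ g : GL n ℝ, evalAt g q = evalAt (x * g * y) p := by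
  refine ⟨MvPolynomial.bind₁ (fun ij : n × n => ∑ k, (∑ l,
    MvPolynomial.C ((x : Matrix n n ℝ) ij.1 l) * MvPolynomial.X (l, k)) *
      MvPolynomial.C ((y : Matrix n n ℝ) k ij.2)) p, fun g => ?_⟩
  simp only [evalAt, MvPolynomial.eval, MvPolynomial.eval₂Hom_bind₁]
  congr 2
  funext ij
  simp [Matrix.mul_apply]

theorem exists_inverse (p : MvPolynomial (n × n) ℝ) :
    ∃ (q : MvPolynomial (n × n) ℝ) (d : ℕ), ∀ g : GL n ℝ,
      evalAt g q = (g : Matrix n n ℝ).det ^ d * evalAt g⁻¹ p := by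
  induction p using MvPolynomial.induction_on with
  | C a => exact ⟨MvPolynomial.C a, 0, fun g => by simp [evalAt]⟩
  | add p₁ p₂ h₁ h₂ =>
    obtain ⟨q₁, d₁, h₁⟩ := h₁
    obtain ⟨q₂, d₂, h₂⟩ := h₂
    let D : MvPolynomial (n × n) ℝ := (Matrix.of fun i j => MvPolynomial.X (i, j)).det
    have hD : ∀ g : GL n ℝ, evalAt g D = (g : Matrix n n ℝ).det := by
      intro g
      simp only [evalAt, D, RingHom.map_det]
      congr 1
      ext i j
      simp
    refine ⟨D ^ d₂ * q₁ + D ^ d₁ * q₂, d₁ + d₂, fun g => ?_⟩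
    have e₁ := h₁ g
    have e₂ := h₂ g
    have e₃ := hD g
    simp only [evalAt, map_add, map_mul, map_pow] at *
    rw [e₁, e₂, e₃]
    ring
  | mul_X p ij h =>
    obtain ⟨q, d, h⟩ := h
    let B : MvPolynomial (n × n) ℝ :=
      (Matrix.of fun i j => (MvPolynomial.X (i, j) : MvPolynomial (n × n) ℝ)).adjugate ij.1 ij.2
    have hB : ∀ g : GL n ℝ, evalAt g B = (g : Matrix n n ℝ).adjugate ij.1 ij.2 := by
      intro g
      have := congrFun (congrFun (RingHom.map_adjugate
        (MvPolynomial.eval (fun ij : n × n => (g : Matrix n n ℝ) ij.1 ij.2))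
        (Matrix.of fun i j => (MvPolynomial.X (i, j) : MvPolynomial (n × n) ℝ))) ij.1) ij.2
      simp only [RingHom.mapMatrix_apply, Matrix.map_apply] at this
      simp only [evalAt, B, this]
      congr 1
      ext i j
      simp
    refine ⟨q * B, d + 1, fun g => ?_⟩
    have e₁ := h g
    have e₂ := hB g
    have e₃ : (g : Matrix n n ℝ).adjugate ij.1 ij.2 =
        (g : Matrix n n ℝ).det * ((g⁻¹ : GL n ℝ) : Matrix n n ℝ) ij.1 ij.2 := by
      have hu : IsUnit (g : Matrix n n ℝ).det := (Matrix.isUnit_iff_isUnit_det _).1 g.isUnit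
      rw [Matrix.coe_units_inv, Matrix.inv_def, Matrix.smul_apply, smul_eq_mul, ← mul_assoc,
        Ring.mul_inverse_cancel _ hu, one_mul]
    simp only [evalAt, map_mul, MvPolynomial.eval_X] at *
    rw [e₁, e₂, e₃]
    ring

/-- The Zariski closure in `GL n ℝ` of a subgroup `H`: the invertible matrices at which every
polynomial in the matrix entries that vanishes on `H` vanishes. -/
def zariskiClosure (H : Subgroup (GL n ℝ)) : Subgroup (GL n ℝ) where
  carrier := {g | ∀ p : MvPolynomial (n × n) ℝ, (∀ h ∈ H, evalAt h p = 0) → evalAt g p = 0}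
  one_mem' := fun p hp => hp 1 H.one_mem
  mul_mem' := by
    intro a b ha hb p hp
    obtain ⟨q, hq⟩ := exists_translate a 1 p
    rw [← mul_one (a * b), ← hq]
    refine hb q fun h hh => ?_
    obtain ⟨r, hr⟩ := exists_translate 1 h p
    rw [hq, mul_one, ← one_mul a, ← hr]
    refine ha r fun k hk => ?_
    rw [hr, one_mul]
    exact hp _ (H.mul_mem hk hh)
  inv_mem' := by
    intro a ha p hp
    obtain ⟨q, d, hq⟩ := exists_inverse p
    have h0 : evalAt a q = 0 := ha q fun h hh => by rw [hq, hp _ (H.inv_mem hh), mul_zero]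
    rw [hq] at h0
    have hu : IsUnit (a : Matrix n n ℝ).det := (Matrix.isUnit_iff_isUnit_det _).1 a.isUnit
    exact (mul_eq_zero.1 h0).resolve_left (pow_ne_zero _ hu.ne_zero)

/-- The invertible matrices `g` with `g L = L`. When `L` is a lattice, this is the group of
integral points of `GL n` for the integral structure given by `L`; for `L = ℤⁿ` it is `GL n ℤ`. -/
def integralPoints (L : AddSubgroup (n → ℝ)) : Subgroup (GL n ℝ) where
  carrier := {g | ∀ v : n → ℝ, (g : Matrix n n ℝ) *ᵥ v ∈ L ↔ v ∈ L}
  one_mem' := by intro v; simp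
  mul_mem' := by
    intro a b ha hb v
    rw [Units.val_mul, ← Matrix.mulVec_mulVec, ha, hb]
  inv_mem' := by
    intro a ha v
    rw [← ha, Matrix.mulVec_mulVec, ← Units.val_mul, mul_inv_cancel, Units.val_one,
      Matrix.one_mulVec]

/-- A subgroup `H` of the integral points (for the integral structure `L`) is thin if it has
infinite index in the group of integral points of its Zariski closure. -/
def IsThin (L : AddSubgroup (n → ℝ)) (H : Subgroup (GL n ℝ)) : Prop :=
  H ≤ integralPoints L ∧ ¬ H.IsFiniteRelIndex (zariskiClosure H ⊓ integralPoints L)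

end Thin

/-! ### Minkowski space -/

/-- The Gram matrix of the form `-b' b + r ^ 2 + m ^ 2` on vectors `(b', b, r, m)`. -/
def gramM : Matrix (Fin 4) (Fin 4) ℝ :=
  !![0, -(1 / 2), 0, 0; -(1 / 2), 0, 0, 0; 0, 0, 1, 0; 0, 0, 0, 1]

/-- The orthogonal group `O_M(ℝ)` of the form with Gram matrix `gramM`. -/
def OM : Subgroup (GL (Fin 4) ℝ) where
  carrier := {g | (g : Matrix (Fin 4) (Fin 4) ℝ)ᵀ * gramM * (g : Matrix (Fin 4) (Fin 4) ℝ) = gramM}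
  one_mem' := by simp
  mul_mem' := by
    intro a b ha hb
    simp only [Set.mem_ofPred_eq, Units.val_mul, Matrix.transpose_mul] at *
    calc _ = (b : Matrix (Fin 4) (Fin 4) ℝ)ᵀ * ((a : Matrix (Fin 4) (Fin 4) ℝ)ᵀ * gramM *
          (a : Matrix (Fin 4) (Fin 4) ℝ)) * (b : Matrix (Fin 4) (Fin 4) ℝ) := by
          simp only [Matrix.mul_assoc]
      _ = _ := by rw [ha, hb]
  inv_mem' := by
    intro a ha
    simp only [Set.mem_ofPred_eq] at *
    have h : (a : Matrix (Fin 4) (Fin 4) ℝ) * ((a⁻¹ : GL (Fin 4) ℝ) : Matrix (Fin 4) (Fin 4) ℝ)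
        = 1 := by rw [← Units.val_mul, mul_inv_cancel, Units.val_one]
    have h' := congrArg Matrix.transpose h
    rw [Matrix.transpose_mul, Matrix.transpose_one] at h'
    conv_lhs => rw [← ha]
    calc _ = (((a⁻¹ : GL (Fin 4) ℝ) : Matrix (Fin 4) (Fin 4) ℝ)ᵀ *
          (a : Matrix (Fin 4) (Fin 4) ℝ)ᵀ) * gramM * ((a : Matrix (Fin 4) (Fin 4) ℝ) *
          ((a⁻¹ : GL (Fin 4) ℝ) : Matrix (Fin 4) (Fin 4) ℝ)) := by
          simp only [Matrix.mul_assoc]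
      _ = _ := by rw [h, h', Matrix.one_mul, Matrix.mul_one]

/-- The special orthogonal group `SO_M(ℝ)`. -/
def SOM : Subgroup (GL (Fin 4) ℝ) := OM ⊓ Matrix.GeneralLinearGroup.det.ker

/-- The Hermitian matrix with coordinates `(b', b, r, m)`. -/
def toHerm (v : Fin 4 → ℝ) : Matrix (Fin 2) (Fin 2) ℂ :=
  !![(v 0 : ℂ), v 2 + v 3 * Complex.I; v 2 - v 3 * Complex.I, (v 1 : ℂ)]

/-- The coordinates `(b', b, r, m)` of a Hermitian matrix. -/
def ofHerm (T : Matrix (Fin 2) (Fin 2) ℂ) : Fin 4 → ℝ :=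
  ![(T 0 0).re, (T 1 1).re, (T 0 1).re, (T 0 1).im]

theorem ofHerm_toHerm (v : Fin 4 → ℝ) : ofHerm (toHerm v) = v := by
  ext i
  fin_cases i <;> simp [ofHerm, toHerm]

theorem toHerm_ofHerm {T : Matrix (Fin 2) (Fin 2) ℂ} (hT : T.IsHermitian) :
    toHerm (ofHerm T) = T := by
  have h00 := congrArg Complex.im (hT.apply 0 0)
  have h11 := congrArg Complex.im (hT.apply 1 1)
  have h10 := hT.apply 1 0
  simp only [Complex.star_def, Complex.conj_im] at h00 h11
  rw [Complex.star_def] at h10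
  ext i j
  fin_cases i <;> fin_cases j <;> apply Complex.ext <;>
    simp [ofHerm, toHerm, ← h10] <;> linarith

theorem toHerm_isHermitian (v : Fin 4 → ℝ) : (toHerm v).IsHermitian := by
  ext i j
  fin_cases i <;> fin_cases j <;> apply Complex.ext <;> simp [toHerm]

/-! ### The group of Möbius transformations and reflections, and its map to `O_M(ℝ)` -/

theorem algEquiv_star (σ : ℂ ≃ₐ[ℝ] ℂ) (z : ℂ) : σ (star z) = star (σ z) := by
  rcases Complex.real_algHom_eq_id_or_conj (σ : ℂ →ₐ[ℝ] ℂ) with h | h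
  · have h' : ∀ w, σ w = w := fun w => DFunLike.congr_fun h w
    rw [h', h']
  · have h' : ∀ w, σ w = star w := fun w => DFunLike.congr_fun h w
    rw [h', h']

/-- `Gal(ℂ/ℝ)`, the group of the identity and of complex conjugation, acting on `SL(2, ℂ)`
entry by entry. -/
def galAct : (ℂ ≃ₐ[ℝ] ℂ) →* MulAut SL(2, ℂ) where
  toFun σ :=
    { toFun := Matrix.SpecialLinearGroup.map (σ : ℂ →+* ℂ)
      invFun := Matrix.SpecialLinearGroup.map (σ.symm : ℂ →+* ℂ)
      left_inv := fun g => by ext i j; simp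
      right_inv := fun g => by ext i j; simp
      map_mul' := fun g h => map_mul _ g h }
  map_one' := by ext; simp
  map_mul' σ τ := by ext; simp

/-- The pairs `(γ, σ)` with `γ ∈ SL(2, ℂ)` and `σ` the identity or complex conjugation, multiplied
as the transformations `z ↦ γ (σ z)`. -/
abbrev ExtSL : Type := SL(2, ℂ) ⋊[galAct] (ℂ ≃ₐ[ℝ] ℂ)

/-- `Gal(ℂ/ℝ)` acting on the Riemann sphere, with `∞` fixed. -/
def galPerm : (ℂ ≃ₐ[ℝ] ℂ) →* Equiv.Perm (OnePoint ℂ) where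
  toFun σ :=
    { toFun := OnePoint.map σ
      invFun := OnePoint.map σ.symm
      left_inv := fun z => by cases z <;> simp
      right_inv := fun z => by cases z <;> simp }
  map_one' := by
    ext z
    cases z <;> rfl
  map_mul' σ τ := by
    ext z
    cases z <;> rfl

/-- `SL(2, ℂ)` acting on the Riemann sphere by Möbius transformations
`z ↦ (α z + γ) / (β z + δ)`. -/
def mobPerm : SL(2, ℂ) →* Equiv.Perm (OnePoint ℂ) :=
  (MulAction.toPermHom (GL (Fin 2) ℂ) (OnePoint ℂ)).comp Matrix.SpecialLinearGroup.toGL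

theorem mobPerm_apply (γ : SL(2, ℂ)) (z : OnePoint ℂ) :
    mobPerm γ z = Matrix.SpecialLinearGroup.toGL γ • z := rfl

/-- The pair `(γ, σ)` acts on the Riemann sphere as `z ↦ γ (σ z)`. -/
def toPerm : ExtSL →* Equiv.Perm (OnePoint ℂ) :=
  SemidirectProduct.lift mobPerm galPerm (by
    intro σ
    refine MonoidHom.ext fun γ => ?_
    change mobPerm (galAct σ γ) = galPerm σ * mobPerm γ * (galPerm σ)⁻¹
    rw [eq_mul_inv_iff_mul_eq]
    refine Equiv.ext fun z => ?_
    exact (OnePoint.map_smul (σ : ℂ →+* ℂ) (Matrix.SpecialLinearGroup.toGL γ) z).symm)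

theorem toPerm_apply (e : ExtSL) (z : OnePoint ℂ) :
    toPerm e z = Matrix.SpecialLinearGroup.toGL e.left • OnePoint.map e.right z := rfl

/-- The action `T ↦ γ σ(T) γ†` of the pair `(γ, σ)` on Hermitian matrices. -/
def hermAct (e : ExtSL) (T : Matrix (Fin 2) (Fin 2) ℂ) : Matrix (Fin 2) (Fin 2) ℂ :=
  (e.left : Matrix (Fin 2) (Fin 2) ℂ) * T.map e.right * (e.left : Matrix (Fin 2) (Fin 2) ℂ)ᴴ

theorem hermAct_isHermitian (e : ExtSL) {T : Matrix (Fin 2) (Fin 2) ℂ} (hT : T.IsHermitian) :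
    (hermAct e T).IsHermitian := by
  have h : (T.map e.right).IsHermitian := by
    ext i j
    rw [Matrix.conjTranspose_apply, Matrix.map_apply, Matrix.map_apply, ← algEquiv_star,
      hT.apply]
  exact Matrix.isHermitian_mul_mul_conjTranspose _ h

theorem hermAct_mul (e f : ExtSL) (T : Matrix (Fin 2) (Fin 2) ℂ) :
    hermAct (e * f) T = hermAct e (hermAct f T) := by
  have h1 : ((e * f).left : Matrix (Fin 2) (Fin 2) ℂ) =
      (e.left : Matrix (Fin 2) (Fin 2) ℂ) *
        (f.left : Matrix (Fin 2) (Fin 2) ℂ).map e.right := by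
    ext i j
    rfl
  have h2 : T.map (e * f).right = (T.map f.right).map e.right := by
    ext i j
    rfl
  have h3 : ((f.left : Matrix (Fin 2) (Fin 2) ℂ)ᴴ).map e.right =
      ((f.left : Matrix (Fin 2) (Fin 2) ℂ).map e.right)ᴴ := by
    ext i j
    simp only [Matrix.map_apply, Matrix.conjTranspose_apply, algEquiv_star]
  have h4 : ∀ A B : Matrix (Fin 2) (Fin 2) ℂ,
      (A * B).map e.right = A.map e.right * B.map e.right := fun A B => Matrix.map_mul
  simp only [hermAct, h1, h2, h3, h4, Matrix.conjTranspose_mul, Matrix.mul_assoc]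

/-- The action on Hermitian matrices as an action on vectors `(b', b, r, m)`. -/
def vecAct : ExtSL →* Module.End ℝ (Fin 4 → ℝ) where
  toFun e :=
    { toFun := fun v => ofHerm (hermAct e (toHerm v))
      map_add' := fun v w => by
        have h : toHerm (v + w) = toHerm v + toHerm w := by
          ext i j
          fin_cases i <;> fin_cases j <;> simp [toHerm] <;> ring
        have h' : (toHerm v + toHerm w).map e.right =
            (toHerm v).map e.right + (toHerm w).map e.right := by
          ext i j
          simp
        ext i
        rw [h]
        simp only [hermAct, h', Matrix.mul_add, Matrix.add_mul]
        fin_cases i <;> simp [ofHerm]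
      map_smul' := fun c v => by
        have h : toHerm (c • v) = c • toHerm v := by
          ext i j
          fin_cases i <;> fin_cases j <;> simp [toHerm] <;> ring
        have h' : (c • toHerm v).map e.right = c • (toHerm v).map e.right := by
          ext i j
          exact e.right.toLinearMap.map_smul c _
        ext i
        rw [h]
        simp only [hermAct, h', Matrix.mul_smul, Matrix.smul_mul]
        fin_cases i <;> simp [ofHerm] }
  map_one' := by
    refine LinearMap.ext fun v => ?_
    change ofHerm (hermAct 1 (toHerm v)) = v
    have h : (toHerm v).map (1 : ExtSL).right = toHerm v := by
      ext i j
      rfl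
    simp only [hermAct, h, SemidirectProduct.one_left, Matrix.SpecialLinearGroup.coe_one,
      Matrix.conjTranspose_one, Matrix.one_mul, Matrix.mul_one, ofHerm_toHerm]
  map_mul' e f := by
    refine LinearMap.ext fun v => ?_
    change ofHerm (hermAct (e * f) (toHerm v)) =
      ofHerm (hermAct e (toHerm (ofHerm (hermAct f (toHerm v)))))
    rw [toHerm_ofHerm (hermAct_isHermitian f (toHerm_isHermitian v)), hermAct_mul]

/-- The matrix, in the coordinates `(b', b, r, m)`, of the action of `(γ, σ)` on Hermitian
matrices. -/
def extRho : ExtSL →* GL (Fin 4) ℝ :=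
  MonoidHom.toHomUnits
    ((LinearMap.toMatrixAlgEquiv' (R := ℝ) (n := Fin 4) : _ →* Matrix (Fin 4) (Fin 4) ℝ).comp
      vecAct)

theorem extRho_mulVec (e : ExtSL) (v : Fin 4 → ℝ) :
    (extRho e : Matrix (Fin 4) (Fin 4) ℝ) *ᵥ v = ofHerm (hermAct e (toHerm v)) :=
  LinearMap.toMatrix'_mulVec (vecAct e) v

theorem ker_toPerm_le : toPerm.ker ≤ extRho.ker := by
  intro e he
  have key : ∀ z : OnePoint ℂ,
      Matrix.SpecialLinearGroup.toGL e.left • OnePoint.map e.right z = z := by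
    intro z
    rw [← toPerm_apply, MonoidHom.mem_ker.1 he]
    rfl
  have h1 := key ∞
  have h2 := key ((0 : ℂ) : OnePoint ℂ)
  have h3 := key ((1 : ℂ) : OnePoint ℂ)
  have h4 := key (Complex.I : OnePoint ℂ)
  have hdet := e.left.det_coe
  rw [Matrix.det_fin_two] at hdet
  rw [OnePoint.map_infty, OnePoint.smul_infty_eq_self_iff] at h1
  rw [OnePoint.map_some, OnePoint.smul_some_eq_ite] at h2 h3 h4
  simp only [Matrix.SpecialLinearGroup.coe_GL_coe_matrix] at h1 h2 h3 h4
  simp only [h1, map_zero, map_one, mul_zero, zero_mul, mul_one, zero_add, sub_zero] at h2 h3 h4 hdet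
  have hd : (e.left : Matrix (Fin 2) (Fin 2) ℂ) 1 1 ≠ 0 := right_ne_zero_of_mul (by rw [hdet]; simp)
  rw [if_neg hd, OnePoint.coe_eq_coe] at h2 h3 h4
  have hb : (e.left : Matrix (Fin 2) (Fin 2) ℂ) 0 1 = 0 := (div_eq_zero_iff.1 h2).resolve_right hd
  rw [hb, add_zero, div_eq_one_iff_eq hd] at h3
  rw [hb, add_zero, h3, mul_div_cancel_left₀ _ hd] at h4
  rw [h3] at hdet
  have hσ : ∀ w, e.right w = w := by
    rcases Complex.real_algHom_eq_id_or_conj (e.right : ℂ →ₐ[ℝ] ℂ) with h | h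
    · exact fun w => DFunLike.congr_fun h w
    · have h' : e.right Complex.I = star Complex.I := DFunLike.congr_fun h Complex.I
      rw [h4] at h'
      have := congrArg Complex.im h'
      simp at this
      linarith
  rw [MonoidHom.mem_ker]
  apply Units.ext
  have hmat : (e.left : Matrix (Fin 2) (Fin 2) ℂ) =
      (e.left : Matrix (Fin 2) (Fin 2) ℂ) 1 1 • (1 : Matrix (Fin 2) (Fin 2) ℂ) := by
    ext i j
    fin_cases i <;> fin_cases j <;> simp [h1, hb, h3]
  have hnorm : (e.left : Matrix (Fin 2) (Fin 2) ℂ) 1 1 *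
      star ((e.left : Matrix (Fin 2) (Fin 2) ℂ) 1 1) = 1 := by
    rcases mul_self_eq_one_iff.1 hdet with h | h <;> rw [h] <;> simp
  refine Matrix.ext_of_mulVec_single fun i => ?_
  rw [extRho_mulVec, Units.val_one, Matrix.one_mulVec]
  have hT : (toHerm (Pi.single i 1)).map e.right = toHerm (Pi.single i 1) := by
    ext k l
    exact hσ _
  rw [hermAct, hT, hmat, Matrix.conjTranspose_smul, Matrix.conjTranspose_one, Matrix.smul_mul,
    Matrix.one_mul, Matrix.mul_smul, Matrix.mul_one, smul_smul, mul_comm, hnorm, one_smul,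
    ofHerm_toHerm]

/-- The group `Möb` of all Möbius transformations and reflections of the Riemann sphere. -/
def Mob : Subgroup (Equiv.Perm (OnePoint ℂ)) := toPerm.range

/-- The homomorphism `ρ : Möb → O_M(ℝ)` under which `z ↦ γ (σ z)` acts on Hermitian matrices by
`T ↦ γ σ(T) γ†`. -/
def rho : Mob →* GL (Fin 4) ℝ :=
  (QuotientGroup.lift toPerm.ker extRho ker_toPerm_le).comp
    (QuotientGroup.quotientKerEquivRange toPerm).symm.toMonoidHom

theorem rho_toPerm (e : ExtSL) : rho ⟨toPerm e, e, rfl⟩ = extRho e := by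
  have h : (QuotientGroup.quotientKerEquivRange toPerm).symm ⟨toPerm e, e, rfl⟩ =
      (QuotientGroup.mk e : ExtSL ⧸ toPerm.ker) := by
    rw [MulEquiv.symm_apply_eq]
    rfl
  change QuotientGroup.lift toPerm.ker extRho ker_toPerm_le
    ((QuotientGroup.quotientKerEquivRange toPerm).symm ⟨toPerm e, e, rfl⟩) = _
  rw [h]
  rfl

/-! ### Circles and the Schmidt arrangement -/

/-- A matrix in `SL(2, ℂ)` as a Möbius transformation. -/
def slToMob : SL(2, ℂ) →* Mob := toPerm.rangeRestrict.comp SemidirectProduct.inl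

/-- Complex conjugation, as an element of `Möb`. -/
def conjugation : Mob := toPerm.rangeRestrict (SemidirectProduct.inr Complex.conjAe)

/-- The extended real line, a circle in the Riemann sphere. -/
def realCircle : Set (OnePoint ℂ) := insert ∞ (Set.range fun x : ℝ => ((x : ℂ) : OnePoint ℂ))

/-- The open upper half plane, as a subset of the Riemann sphere. -/
def upperHalf : Set (OnePoint ℂ) := (fun z : ℂ => (z : OnePoint ℂ)) '' {z | 0 < z.im}

/-- An oriented circle in the Riemann sphere, given by its points and by its interior, the component
of its complement that lies to the left in the direction of travel. Every such pair is the image of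
the real line, travelled to the right, under a Möbius transformation. -/
@[ext]
structure OrientedCircle where
  carrier : Set (OnePoint ℂ)
  interior : Set (OnePoint ℂ)
  exists_eq_image : ∃ γ : SL(2, ℂ),
    carrier = (slToMob γ : Equiv.Perm (OnePoint ℂ)) '' realCircle ∧
    interior = (slToMob γ : Equiv.Perm (OnePoint ℂ)) '' upperHalf

/-- The exterior of an oriented circle: the other component of its complement. -/
def OrientedCircle.exterior (C : OrientedCircle) : Set (OnePoint ℂ) :=
  (C.carrier ∪ C.interior)ᶜ

/-- The extended real line with positive orientation; its interior is the upper half plane. -/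
def realOriented : OrientedCircle where
  carrier := realCircle
  interior := upperHalf
  exists_eq_image := ⟨1, by simp⟩

section Schmidt

variable {K : Type*} [Field K] (φ : K →+* ℂ)

/-- The homomorphism `SL(2, 𝓞 K) → Möb` given by a complex embedding of `K`. -/
def bianchiHom : SL(2, 𝓞 K) →* Mob :=
  slToMob.comp (Matrix.SpecialLinearGroup.map (φ.comp (algebraMap (𝓞 K) K)))

/-- The Bianchi group `PSL(2, 𝓞 K)`, as a subgroup of `Möb`. -/
def bianchiGroup : Subgroup Mob := (bianchiHom φ).range

/-- The group generated by the Bianchi group and complex conjugation. -/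
def extendedBianchiGroup : Subgroup Mob := Subgroup.closure (bianchiGroup φ ∪ {conjugation})

/-- The Schmidt arrangement with orientations: the oriented circles, of either orientation, whose
underlying circle is the image of the extended real line under an element of `PSL(2, 𝓞 K)`. -/
def schmidt : Set OrientedCircle :=
  {C | ∃ g ∈ bianchiGroup φ, C.carrier = (g : Equiv.Perm (OnePoint ℂ)) '' realCircle}

/-- A set of points straddles an oriented circle if it meets its interior and its exterior. -/
def Straddles (S : Set (OnePoint ℂ)) (D : OrientedCircle) : Prop :=
  (S ∩ D.interior).Nonempty ∧ (S ∩ D.exterior).Nonempty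

/-- Two oriented circles are externally tangent if they have exactly one point in common and
disjoint interiors. -/
def ExternallyTangent (C C' : OrientedCircle) : Prop :=
  (∃ x, C.carrier ∩ C'.carrier = {x}) ∧ Disjoint C.interior C'.interior

/-- Two circles of the Schmidt arrangement are immediately tangent if they are externally tangent
and together straddle no circle of the Schmidt arrangement. -/
def ImmediatelyTangent (C C' : OrientedCircle) : Prop :=
  C ∈ schmidt φ ∧ C' ∈ schmidt φ ∧ ExternallyTangent C C' ∧
    ∀ D ∈ schmidt φ, ¬ Straddles (C.carrier ∪ C'.carrier) D

theorem ImmediatelyTangent.symm {C C' : OrientedCircle} (h : ImmediatelyTangent φ C C') :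
    ImmediatelyTangent φ C' C := by
  obtain ⟨h1, h2, ⟨⟨x, hx⟩, hd⟩, hs⟩ := h
  refine ⟨h2, h1, ⟨⟨x, by rw [Set.inter_comm, hx]⟩, hd.symm⟩, fun D hD => ?_⟩
  rw [Set.union_comm]
  exact hs D hD

/-- A set of circles of the Schmidt arrangement is closed under immediate tangency if it contains
every circle immediately tangent to one of its members. -/
def ClosedUnderTangency (P : Set OrientedCircle) : Prop :=
  P ⊆ schmidt φ ∧ ∀ C ∈ P, ∀ C', ImmediatelyTangent φ C C' → C' ∈ P

/-- A `K`-Apollonian packing: a minimal non-empty set of oriented circles of the Schmidt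
arrangement that is closed under immediate tangency. -/
def IsApollonianPacking (P : Set OrientedCircle) : Prop :=
  Minimal (fun Q => Q.Nonempty ∧ ClosedUnderTangency φ Q) P

/-- The fundamental packing: the circles reached from the positively oriented real line by finitely
many immediate tangencies. -/
def fundamentalPacking : Set OrientedCircle :=
  {C | Relation.ReflTransGen (ImmediatelyTangent φ) realOriented C}

/-- The fundamental packing is the only `K`-Apollonian packing containing the positively oriented
real line. -/
theorem isApollonianPacking_iff (P : Set OrientedCircle) :
    IsApollonianPacking φ P ∧ realOriented ∈ P ↔ P = fundamentalPacking φ := by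
  have h0 : realOriented ∈ schmidt φ := ⟨1, (bianchiGroup φ).one_mem, by simp [realOriented]⟩
  have hF : ClosedUnderTangency φ (fundamentalPacking φ) := by
    refine ⟨fun C hC => ?_, fun C hC C' h => Relation.ReflTransGen.tail hC h⟩
    rcases Relation.ReflTransGen.cases_tail hC with h | ⟨_, _, h⟩
    · exact h ▸ h0
    · exact h.2.1
  have hmin : ∀ Q, ClosedUnderTangency φ Q → realOriented ∈ Q → fundamentalPacking φ ⊆ Q := by
    intro Q hQ hr C hC
    induction hC with
    | refl => exact hr
    | tail _ h ih => exact hQ.2 _ ih _ h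
  have hr : realOriented ∈ fundamentalPacking φ := Relation.ReflTransGen.refl
  constructor
  · rintro ⟨hP, hrP⟩
    exact Set.Subset.antisymm (hP.2 ⟨⟨_, hr⟩, hF⟩ (hmin P hP.1.2 hrP)) (hmin P hP.1.2 hrP)
  · rintro rfl
    refine ⟨⟨⟨⟨_, hr⟩, hF⟩, ?_⟩, hr⟩
    rintro Q ⟨⟨C, hC⟩, hQ⟩ hle
    refine hmin Q hQ ?_
    have hCF : Relation.ReflTransGen (ImmediatelyTangent φ) realOriented C := hle hC
    have hback : ∀ D, Relation.ReflTransGen (ImmediatelyTangent φ) D C → D ∈ Q := by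
      intro D hD
      induction hD using Relation.ReflTransGen.head_induction_on with
      | refl => exact hC
      | head h _ ih => exact hQ.2 _ ih _ h.symm
    exact hback _ hCF

/-! ### Weak Apollonian groups -/

/-- The limit set of a subgroup of `Möb`: the set of accumulation points of the orbit of `0`. -/
def limitSet (A : Subgroup Mob) : Set (OnePoint ℂ) :=
  derivedSet {z | ∃ g ∈ A, (g : Equiv.Perm (OnePoint ℂ)) ((0 : ℂ) : OnePoint ℂ) = z}

/-- A Kleinian group: a discrete subgroup of `Möb`, with the topology `Möb` has as a subgroup of
`O_M(ℝ)`. -/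
def IsKleinian (A : Subgroup Mob) : Prop := DiscreteTopology (A.map rho)

/-- A weak `K`-Apollonian group: a finitely generated Kleinian subgroup of the group generated by
`PSL(2, 𝓞 K)` and complex conjugation, whose limit set is the closure of the fundamental packing. -/
structure IsWeakApollonian (A : Subgroup Mob) : Prop where
  le : A ≤ extendedBianchiGroup φ
  fg : A.FG
  kleinian : IsKleinian A
  limitSet_eq : limitSet A = closure (⋃ C ∈ fundamentalPacking φ, C.carrier)

/-- The lattice of vectors `(b', b, r, m)` with `b', b ∈ ℤ` and `r + m i ∈ 𝓞 K`, that is, of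
Hermitian matrices with entries in `𝓞 K`. It gives `O_M` its integral structure. -/
def hermLattice : AddSubgroup (Fin 4 → ℝ) where
  carrier := {v | (∃ k : ℤ, v 0 = k) ∧ (∃ k : ℤ, v 1 = k) ∧
    ∃ x : 𝓞 K, φ (x : K) = v 2 + v 3 * Complex.I}
  zero_mem' := ⟨⟨0, by simp⟩, ⟨0, by simp⟩, 0, by simp⟩
  add_mem' := by
    rintro v w ⟨⟨a, ha⟩, ⟨b, hb⟩, x, hx⟩ ⟨⟨a', ha'⟩, ⟨b', hb'⟩, x', hx'⟩
    refine ⟨⟨a + a', by simp [ha, ha']⟩, ⟨b + b', by simp [hb, hb']⟩, x + x', ?_⟩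
    simp [hx, hx']
    ring
  neg_mem' := by
    rintro v ⟨⟨a, ha⟩, ⟨b, hb⟩, x, hx⟩
    refine ⟨⟨-a, by simp [ha]⟩, ⟨-b, by simp [hb]⟩, -x, ?_⟩
    simp [hx]
    ring

/-- The group `O_M(ℤ)`: the elements of `O_M(ℝ)` that map the lattice `hermLattice` onto itself. -/
def OMInt : Subgroup (GL (Fin 4) ℝ) := OM ⊓ integralPoints (hermLattice φ)

end Schmidt

end Apollonian

end

noncomputable section

namespace Apollonian

/-! ### Homogeneous coordinates on the Riemann sphere -/

open Filter Topology

/-! The theorem has two halves: infinite index, and Zariski density in `SO_M`.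

Infinite index. The circles of the fundamental packing never enter the upper half plane: a chain of
immediate tangencies that did so would contain a circle around the whole half plane, and the
condition on straddling forbids it (`below_of_mem_fundamentalPacking`). So the limit set of `A`
misses the upper half plane. If `ω` is an integer of `K` with positive imaginary part, some integral
parabolic element of `SO_M` fixes `-1 / ω`, which is in the upper half plane. Were `A` of finite
relative index in a group containing this element, a positive power of it would lie in `A`, and its
fixed point would be a limit point (`exists_forall_not_isFiniteRelIndex`). The same element serves
for `O_M(ℤ)` and, once the Zariski closure is known to contain `SO_M`, for the integral points of
that closure.

Zariski density. Let `t` be the real Lie algebra of `2 × 2` complex matrices whose image under the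
differential of `ρ` is tangent to the Zariski closure, and let `Γ` be the orientation-preserving
part of `A`, lifted to matrices over the integers of `K`. Rescaled elements of `Γ` that go to
infinity converge to singular matrices `M`, and the accumulation points of orbits are controlled by
the images of such `M`. A loxodromic element of `Γ` puts its hyperbolic generator `X` in `t`: a
polynomial that vanishes on the powers of the element vanishes on the whole split torus. Since `t`
is stable under conjugation by `Γ`, the limits `M h X adj(M h)` are again in `t`; they are nilpotent
and kill the image of `M`. If all of them vanished, some orbit would consist of fixed points of the
loxodromic element, which discreteness excludes as soon as there are three limit points. Hence every
limit point is the kernel of a nonzero nilpotent element of `t`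
(`accumulationSet_subset_nilpotentKernels`).

The real line is in the packing. Outside `ℚ(√-3)` the smallest positive imaginary part `h` of an
integer is at least `1`, and then the horizontal line at height `-h` is immediately tangent to the
real line. So `0`, `1`, `∞` and `1 - h i` are limit points. Double brackets of the four nilpotents,
together with `(1 - h i) ^ 2` not being real, give all strictly triangular matrices
(`triangular_mem_of_nilpotentKernels`). Their exponentials and the split torus generate `SO_M`,
which has index two in `O_M`. -/

/-- The point of the Riemann sphere with homogeneous coordinates `v`. -/
def proj (v : Fin 2 → ℂ) : OnePoint ℂ := if v 1 = 0 then ∞ else ((v 0 / v 1 : ℂ) : OnePoint ℂ)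

/-- Homogeneous coordinates of a point of the Riemann sphere. -/
def lift (z : OnePoint ℂ) : Fin 2 → ℂ := z.elim ![1, 0] (fun z => ![z, 1])

@[simp] theorem lift_infty : lift ∞ = ![1, 0] := rfl
@[simp] theorem lift_coe (z : ℂ) : lift (z : OnePoint ℂ) = ![z, 1] := rfl

theorem lift_ne_zero (z : OnePoint ℂ) : lift z ≠ 0 := by
  induction z using OnePoint.rec with
  | infty => intro h; simpa using congrFun h 0
  | coe z => intro h; simpa using congrFun h 1

@[simp] theorem proj_lift (z : OnePoint ℂ) : proj (lift z) = z := by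
  induction z using OnePoint.rec <;> simp [proj]

theorem proj_smul {c : ℂ} (hc : c ≠ 0) (v : Fin 2 → ℂ) : proj (c • v) = proj v := by
  simp [proj, hc, mul_div_mul_left]

/-- A non-zero vector is a multiple of the chosen coordinates of its point. -/
theorem exists_smul_lift_proj {v : Fin 2 → ℂ} (hv : v ≠ 0) :
    ∃ c : ℂ, c ≠ 0 ∧ v = c • lift (proj v) := by
  by_cases h : v 1 = 0
  · have h0 : v 0 ≠ 0 := fun h0 => hv (by ext i; fin_cases i <;> simp [h, h0])
    refine ⟨v 0, h0, ?_⟩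
    ext i
    fin_cases i <;> simp [proj, h]
  · refine ⟨v 1, h, ?_⟩
    ext i
    fin_cases i <;> simp [proj, h]
    field_simp

theorem proj_eq_iff {v w : Fin 2 → ℂ} (hv : v ≠ 0) (hw : w ≠ 0) :
    proj v = proj w ↔ v 0 * w 1 = v 1 * w 0 := by
  obtain ⟨c, hc, h⟩ := exists_smul_lift_proj hv
  obtain ⟨d, hd, h'⟩ := exists_smul_lift_proj hw
  generalize proj v = x at *
  generalize proj w = y at *
  subst h h'
  induction x using OnePoint.rec <;> induction y using OnePoint.rec <;> simp [hc, hd]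
  rename_i a b
  constructor
  · rintro rfl; ring
  · intro h
    have : c * d * (a - b) = 0 := by linear_combination h
    simpa [hc, hd, sub_eq_zero] using this

theorem mulVec_ne_zero (γ : SL(2, ℂ)) {v : Fin 2 → ℂ} (hv : v ≠ 0) :
    (γ : Matrix (Fin 2) (Fin 2) ℂ) *ᵥ v ≠ 0 := by
  intro h
  apply hv
  have := congrArg (fun w => ((γ⁻¹ : SL(2, ℂ)) : Matrix (Fin 2) (Fin 2) ℂ) *ᵥ w) h
  simpa only [Matrix.mulVec_mulVec, ← Matrix.SpecialLinearGroup.coe_mul, inv_mul_cancel,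
    Matrix.SpecialLinearGroup.coe_one, Matrix.one_mulVec, Matrix.mulVec_zero] using this

theorem mobPerm_eq_proj (γ : SL(2, ℂ)) (z : OnePoint ℂ) :
    mobPerm γ z = proj ((γ : Matrix (Fin 2) (Fin 2) ℂ) *ᵥ lift z) := by
  rw [mobPerm_apply]
  induction z using OnePoint.rec with
  | infty => rw [OnePoint.smul_infty_eq_ite]; simp [proj]; split_ifs <;> simp_all
  | coe z => rw [OnePoint.smul_some_eq_ite]; simp [proj]; split_ifs <;> simp_all

theorem mobPerm_proj (γ : SL(2, ℂ)) {v : Fin 2 → ℂ} (hv : v ≠ 0) :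
    mobPerm γ (proj v) = proj ((γ : Matrix (Fin 2) (Fin 2) ℂ) *ᵥ v) := by
  obtain ⟨c, hc, h⟩ := exists_smul_lift_proj hv
  conv_rhs => rw [h, Matrix.mulVec_smul, proj_smul hc]
  rw [mobPerm_eq_proj]

theorem continuousAt_proj {v : Fin 2 → ℂ} (hv : v ≠ 0) : ContinuousAt proj v := by
  by_cases h : v 1 = 0
  · have h0 : v 0 ≠ 0 := fun h0 => hv (by ext i; fin_cases i <;> simp [h, h0])
    have hp : proj v = ∞ := by simp [proj, h]
    rw [ContinuousAt, hp, (OnePoint.hasBasis_nhds_infty).tendsto_right_iff]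
    rintro s ⟨hs, hs'⟩
    obtain ⟨R, hR, hb⟩ := hs'.isBounded.exists_pos_norm_le
    -- The compact set lies in the ball of radius `R`; the condition `R * ‖w 1‖ < ‖w 0‖` is open,
    -- holds at `v`, and keeps the quotient outside that ball.
    have h1 : Tendsto (fun w : Fin 2 → ℂ => ‖w 0‖ - R * ‖w 1‖) (𝓝 v) (𝓝 (‖v 0‖ - R * ‖v 1‖)) := by
      have : Continuous (fun w : Fin 2 → ℂ => ‖w 0‖ - R * ‖w 1‖) := by fun_prop
      exact this.continuousAt
    have h2 : ∀ᶠ w in 𝓝 v, 0 < ‖w 0‖ - R * ‖w 1‖ := by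
      apply h1.eventually (lt_mem_nhds _)
      simpa [h] using h0
    filter_upwards [h2] with w hw
    by_cases hw1 : w 1 = 0
    · right; simp [proj, hw1]
    · left
      refine ⟨w 0 / w 1, ?_, by simp [proj, hw1]⟩
      intro hmem
      have := hb _ hmem
      rw [norm_div, div_le_iff₀ (by simpa using hw1)] at this
      linarith
  · have : ContinuousAt (fun w : Fin 2 → ℂ => ((w 0 / w 1 : ℂ) : OnePoint ℂ)) v := by
      refine OnePoint.continuous_coe.continuousAt.comp ?_
      exact ContinuousAt.div (continuous_apply 0).continuousAt (continuous_apply 1).continuousAt h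
    refine this.congr ?_
    have h2 : ∀ᶠ w in 𝓝 v, w 1 ≠ 0 := by
      exact (continuous_apply (1 : Fin 2)).continuousAt.eventually_ne h
    filter_upwards [h2] with w hw
    simp [proj, hw]

/-- The quotient `v 0 / v 1` and the product `v 0 * star (v 1)` differ by the positive factor `‖v 1‖
^ 2`, so the side of the real line is the sign of a Hermitian form. -/
theorem mem_upperHalf_iff {v : Fin 2 → ℂ} :
    proj v ∈ upperHalf ↔ 0 < (v 0 * star (v 1)).im := by
  by_cases h : v 1 = 0
  · simp [proj, h, upperHalf]
  · have h1 : 0 < Complex.normSq (v 1) := Complex.normSq_pos.2 h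
    have key : (v 0 / v 1).im = (v 0 * star (v 1)).im / Complex.normSq (v 1) := by
      simp [Complex.div_im]; field_simp; ring
    simp only [proj, h, if_false, upperHalf, Set.mem_image, Set.mem_ofPred_eq, OnePoint.coe_eq_coe,
      exists_eq_right, key]
    constructor
    · intro h2; exact (div_pos_iff_of_pos_right h1).1 h2
    · intro h2; exact div_pos h2 h1

theorem mem_realCircle_iff {v : Fin 2 → ℂ} :
    proj v ∈ realCircle ↔ (v 0 * star (v 1)).im = 0 := by
  by_cases h : v 1 = 0
  · simp [proj, h, realCircle]
  · have h1 : 0 < Complex.normSq (v 1) := Complex.normSq_pos.2 h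
    have key : (v 0 / v 1).im = (v 0 * star (v 1)).im / Complex.normSq (v 1) := by
      simp [Complex.div_im]; field_simp; ring
    have : (v 0 * star (v 1)).im = 0 ↔ (v 0 / v 1).im = 0 := by
      rw [key, div_eq_zero_iff]; simp [h1.ne']
    rw [this]
    simp only [proj, h, if_false, realCircle, Set.mem_insert_iff, OnePoint.coe_ne_infty, false_or,
      Set.mem_range, OnePoint.coe_eq_coe]
    constructor
    · rintro ⟨x, hx⟩; rw [← hx]; simp
    · intro h2; exact ⟨(v 0 / v 1).re, Complex.ext (by simp) (by simp [h2])⟩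

theorem continuous_mobPerm (γ : SL(2, ℂ)) : Continuous (mobPerm γ) := by
  rw [continuous_iff_continuousAt]
  intro z
  induction z using OnePoint.rec with
  | infty =>
    rw [OnePoint.continuousAt_infty', coclosedCompact_eq_cocompact, ← Metric.cobounded_eq_cocompact]
    -- Near `∞` the coordinates `(z, 1)` are rescaled to `(1, z⁻¹)`, which converge.
    have h1 : Tendsto (fun z : ℂ => (γ : Matrix (Fin 2) (Fin 2) ℂ) *ᵥ ![1, z⁻¹])
        (Bornology.cobounded ℂ) (𝓝 ((γ : Matrix (Fin 2) (Fin 2) ℂ) *ᵥ ![1, 0])) := by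
      have h3 : Continuous (fun z : ℂ => (γ : Matrix (Fin 2) (Fin 2) ℂ) *ᵥ ![1, z]) := by fun_prop
      exact (h3.tendsto 0).comp tendsto_inv₀_cobounded
    have h2 := (continuousAt_proj (mulVec_ne_zero γ (lift_ne_zero ∞))).tendsto.comp h1
    rw [mobPerm_eq_proj]
    refine h2.congr' ?_
    filter_upwards [Bornology.eventually_ne_cobounded (0 : ℂ)] with z hz
    have : (![z, 1] : Fin 2 → ℂ) = z • ![1, z⁻¹] := by
      ext i; fin_cases i <;> simp [hz]
    simp only [Function.comp]
    rw [mobPerm_eq_proj, lift_coe, this, Matrix.mulVec_smul, proj_smul hz]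
  | coe z =>
    rw [OnePoint.continuousAt_coe]
    have h1 : ContinuousAt (fun z : ℂ => (γ : Matrix (Fin 2) (Fin 2) ℂ) *ᵥ ![z, 1]) z := by
      have h3 : Continuous (fun z : ℂ => (γ : Matrix (Fin 2) (Fin 2) ℂ) *ᵥ ![z, 1]) := by fun_prop
      exact h3.continuousAt
    have h2 := ContinuousAt.comp (f := fun z : ℂ => (γ : Matrix (Fin 2) (Fin 2) ℂ) *ᵥ ![z, 1])
      (x := z) (continuousAt_proj (mulVec_ne_zero γ (lift_ne_zero (z : OnePoint ℂ)))) h1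
    refine h2.congr (Eventually.of_forall fun w => ?_)
    simp only [Function.comp]
    rw [mobPerm_eq_proj, lift_coe]

/-- A matrix in `SL(2, ℂ)` as a homeomorphism of the Riemann sphere. -/
def mobHomeo (γ : SL(2, ℂ)) : OnePoint ℂ ≃ₜ OnePoint ℂ where
  toEquiv := mobPerm γ
  continuous_toFun := continuous_mobPerm γ
  continuous_invFun := by
    have := continuous_mobPerm γ⁻¹
    rw [map_inv] at this
    exact this

@[simp] theorem coe_mobHomeo (γ : SL(2, ℂ)) : ⇑(mobHomeo γ) = mobPerm γ := rfl

theorem toPerm_inl (γ : SL(2, ℂ)) : toPerm (SemidirectProduct.inl γ) = mobPerm γ :=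
  SemidirectProduct.lift_inl ..

@[simp] theorem coe_slToMob (γ : SL(2, ℂ)) :
    (slToMob γ : Equiv.Perm (OnePoint ℂ)) = mobPerm γ := toPerm_inl γ

/-! ### Half planes as sign conditions of a Hermitian form -/

/-- The Hermitian form that vanishes on the real line and is positive on the upper half plane. -/
def imForm (v : Fin 2 → ℂ) : ℝ := (v 0 * star (v 1)).im

theorem mem_upperHalf (z : OnePoint ℂ) : z ∈ upperHalf ↔ 0 < imForm (lift z) := by
  rw [imForm, ← mem_upperHalf_iff, proj_lift]

theorem mem_realCircle (z : OnePoint ℂ) : z ∈ realCircle ↔ imForm (lift z) = 0 := by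
  rw [imForm, ← mem_realCircle_iff, proj_lift]

theorem mobPerm_mem_upperHalf (γ : SL(2, ℂ)) (z : OnePoint ℂ) :
    mobPerm γ z ∈ upperHalf ↔ 0 < imForm ((γ : Matrix (Fin 2) (Fin 2) ℂ) *ᵥ lift z) := by
  rw [mobPerm_eq_proj, mem_upperHalf_iff, imForm]

theorem mobPerm_mem_realCircle (γ : SL(2, ℂ)) (z : OnePoint ℂ) :
    mobPerm γ z ∈ realCircle ↔ imForm ((γ : Matrix (Fin 2) (Fin 2) ℂ) *ᵥ lift z) = 0 := by
  rw [mobPerm_eq_proj, mem_realCircle_iff, imForm]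

/-- The open lower half plane, as a subset of the Riemann sphere. -/
def lowerHalf : Set (OnePoint ℂ) := (realCircle ∪ upperHalf)ᶜ

theorem isOpen_upperHalf : IsOpen upperHalf :=
  OnePoint.isOpenEmbedding_coe.isOpenMap _ (isOpen_lt continuous_const Complex.continuous_im)

theorem isPreconnected_upperHalf : IsPreconnected upperHalf :=
  (convex_halfSpace_im_gt 0).isPreconnected.image _ OnePoint.continuous_coe.continuousOn

/-- A vector over a boundary point is pushed along a direction in which `imForm` is positive for all
`t > 0`; then `t` tends to zero. -/
theorem realCircle_subset_closure : realCircle ⊆ closure upperHalf := by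
  have key : ∀ v w : Fin 2 → ℂ, v ≠ 0 → (∀ t : ℝ, 0 < t → 0 < imForm (v + (t : ℂ) • w)) →
      proj v ∈ closure upperHalf := by
    intro v w hv h
    have hc : Continuous fun t : ℝ => v + (t : ℂ) • w := by fun_prop
    have h1 : Tendsto (fun t : ℝ => proj (v + (t : ℂ) • w)) (𝓝[>] 0) (𝓝 (proj v)) := by
      refine (continuousAt_proj hv).tendsto.comp ?_
      have := hc.tendsto 0
      simp only [Complex.ofReal_zero, zero_smul, add_zero] at this
      exact this.mono_left nhdsWithin_le_nhds
    refine mem_closure_of_tendsto h1 ?_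
    filter_upwards [self_mem_nhdsWithin] with t ht
    exact mem_upperHalf_iff.2 (h t ht)
  rintro z (rfl | ⟨x, rfl⟩)
  · have := key ![1, 0] ![0, -Complex.I] (lift_ne_zero ∞) (by
      intro t ht; simpa [imForm] using ht)
    rwa [← lift_infty, proj_lift] at this
  · have := key ![x, 1] ![Complex.I, 0] (lift_ne_zero (x : ℂ)) (by
      intro t ht; simpa [imForm] using ht)
    rwa [← lift_coe, proj_lift] at this

/-- The rotation `z ↦ -z`. -/
def negSL : SL(2, ℂ) := ⟨!![Complex.I, 0; 0, -Complex.I], by simp [Matrix.det_fin_two]⟩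

theorem mobPerm_negSL_image : mobPerm negSL '' upperHalf = lowerHalf := by
  have h : ∀ z, mobPerm negSL z ∈ lowerHalf ↔ z ∈ upperHalf := by
    intro z
    rw [lowerHalf, Set.mem_compl_iff, Set.mem_union, mobPerm_mem_realCircle, mobPerm_mem_upperHalf,
      mem_upperHalf]
    have : imForm ((negSL : Matrix (Fin 2) (Fin 2) ℂ) *ᵥ lift z) = - imForm (lift z) := by
      simp [imForm, negSL, Matrix.vecHead, Matrix.vecTail]
    rw [this, not_or, not_lt, neg_nonpos]
    exact ⟨fun h => lt_of_le_of_ne h.2 (by simpa [eq_comm] using h.1), fun h => ⟨by simp [h.ne'], h.le⟩⟩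
  ext z
  constructor
  · rintro ⟨w, hw, rfl⟩; exact (h w).2 hw
  · intro hz
    refine ⟨(mobPerm negSL).symm z, (h _).1 (by simpa using hz), by simp⟩

theorem isOpen_lowerHalf : IsOpen lowerHalf := by
  rw [← mobPerm_negSL_image]
  exact (mobHomeo negSL).isOpenMap _ isOpen_upperHalf

/-- A Möbius transformation that maps the real line into itself preserves the imaginary part of
homogeneous coordinates up to a sign. -/
theorem imForm_mulVec_of_maps (γ : SL(2, ℂ)) (h : mobPerm γ '' realCircle ⊆ realCircle) :
    (∀ v, imForm ((γ : Matrix (Fin 2) (Fin 2) ℂ) *ᵥ v) = imForm v) ∨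
      ∀ v, imForm ((γ : Matrix (Fin 2) (Fin 2) ℂ) *ᵥ v) = - imForm v := by
  have h0 := (mobPerm_mem_realCircle γ _).1
    (h (Set.mem_image_of_mem _ (show ((0 : ℂ) : OnePoint ℂ) ∈ realCircle from
      Or.inr ⟨0, by simp⟩)))
  have h1 := (mobPerm_mem_realCircle γ _).1
    (h (Set.mem_image_of_mem _ (show ((1 : ℂ) : OnePoint ℂ) ∈ realCircle from
      Or.inr ⟨1, by simp⟩)))
  have h2 := (mobPerm_mem_realCircle γ _).1
    (h (Set.mem_image_of_mem _ (show ∞ ∈ realCircle from Or.inl rfl)))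
  have hd := γ.det_coe
  rw [Matrix.det_fin_two] at hd
  generalize hM : (γ : Matrix (Fin 2) (Fin 2) ℂ) = M at *
  simp [imForm] at h0 h1 h2
  have hr := congrArg Complex.re hd
  have hi := congrArg Complex.im hd
  simp at hr hi
  -- Reality at `0`, `∞` and `1` kills every coefficient of the transformed Hermitian form except
  -- that of `imForm`, which is `w`.
  set w := (M 0 0 * star (M 1 1) - star (M 0 1) * M 1 0).re with hw
  have hw2 : w ^ 2 = 1 := by
    have hwi : (M 0 0 * star (M 1 1) - star (M 0 1) * M 1 0).im = 0 := by
      simp; linarith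
    -- The discriminant of the form is `|det M| ^ 2 = 1`, so `w` is a sign.
    have e : (M 0 0 * star (M 1 1) - star (M 0 1) * M 1 0).re ^ 2 +
        (M 0 0 * star (M 1 1) - star (M 0 1) * M 1 0).im ^ 2 =
        ((M 0 0 * M 1 1 - M 0 1 * M 1 0).re ^ 2 + (M 0 0 * M 1 1 - M 0 1 * M 1 0).im ^ 2) +
        4 * (M 0 0 * star (M 1 0)).im * (M 0 1 * star (M 1 1)).im := by
      simp; ring
    rw [hd, hwi, ← hw] at e
    simp at e
    rw [e]
    linear_combination 4 * (-(M 0 1).re * (M 1 1).im + (M 0 1).im * (M 1 1).re) * h2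
  have key : ∀ v, imForm (M *ᵥ v) = w * imForm v := by
    intro v
    simp [imForm, hw]
    linear_combination ((v 0).re ^ 2 + (v 0).im ^ 2) * h2 + ((v 1).re ^ 2 + (v 1).im ^ 2) * h0 +
      ((v 0).re * (v 1).re + (v 0).im * (v 1).im) * (h1 - h2 - h0)
  rcases mul_self_eq_one_iff.1 ((sq w).symm.trans hw2) with h | h
  · left; intro v; rw [key, h, one_mul]
  · right; intro v; rw [key, h, neg_one_mul]

/-! ### Point-set properties of oriented circles -/

namespace OrientedCircle

theorem exists_mobPerm (C : OrientedCircle) : ∃ γ : SL(2, ℂ),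
    C.carrier = mobPerm γ '' realCircle ∧ C.interior = mobPerm γ '' upperHalf ∧
      C.exterior = mobPerm γ '' lowerHalf := by
  obtain ⟨γ, h1, h2⟩ := C.exists_eq_image
  rw [coe_slToMob] at h1 h2
  refine ⟨γ, h1, h2, ?_⟩
  rw [exterior, h1, h2, ← Set.image_union, lowerHalf, Set.image_compl_eq (mobPerm γ).bijective]

theorem isOpen_interior (C : OrientedCircle) : IsOpen C.interior := by
  obtain ⟨γ, -, h, -⟩ := C.exists_mobPerm
  rw [h]
  exact (mobHomeo γ).isOpenMap _ isOpen_upperHalf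

theorem isOpen_exterior (C : OrientedCircle) : IsOpen C.exterior := by
  obtain ⟨γ, -, -, h⟩ := C.exists_mobPerm
  rw [h]
  exact (mobHomeo γ).isOpenMap _ isOpen_lowerHalf

theorem carrier_subset_closure (C : OrientedCircle) : C.carrier ⊆ closure C.interior := by
  obtain ⟨γ, h, h', -⟩ := C.exists_mobPerm
  rw [h, h', ← coe_mobHomeo, ← (mobHomeo γ).image_closure]
  exact Set.image_mono realCircle_subset_closure

theorem disjoint_carrier_interior (C : OrientedCircle) : Disjoint C.carrier C.interior := by
  obtain ⟨γ, h, h', -⟩ := C.exists_mobPerm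
  rw [h, h', Set.disjoint_image_iff (mobPerm γ).injective, Set.disjoint_left]
  intro z hz hz'
  rw [mem_realCircle] at hz
  rw [mem_upperHalf] at hz'
  exact hz'.ne' hz

theorem mem_or (C : OrientedCircle) (z : OnePoint ℂ) :
    z ∈ C.carrier ∨ z ∈ C.interior ∨ z ∈ C.exterior := by
  by_cases h : z ∈ C.carrier
  · exact Or.inl h
  · by_cases h' : z ∈ C.interior
    · exact Or.inr (Or.inl h')
    · exact Or.inr (Or.inr (by simp [exterior, h, h']))

theorem interior_nonempty (C : OrientedCircle) : C.interior.Nonempty := by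
  obtain ⟨γ, -, h, -⟩ := C.exists_mobPerm
  rw [h]
  exact Set.Nonempty.image _ ⟨_, Complex.I, by simp, rfl⟩

theorem carrier_nontrivial (C : OrientedCircle) : C.carrier.Nontrivial := by
  obtain ⟨γ, h, -, -⟩ := C.exists_mobPerm
  rw [h]
  refine Set.Nontrivial.image ⟨∞, Or.inl rfl, ((0 : ℂ) : OnePoint ℂ), Or.inr ⟨0, by simp⟩,
    OnePoint.infty_ne_coe _⟩ (mobPerm γ).injective

/-- An oriented circle whose points lie on another one has the same points and either the same
interior or the complementary one. -/
theorem eq_of_carrier_subset {C D : OrientedCircle} (h : C.carrier ⊆ D.carrier) :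
    C.carrier = D.carrier ∧ (C.interior = D.interior ∨ C.interior = D.exterior) := by
  obtain ⟨γ, hγ, hγ', -⟩ := C.exists_mobPerm
  obtain ⟨δ, hδ, hδ', hδ''⟩ := D.exists_mobPerm
  have hm : mobPerm (δ⁻¹ * γ) '' realCircle ⊆ realCircle := by
    rintro _ ⟨z, hz, rfl⟩
    have : mobPerm γ z ∈ D.carrier := h (hγ ▸ Set.mem_image_of_mem _ hz)
    rw [hδ] at this
    obtain ⟨w, hw, hw'⟩ := this
    rw [map_mul, map_inv, Equiv.Perm.mul_apply, ← hw']
    simpa using hw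
  have e : ∀ S : Set (OnePoint ℂ), mobPerm γ '' S = mobPerm δ '' (mobPerm (δ⁻¹ * γ) '' S) := by
    intro S
    rw [← Set.image_comp, ← Equiv.Perm.coe_mul, ← map_mul, mul_inv_cancel_left]
  have im : ∀ S T : Set (OnePoint ℂ), (∀ z, mobPerm (δ⁻¹ * γ) z ∈ T ↔ z ∈ S) →
      mobPerm (δ⁻¹ * γ) '' S = T := by
    intro S T hST
    ext z
    constructor
    · rintro ⟨w, hw, rfl⟩; exact (hST w).2 hw
    · intro hz
      exact ⟨(mobPerm (δ⁻¹ * γ)).symm z, (hST _).1 (by simpa using hz), by simp⟩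
  have hc : mobPerm (δ⁻¹ * γ) '' realCircle = realCircle := by
    refine im _ _ fun z => ?_
    rw [mobPerm_mem_realCircle, mem_realCircle]
    rcases imForm_mulVec_of_maps _ hm with h | h <;> rw [h]
    rw [neg_eq_zero]
  refine ⟨by rw [hγ, e, hc, hδ], ?_⟩
  rcases imForm_mulVec_of_maps _ hm with h | h
  · left
    rw [hγ', e, im _ upperHalf, hδ']
    intro z
    rw [mobPerm_mem_upperHalf, mem_upperHalf, h]
  · right
    rw [hγ', e, im _ lowerHalf, hδ'']
    intro z
    rw [lowerHalf, Set.mem_compl_iff, Set.mem_union, mobPerm_mem_realCircle, mobPerm_mem_upperHalf,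
      mem_upperHalf, h, not_or, not_lt, neg_nonpos, neg_eq_zero]
    exact ⟨fun h => lt_of_le_of_ne h.2 (Ne.symm h.1), fun h => ⟨h.ne', h.le⟩⟩

theorem eq_of_carrier_eq {C D : OrientedCircle} (h : C.carrier = D.carrier) :
    C = D ∨ C.interior = D.exterior :=
  (eq_of_carrier_subset h.le).2.imp_left fun h' => OrientedCircle.ext h h'

/-- Circles with disjoint interiors do not enter each other's interior. -/
theorem disjoint_carrier_of_disjoint {C : OrientedCircle} {S : Set (OnePoint ℂ)} (hS : IsOpen S)
    (h : Disjoint C.interior S) : Disjoint C.carrier S :=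
  (h.closure_left hS).mono_left C.carrier_subset_closure

/-- A connected set that misses the points of a circle and meets its interior is inside. -/
theorem subset_interior {C : OrientedCircle} {S : Set (OnePoint ℂ)} (hS : IsPreconnected S)
    (h : Disjoint S C.carrier) (h' : (S ∩ C.interior).Nonempty) : S ⊆ C.interior := by
  refine hS.subset_left_of_subset_union C.isOpen_interior C.isOpen_exterior ?_ ?_ h'
  · rw [Set.disjoint_left]
    intro z hz hz'
    exact hz' (Or.inr hz)
  · intro z hz
    exact (C.mem_or z).resolve_left (Set.disjoint_left.1 h hz)

end OrientedCircle

/-! ### The fundamental packing stays below the real line -/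

section Packing

variable {K : Type*} [Field K] {φ : K →+* ℂ}

theorem realOriented_mem_schmidt : realOriented ∈ schmidt φ :=
  ⟨1, (bianchiGroup φ).one_mem, by simp [realOriented]⟩

/-- The circles that are the positively oriented real line or lie in the lower half plane, with an
interior that does not meet the upper half plane. -/
def Below (C : OrientedCircle) : Prop :=
  C = realOriented ∨ (Disjoint C.interior upperHalf ∧ C.carrier ≠ realCircle)

theorem Below.disjoint {C : OrientedCircle} (h : Below C) : Disjoint C.carrier upperHalf := by
  rcases h with rfl | ⟨h, -⟩
  · exact realOriented.disjoint_carrier_interior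
  · exact OrientedCircle.disjoint_carrier_of_disjoint isOpen_upperHalf h

theorem ExternallyTangent.carrier_ne {C D : OrientedCircle} (h : ExternallyTangent C D) :
    ¬ C.carrier ⊆ D.carrier := by
  intro hs
  obtain ⟨⟨x, hx⟩, -⟩ := h
  obtain ⟨a, ha, b, hb, hab⟩ := C.carrier_nontrivial
  rw [Set.inter_eq_left.2 hs] at hx
  rw [hx] at ha hb
  exact hab (ha.trans hb.symm)

/-- A chain of circles below the real line, each of them immediately tangent to the next, does not
end at a circle tangent to one that surrounds the upper half plane. -/
theorem not_tangent_of_chain {C D : OrientedCircle}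
    (hC : Relation.ReflTransGen (fun X Y => Below X ∧ ImmediatelyTangent φ X Y) realOriented C)
    (hD : D ∈ schmidt φ) (hDU : upperHalf ⊆ D.interior) (hDR : ¬ Below D) :
    ¬ ExternallyTangent C D := by
  have hR : D ≠ realOriented := fun h => hDR (Or.inl h)
  -- The invariant carried along the chain: each circle enters the interior of `D` or has the same
  -- points as `D`.
  have step : (C.carrier ∩ D.interior).Nonempty ∨ C.carrier = D.carrier := by
    induction hC with
    | refl =>
      left
      by_contra hemp
      -- The real line is in the closure of the upper half plane, so it misses the exterior of `D`.
      -- If it missed the interior too, it would lie on `D` and be equal to `D` with its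
      -- orientation.
      have hsub : realOriented.carrier ⊆ D.carrier := by
        intro z hz
        have hz' : z ∉ D.exterior := fun hz' => by
          obtain ⟨w, hw, hw'⟩ := mem_closure_iff.1 (realOriented.carrier_subset_closure hz) _
            D.isOpen_exterior hz'
          exact hw (Or.inr (hDU hw'))
        exact ((D.mem_or z).resolve_right fun h => h.elim (fun h => hemp ⟨z, hz, h⟩) hz')
      obtain ⟨h1, h2⟩ := OrientedCircle.eq_of_carrier_subset hsub
      rcases h2 with h2 | h2
      · exact hR (OrientedCircle.ext h1 h2).symm
      · obtain ⟨z, hz⟩ := realOriented.interior_nonempty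
        have hz' := hz
        rw [h2] at hz'
        exact hz' (Or.inr (hDU hz))
    | @tail X Y _ hXY ih =>
      obtain ⟨hX, -, -, hext, hns⟩ := hXY
      have hY : ¬ Y.carrier ⊆ D.carrier → (Y.carrier ∩ D.exterior) = ∅ →
          (Y.carrier ∩ D.interior).Nonempty := by
        intro h1 h2
        obtain ⟨z, hz, hz'⟩ := Set.not_subset.1 h1
        refine ⟨z, hz, ((D.mem_or z).resolve_left hz').resolve_right fun h => ?_⟩
        exact (Set.eq_empty_iff_forall_notMem.1 h2) z ⟨hz, h⟩
      rcases ih with ⟨x, hx, hx'⟩ | ih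
      · have h2 : Y.carrier ∩ D.exterior = ∅ := by
          rw [Set.eq_empty_iff_forall_notMem]
          rintro z ⟨hz, hz'⟩
          exact hns D hD ⟨⟨x, Or.inl hx, hx'⟩, ⟨z, Or.inr hz, hz'⟩⟩
        by_cases h1 : Y.carrier ⊆ D.carrier
        · right; exact (OrientedCircle.eq_of_carrier_subset h1).1
        · left; exact hY h1 h2
      -- Here `X` is `D` with the opposite orientation. External tangency to `X` keeps `Y` out of
      -- the interior of `X`, which is the exterior of `D`.
      · left
        have hXD : X.interior = D.exterior := by
          rcases OrientedCircle.eq_of_carrier_eq ih with rfl | h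
          · exact absurd hX hDR
          · exact h
        have h1 : ¬ Y.carrier ⊆ D.carrier := by
          rw [← ih]
          refine ExternallyTangent.carrier_ne ⟨?_, hext.2.symm⟩
          obtain ⟨x, hx⟩ := hext.1
          exact ⟨x, by rw [Set.inter_comm, hx]⟩
        refine hY h1 ?_
        rw [← hXD]
        exact Set.disjoint_iff_inter_eq_empty.1
          (OrientedCircle.disjoint_carrier_of_disjoint X.isOpen_interior hext.2.symm)
  intro ht
  rcases step with ⟨z, hz, hz'⟩ | h
  · exact Set.disjoint_left.1
      (OrientedCircle.disjoint_carrier_of_disjoint D.isOpen_interior ht.2) hz hz'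
  · exact ht.carrier_ne h.le

/-- Induction along the chain, keeping the chain itself in the statement: the first circle that is
not below would surround the upper half plane, against `not_tangent_of_chain`. -/
theorem below_of_mem_fundamentalPacking {C : OrientedCircle} (hC : C ∈ fundamentalPacking φ) :
    Below C := by
  have : Below C ∧
      Relation.ReflTransGen (fun X Y => Below X ∧ ImmediatelyTangent φ X Y) realOriented C := by
    induction hC with
    | refl => exact ⟨Or.inl rfl, Relation.ReflTransGen.refl⟩
    | @tail X Y _ hXY ih =>
      obtain ⟨hX, hc⟩ := ih
      refine ⟨?_, hc.tail ⟨hX, hXY⟩⟩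
      by_contra hY
      obtain ⟨-, hYs, hext, hns⟩ := hXY
      -- Otherwise `Y` could only be the real line reversed, and the open interior of `X` would have
      -- no room off the real line.
      have hYU : ¬ Disjoint Y.interior upperHalf := by
        intro hd
        have hYR : Y.carrier = realOriented.carrier := by
          by_contra h
          exact hY (Or.inr ⟨hd, h⟩)
        rcases OrientedCircle.eq_of_carrier_eq hYR with h | h
        · exact hY (Or.inl h)
        · rcases hX with rfl | ⟨hX, hXR⟩
          · exact hext.carrier_ne hYR.symm.le
          · obtain ⟨z, hz⟩ := X.interior_nonempty
            have hX2 := hext.2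
            rw [h] at hX2
            have hsub : X.interior ⊆ realCircle := by
              intro z hz
              rcases realOriented.mem_or z with h | h | h
              · exact h
              · exact absurd h (Set.disjoint_left.1 hX hz)
              · exact absurd h (Set.disjoint_left.1 hX2 hz)
            obtain ⟨w, hw, hw'⟩ := mem_closure_iff.1
              (realOriented.carrier_subset_closure (hsub hz)) _ X.isOpen_interior hz
            exact Set.disjoint_left.1 hX hw hw'
      -- A point of `Y` in the upper half plane and a point of `X` below would make the pair
      -- straddle the real line, itself a circle of the arrangement.
      have hYc : Disjoint upperHalf Y.carrier := by
        rcases hX with rfl | hX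
        · exact absurd hext.2.symm hYU
        · have hXs : ∃ x ∈ X.carrier, x ∈ realOriented.exterior := by
            by_contra hno
            push Not at hno
            have : X.carrier ⊆ realOriented.carrier := by
              intro z hz
              rcases realOriented.mem_or z with h | h | h
              · exact h
              · exact absurd h (Set.disjoint_left.1 (Below.disjoint (Or.inr hX)) hz)
              · exact absurd h (hno z hz)
            exact hX.2 (OrientedCircle.eq_of_carrier_subset this).1
          obtain ⟨x, hx, hx'⟩ := hXs
          rw [Set.disjoint_left]
          intro z hz hz'
          exact hns _ realOriented_mem_schmidt ⟨⟨z, Or.inr hz', hz⟩, ⟨x, Or.inl hx, hx'⟩⟩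
      rw [Set.not_disjoint_iff] at hYU
      obtain ⟨z, hz, hz'⟩ := hYU
      exact not_tangent_of_chain hc hYs
        (OrientedCircle.subset_interior isPreconnected_upperHalf hYc ⟨z, hz', hz⟩) hY hext
  exact this.1

/-- The closure of the fundamental packing does not meet the upper half plane. -/
theorem disjoint_closure_fundamentalPacking :
    Disjoint (closure (⋃ C ∈ fundamentalPacking φ, C.carrier)) upperHalf := by
  refine Disjoint.closure_left ?_ isOpen_upperHalf
  simp only [Set.disjoint_iUnion_left]
  exact fun C hC => (below_of_mem_fundamentalPacking hC).disjoint

end Packing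

/-! ### Integers of an imaginary quadratic field -/

section Arithmetic

variable {K : Type*} [Field K] [NumberField K] [Algebra.IsQuadraticExtension ℚ K]
  [NumberField.IsTotallyComplex K] (φ : K →+* ℂ)

/-- The ring of integers of an imaginary quadratic field is stable under complex conjugation. -/
theorem exists_conj (x : 𝓞 K) : ∃ y : 𝓞 K, φ y = star (φ x) := by
  have := NumberField.IsCMField.ofCMExtension ℚ K
  exact ⟨NumberField.IsCMField.ringOfIntegersComplexConj K x,
    NumberField.IsCMField.complexEmbedding_complexConj K φ x⟩

/-- The real elements of the ring of integers are the rational integers. -/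
theorem exists_int_of_im_eq_zero (x : 𝓞 K) (h : (φ x).im = 0) : ∃ n : ℤ, x = n := by
  have := NumberField.IsCMField.ofCMExtension ℚ K
  obtain ⟨q, hq⟩ : ∃ q : ℚ, algebraMap ℚ K q = x := by
    have hx : (x : K) ∈ NumberField.maximalRealSubfield K := by
      rw [← NumberField.IsCMField.complexConj_eq_self_iff]
      refine φ.injective ?_
      rw [NumberField.IsCMField.complexEmbedding_complexConj, Complex.conj_eq_iff_im, h]
    exact ⟨(NumberField.CMExtension.equivMaximalRealSubfield ℚ K).symm ⟨x, hx⟩,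
      NumberField.CMExtension.algebraMap_equivMaximalRealSubfield_symm_apply ℚ K ⟨x, hx⟩⟩
  have hi : IsIntegral ℤ q := by
    have := x.isIntegral_coe
    rw [← NumberField.RingOfIntegers.coe_eq_algebraMap, ← hq] at this
    exact (isIntegral_algebraMap_iff (algebraMap ℚ K).injective).1 this
  obtain ⟨n, hn⟩ := IsIntegrallyClosed.isIntegral_iff.1 hi
  refine ⟨n, NumberField.RingOfIntegers.ext ?_⟩
  rw [← hq, ← hn]
  simp

/-- The product of `x` and its conjugate is a rational integer, equal to `‖φ x‖ ^ 2` and hence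
positive. This is the source of all discreteness below. -/
theorem one_le_norm {x : 𝓞 K} (hx : x ≠ 0) : 1 ≤ ‖φ x‖ := by
  obtain ⟨y, hy⟩ := exists_conj φ x
  have e : φ (x * y : 𝓞 K) = ((‖φ x‖ ^ 2 : ℝ) : ℂ) := by
    rw [NumberField.RingOfIntegers.coe_eq_algebraMap, map_mul, map_mul,
      ← NumberField.RingOfIntegers.coe_eq_algebraMap, ← NumberField.RingOfIntegers.coe_eq_algebraMap,
      hy, Complex.star_def, Complex.mul_conj, Complex.normSq_eq_norm_sq]
  obtain ⟨n, hn⟩ := exists_int_of_im_eq_zero φ (x * y) (by rw [e, Complex.ofReal_im])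
  rw [hn] at e
  have e' : (n : ℝ) = ‖φ x‖ ^ 2 := by
    have : ((n : ℝ) : ℂ) = ((‖φ x‖ ^ 2 : ℝ) : ℂ) := by rw [← e]; simp
    exact_mod_cast this
  have hpos : 0 < ‖φ x‖ := by
    rw [norm_pos_iff, Ne, map_eq_zero]
    simpa using hx
  have hn1 : (1 : ℝ) ≤ n := by
    have : (0 : ℝ) < n := by rw [e']; positivity
    have : 0 < n := by exact_mod_cast this
    exact_mod_cast this
  nlinarith

/-- Imaginary parts of integers form a cyclic group. -/
theorem exists_im_generator : ∃ (h : ℝ) (ω : 𝓞 K), 0 < h ∧ (φ ω).im = h ∧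
    ∀ x : 𝓞 K, ∃ k : ℤ, (φ x).im = k * h := by
  let f : 𝓞 K →+ ℝ := Complex.imAddGroupHom.comp (φ.comp (algebraMap (𝓞 K) K)).toAddMonoidHom
  have hf : ∀ x, f x = (φ x).im := fun _ => rfl
  -- The difference of `x` and its conjugate is an integer with value `2 i Im x`, so a nonzero
  -- imaginary part has size at least `1 / 2`; a discrete subgroup of `ℝ` is cyclic.
  have hiso : Disjoint (f.range : Set ℝ) (Set.Ioo 0 (1 / 2)) := by
    rw [Set.disjoint_left]
    rintro _ ⟨x, rfl⟩ ⟨h1, h2⟩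
    obtain ⟨y, hy⟩ := exists_conj φ x
    have e : φ (x - y : 𝓞 K) = ((2 * f x : ℝ) : ℂ) * Complex.I := by
      rw [NumberField.RingOfIntegers.coe_eq_algebraMap, map_sub, map_sub,
        ← NumberField.RingOfIntegers.coe_eq_algebraMap,
        ← NumberField.RingOfIntegers.coe_eq_algebraMap, hy, hf]
      apply Complex.ext <;> simp
      ring
    have hne : x - y ≠ 0 := by
      intro h0
      rw [h0] at e
      have := congrArg Complex.im e
      simp at this
      linarith
    have := one_le_norm φ hne
    rw [e, norm_mul, Complex.norm_I, mul_one, Complex.norm_real, Real.norm_eq_abs,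
      abs_of_pos (by linarith)] at this
    linarith
  obtain ⟨b, hb⟩ := AddSubgroup.cyclic_of_isolated_zero (by norm_num) hiso
  -- If all imaginary parts vanished, `φ` would be a real embedding.
  have hb0 : b ≠ 0 := by
    rintro rfl
    have hre : ∀ x : 𝓞 K, star (φ x) = φ x := by
      intro x
      have : f x ∈ f.range := ⟨x, rfl⟩
      rw [hb, AddSubgroup.mem_closure_singleton] at this
      obtain ⟨k, hk⟩ := this
      rw [Complex.star_def, Complex.conj_eq_iff_im, ← hf, ← hk, smul_zero]
    apply NumberField.IsTotallyComplex.complexEmbedding_not_isReal φ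
    rw [NumberField.ComplexEmbedding.isReal_iff]
    ext z
    obtain ⟨x, y, -, rfl⟩ := IsFractionRing.div_surjective (A := 𝓞 K) z
    have hx := hre x
    have hy := hre y
    rw [Complex.star_def] at hx hy
    rw [NumberField.ComplexEmbedding.conjugate_coe_eq, map_div₀, map_div₀, hx, hy]
  have hmem : ∀ x, ∃ k : ℤ, f x = k * |b| := by
    intro x
    have : f x ∈ f.range := ⟨x, rfl⟩
    rw [hb, AddSubgroup.mem_closure_singleton] at this
    obtain ⟨k, hk⟩ := this
    rcases abs_choice b with h | h
    · exact ⟨k, by rw [h, ← hk]; simp⟩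
    · exact ⟨-k, by rw [h, ← hk]; simp⟩
  have hbm : |b| ∈ f.range := by
    have : b ∈ f.range := hb ▸ AddSubgroup.subset_closure rfl
    rcases abs_choice b with h | h
    · rwa [h]
    · rw [h]; exact neg_mem this
  obtain ⟨ω, hω⟩ := hbm
  exact ⟨|b|, ω, abs_pos.2 hb0, hω, hmem⟩

/-- Removing the right multiple of `ω` leaves a real integer of `K`, which is rational. So `1, ω` is
an integral basis. -/
theorem eq_add_mul_of_generator {h : ℝ} {ω : 𝓞 K} (hω : (φ ω).im = h)
    (hg : ∀ x : 𝓞 K, ∃ k : ℤ, (φ x).im = k * h) (x : 𝓞 K) : ∃ m k : ℤ, x = m + k * ω := by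
  obtain ⟨k, hk⟩ := hg x
  obtain ⟨m, hm⟩ := exists_int_of_im_eq_zero φ (x - k * ω) (by simp [hk, hω])
  exact ⟨m, k, by rw [← hm]; ring⟩

/-- The discriminant in terms of the smallest positive imaginary part. -/
theorem discr_eq_of_generator {h : ℝ} {ω : 𝓞 K} (h0 : 0 < h) (hω : (φ ω).im = h)
    (hg : ∀ x : 𝓞 K, ∃ k : ℤ, (φ x).im = k * h) :
    (NumberField.discr K : ℝ) = - (4 * h ^ 2) ∧
      ∃ t n : ℤ, NumberField.discr K = t ^ 2 - 4 * n := by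
  have hli : LinearIndependent ℤ ![(1 : 𝓞 K), ω] := by
    rw [LinearIndependent.pair_iff]
    intro a b hab
    have e := congrArg (fun z : 𝓞 K => φ z) hab
    simp at e
    have him := congrArg Complex.im e
    simp [hω, h0.ne'] at him
    subst him
    simpa using e
  have hsp : ⊤ ≤ Submodule.span ℤ (Set.range ![(1 : 𝓞 K), ω]) := by
    intro x _
    obtain ⟨m, k, rfl⟩ := eq_add_mul_of_generator φ hω hg x
    have h1 : (1 : 𝓞 K) ∈ Submodule.span ℤ (Set.range ![(1 : 𝓞 K), ω]) :=
      Submodule.subset_span ⟨0, rfl⟩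
    have h2 : ω ∈ Submodule.span ℤ (Set.range ![(1 : 𝓞 K), ω]) :=
      Submodule.subset_span ⟨1, rfl⟩
    have := add_mem (Submodule.smul_mem _ m h1) (Submodule.smul_mem _ k h2)
    simpa using this
  let b := Module.Basis.mk hli hsp
  have hb0 : b 0 = 1 := by simp [b]
  have hb1 : b 1 = ω := by simp [b]
  obtain ⟨y, hy⟩ := exists_conj φ ω
  obtain ⟨t, ht⟩ := exists_int_of_im_eq_zero φ (ω + y) (by simp [hy])
  obtain ⟨n, hn⟩ := exists_int_of_im_eq_zero φ (ω * y) (by simp [hy]; ring)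
  have hy' : y = t - ω := by rw [← ht]; ring
  have hsq : ω * ω = t • ω - n • (1 : 𝓞 K) := by
    rw [zsmul_eq_mul, zsmul_eq_mul, ← hn, hy']; ring
  have htr1 : Algebra.trace ℤ (𝓞 K) 1 = 2 := by
    have := Algebra.trace_algebraMap_of_basis b (1 : ℤ)
    simpa using this
  have htrω : Algebra.trace ℤ (𝓞 K) ω = t := by
    rw [Algebra.trace_eq_matrix_trace b, Matrix.trace_fin_two, Algebra.leftMulMatrix_eq_repr_mul,
      Algebra.leftMulMatrix_eq_repr_mul, hb0, hb1, hsq, mul_one, ← hb0, ← hb1, map_sub, map_zsmul,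
      map_zsmul, b.repr_self, b.repr_self]
    simp
  -- The trace matrix of the basis `1, ω`, where `ω ^ 2 = t ω - n`. As `t = 2 Re ω` and `n = |ω| ^
  -- 2`, the result is also `-4 h ^ 2`.
  have hd : NumberField.discr K = t ^ 2 - 4 * n := by
    rw [← NumberField.discr_eq_discr K b, Algebra.discr_def, Matrix.det_fin_two]
    simp only [Algebra.traceMatrix_apply, Algebra.traceForm_apply, hb0, hb1, one_mul, mul_one, hsq,
      map_sub, map_zsmul, htr1, htrω, smul_eq_mul]
    ring
  refine ⟨?_, t, n, hd⟩
  rw [hd]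
  have e1 := congrArg (fun z : 𝓞 K => (φ z).re) ht
  have e2 := congrArg (fun z : 𝓞 K => (φ z).re) hn
  simp [hy] at e1 e2
  push_cast
  rw [← e1, ← e2, hω]
  ring

/-- Outside `ℚ(√-3)`, the imaginary parts of integers are the integral multiples of some number
that is at least `1`. -/
theorem exists_one_le_generator (hK : NumberField.discr K ≠ -3) : ∃ (h : ℝ) (ω : 𝓞 K), 1 ≤ h ∧
    (φ ω).im = h ∧ ∀ x : 𝓞 K, ∃ k : ℤ, (φ x).im = k * h := by
  obtain ⟨h, ω, h0, hω, hg⟩ := exists_im_generator φ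
  refine ⟨h, ω, ?_, hω, hg⟩
  obtain ⟨hd, t, n, htn⟩ := discr_eq_of_generator φ h0 hω hg
  -- If `h < 1`, the discriminant lies strictly between `-4` and `0`; being `0` or `1` modulo `4`,
  -- it is `-3`.
  by_contra hlt
  push Not at hlt
  have h1 : (-4 : ℝ) < NumberField.discr K := by rw [hd]; nlinarith
  have h2 : (NumberField.discr K : ℝ) < 0 := by rw [hd]; nlinarith
  have h1' : -4 < NumberField.discr K := by exact_mod_cast h1
  have h2' : NumberField.discr K < 0 := by exact_mod_cast h2
  have h3 : t ^ 2 % 4 = 0 ∨ t ^ 2 % 4 = 1 := by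
    rcases Int.even_or_odd' t with ⟨c, rfl | rfl⟩
    · left; ring_nf; omega
    · right; ring_nf; omega
  omega

/-- Only finitely many integers are bounded by a given number. -/
theorem finite_norm_le (B : ℝ) : {x : 𝓞 K | ‖φ x‖ ≤ B}.Finite := by
  obtain ⟨h, ω, h0, hω, hg⟩ := exists_im_generator φ
  have hfin := (Set.finite_Icc (-⌈B + ⌈B / h⌉ * ‖φ ω‖⌉) ⌈B + ⌈B / h⌉ * ‖φ ω‖⌉).prod
    (Set.finite_Icc (-⌈B / h⌉) ⌈B / h⌉)
  refine (hfin.image fun p : ℤ × ℤ => (p.1 : 𝓞 K) + p.2 * ω).subset fun x hx => ?_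
  obtain ⟨m, k, rfl⟩ := eq_add_mul_of_generator φ hω hg x
  rw [Set.mem_ofPred_eq] at hx
  have e : φ ((m + k * ω : 𝓞 K) : K) = m + k * φ ω := by simp
  rw [e] at hx
  have hk : |(k : ℝ)| ≤ B / h := by
    rw [le_div_iff₀ h0]
    have := (Complex.abs_im_le_norm _).trans hx
    simpa [hω, abs_mul, abs_of_pos h0] using this
  have hk' : |k| ≤ ⌈B / h⌉ := by
    have : ((|k| : ℤ) : ℝ) ≤ ⌈B / h⌉ := by push_cast; exact hk.trans (Int.le_ceil _)
    exact_mod_cast this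
  have hm : |(m : ℝ)| ≤ B + ⌈B / h⌉ * ‖φ ω‖ := by
    have e1 : (m : ℂ) = (m + k * φ ω) - k * φ ω := by ring
    have e2 : ‖(m : ℂ)‖ ≤ ‖(m : ℂ) + k * φ ω‖ + ‖k * φ ω‖ := by
      conv_lhs => rw [e1]
      exact norm_sub_le _ _
    rw [norm_mul, Complex.norm_intCast, Complex.norm_intCast] at e2
    have e3 := mul_le_mul_of_nonneg_right (hk.trans (Int.le_ceil _)) (norm_nonneg (φ ω))
    linarith
  have hm' : |m| ≤ ⌈B + ⌈B / h⌉ * ‖φ ω‖⌉ := by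
    have : ((|m| : ℤ) : ℝ) ≤ ⌈B + ⌈B / h⌉ * ‖φ ω‖⌉ := by push_cast; exact hm.trans (Int.le_ceil _)
    exact_mod_cast this
  exact ⟨(m, k), ⟨abs_le.1 hm', abs_le.1 hk'⟩, rfl⟩

end Arithmetic

/-! ### The first horizontal line below the real line -/

/-- The oriented circle that is the image of the real line under a matrix in `SL(2, ℂ)`. -/
def OrientedCircle.ofSL (γ : SL(2, ℂ)) : OrientedCircle where
  carrier := mobPerm γ '' realCircle
  interior := mobPerm γ '' upperHalf
  exists_eq_image := ⟨γ, by rw [coe_slToMob], by rw [coe_slToMob]⟩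

theorem mobPerm_symm_apply (γ : SL(2, ℂ)) (z : OnePoint ℂ) :
    (mobPerm γ).symm z = mobPerm γ⁻¹ z := by
  rw [map_inv]; rfl

theorem OrientedCircle.mem_interior_ofSL (γ : SL(2, ℂ)) (z : OnePoint ℂ) :
    z ∈ (ofSL γ).interior ↔ 0 < imForm ((γ⁻¹ : SL(2, ℂ)).1 *ᵥ lift z) := by
  rw [← mobPerm_mem_upperHalf, ← mobPerm_symm_apply]
  exact Set.mem_image_equiv

theorem OrientedCircle.mem_carrier_ofSL (γ : SL(2, ℂ)) (z : OnePoint ℂ) :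
    z ∈ (ofSL γ).carrier ↔ imForm ((γ⁻¹ : SL(2, ℂ)).1 *ᵥ lift z) = 0 := by
  rw [← mobPerm_mem_realCircle, ← mobPerm_symm_apply]
  exact Set.mem_image_equiv

theorem OrientedCircle.mem_exterior_ofSL (γ : SL(2, ℂ)) (z : OnePoint ℂ) :
    z ∈ (ofSL γ).exterior ↔ imForm ((γ⁻¹ : SL(2, ℂ)).1 *ᵥ lift z) < 0 := by
  rw [exterior, Set.mem_compl_iff, Set.mem_union, mem_carrier_ofSL, mem_interior_ofSL, not_or,
    not_lt]
  exact ⟨fun h => lt_of_le_of_ne h.2 h.1, fun h => ⟨h.ne, h.le⟩⟩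

theorem inv_mulVec_fin_two (γ : SL(2, ℂ)) (v : Fin 2 → ℂ) :
    (γ⁻¹ : SL(2, ℂ)).1 *ᵥ v =
      ![γ.1 1 1 * v 0 - γ.1 0 1 * v 1, -γ.1 1 0 * v 0 + γ.1 0 0 * v 1] := by
  rw [Matrix.SpecialLinearGroup.coe_inv, Matrix.adjugate_fin_two, Matrix.mulVec_fin_two]
  simp [sub_eq_add_neg]

/-- A quadratic polynomial with non-positive discriminant does not change sign. -/
theorem quadratic_mul_nonneg {A B C : ℝ} (h : B ^ 2 - 4 * A * C ≤ 0) (x : ℝ) :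
    0 ≤ A * (A * x ^ 2 + B * x + C) := by
  nlinarith [sq_nonneg (2 * A * x + B)]

/-- The matrix of the Möbius transformation `z ↦ - z - h i`. -/
def lineSL (h : ℝ) : SL(2, ℂ) := ⟨!![Complex.I, -h; 0, -Complex.I], by simp [Matrix.det_fin_two]⟩

/-- The horizontal line at height `-h`, with the half plane below it as its interior. -/
def lineOriented (h : ℝ) : OrientedCircle := OrientedCircle.ofSL (lineSL h)

theorem imForm_lineSL_inv (h : ℝ) (v : Fin 2 → ℂ) :
    imForm ((lineSL h)⁻¹.1 *ᵥ v) = - imForm v - h * Complex.normSq (v 1) := by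
  rw [inv_mulVec_fin_two]
  simp [imForm, lineSL, Complex.normSq_apply]
  ring

theorem mem_carrier_lineOriented (h : ℝ) (z : OnePoint ℂ) :
    z ∈ (lineOriented h).carrier ↔ z = ∞ ∨ ∃ w : ℂ, w.im = -h ∧ z = w := by
  rw [lineOriented, OrientedCircle.mem_carrier_ofSL, imForm_lineSL_inv]
  induction z using OnePoint.rec with
  | infty => simp [imForm]
  | coe w =>
    simp [imForm]
    constructor <;> intro <;> linarith

theorem mem_interior_lineOriented (h : ℝ) (z : OnePoint ℂ) :
    z ∈ (lineOriented h).interior ↔ ∃ w : ℂ, w.im < -h ∧ z = w := by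
  rw [lineOriented, OrientedCircle.mem_interior_ofSL, imForm_lineSL_inv]
  induction z using OnePoint.rec with
  | infty => simp [imForm]
  | coe w =>
    simp [imForm]
    constructor <;> intro <;> linarith

section

variable {K : Type*} [Field K] {φ : K →+* ℂ}

/-- The inclusion of `SL(2, 𝓞 K)` in `SL(2, ℂ)`. -/
def slEmb (φ : K →+* ℂ) : SL(2, 𝓞 K) →* SL(2, ℂ) :=
  Matrix.SpecialLinearGroup.map (φ.comp (algebraMap (𝓞 K) K))

theorem slEmb_apply (M : SL(2, 𝓞 K)) (i j : Fin 2) :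
    (slEmb φ M : Matrix (Fin 2) (Fin 2) ℂ) i j = φ (M i j) := rfl

theorem exists_slEmb_of_mem_schmidt {D : OrientedCircle} (hD : D ∈ schmidt φ) :
    ∃ M : SL(2, 𝓞 K), D = OrientedCircle.ofSL (slEmb φ M) ∨
      (D.interior = (OrientedCircle.ofSL (slEmb φ M)).exterior ∧
        D.carrier = (OrientedCircle.ofSL (slEmb φ M)).carrier) := by
  obtain ⟨_, ⟨M, rfl⟩, hM⟩ := hD
  have hM' : D.carrier = (OrientedCircle.ofSL (slEmb φ M)).carrier := by
    rw [hM, bianchiHom, MonoidHom.comp_apply, coe_slToMob]; rfl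
  refine ⟨M, (OrientedCircle.eq_of_carrier_eq hM').imp_right fun h => ⟨h, hM'⟩⟩

variable [NumberField K] [Algebra.IsQuadraticExtension ℚ K] [NumberField.IsTotallyComplex K]

/-- No circle of the Schmidt arrangement separates the real line from the next horizontal line. -/
theorem imForm_same_sign {h : ℝ} (h1 : 1 ≤ h) (hg : ∀ x : 𝓞 K, ∃ k : ℤ, (φ x).im = k * h)
    (N : SL(2, 𝓞 K)) {p q : OnePoint ℂ}
    (hp : p ∈ realOriented.carrier ∪ (lineOriented h).carrier)
    (hq : q ∈ realOriented.carrier ∪ (lineOriented h).carrier)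
    (hp' : 0 < imForm ((slEmb φ N).1 *ᵥ lift p)) (hq' : imForm ((slEmb φ N).1 *ᵥ lift q) < 0) :
    False := by
  obtain ⟨a, ha⟩ : ∃ a, a = N 0 0 := ⟨_, rfl⟩
  obtain ⟨b, hb⟩ : ∃ b, b = N 0 1 := ⟨_, rfl⟩
  obtain ⟨c, hc⟩ : ∃ c, c = N 1 0 := ⟨_, rfl⟩
  obtain ⟨d, hd⟩ : ∃ d, d = N 1 1 := ⟨_, rfl⟩
  have hdet : φ a * φ d - φ b * φ c = 1 := by
    have := (slEmb φ N).det_coe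
    rwa [Matrix.det_fin_two, slEmb_apply, slEmb_apply, slEmb_apply, slEmb_apply, ← ha, ← hb, ← hc,
      ← hd] at this
  -- At `(z, 1)` the transformed form is `A |z| ^ 2 + B Re z + W Im z + C`, and its discriminant `B
  -- ^ 2 + W ^ 2 - 4 A C` is `1`. What follows is the arithmetic of these coefficients.
  set A := (φ a * star (φ c)).im with hA
  set C := (φ b * star (φ d)).im with hC
  set W := (φ a * star (φ d) - star (φ b) * φ c).re with hW
  set B := (φ a * star (φ d) - star (φ b) * φ c).im with hB
  obtain ⟨c', hc'⟩ := exists_conj φ c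
  obtain ⟨d', hd'⟩ := exists_conj φ d
  obtain ⟨j, hj⟩ : ∃ j : ℤ, A = j * h := by
    obtain ⟨j, hj⟩ := hg (a * c'); exact ⟨j, by rw [← hj, hA, ← hc']; simp⟩
  obtain ⟨k, hk⟩ : ∃ k : ℤ, C = k * h := by
    obtain ⟨j, hj⟩ := hg (b * d'); exact ⟨j, by rw [← hj, hC, ← hd']; simp⟩
  -- Subtracting `2 i` times the imaginary parts from `b` and `d` gives their conjugates, so `W` is
  -- the determinant `1` plus `2 h` times the imaginary part of an integer.
  obtain ⟨l, hl⟩ : ∃ l : ℤ, W = 1 + 2 * h ^ 2 * l := by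
    obtain ⟨u, hu⟩ := hg d
    obtain ⟨v, hv⟩ := hg b
    obtain ⟨l, hl⟩ := hg (a * u - c * v)
    refine ⟨l, ?_⟩
    have e := congrArg Complex.re hdet
    simp at e hl
    simp [hW]
    rw [hu, hv] at e ⊢
    linear_combination e + 2 * h * hl
  have hdisc : B ^ 2 + W ^ 2 - 4 * A * C = 1 := by
    have er := congrArg Complex.re hdet
    have ei := congrArg Complex.im hdet
    simp at er ei
    simp [hA, hB, hC, hW]
    linear_combination ((φ a).re * (φ d).re - (φ a).im * (φ d).im -
      ((φ b).re * (φ c).re - (φ b).im * (φ c).im) + 1) * er +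
      ((φ a).re * (φ d).im + (φ a).im * (φ d).re -
      ((φ b).re * (φ c).im + (φ b).im * (φ c).re)) * ei
  -- This is where `1 ≤ h` is needed: for `m < 0` it gives `1 + 2 h ^ 2 m ≤ -1`.
  have habs : ∀ m : ℤ, 1 ≤ (1 + 2 * h ^ 2 * m) ^ 2 := by
    intro m
    have hh : 1 ≤ h ^ 2 := one_le_pow₀ h1
    rcases lt_trichotomy m 0 with hm | rfl | hm
    · have : (m : ℝ) ≤ -1 := by exact_mod_cast Int.le_sub_one_of_lt hm
      have h3 : h ^ 2 * m ≤ -1 := by nlinarith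
      nlinarith
    · simp
    · have : (1 : ℝ) ≤ m := by exact_mod_cast hm
      nlinarith [mul_pos (lt_of_lt_of_le one_pos hh) (lt_of_lt_of_le one_pos this)]
  have hinf : imForm ((slEmb φ N).1 *ᵥ lift ∞) = A := by
    simp [imForm, hA, ha, hc, slEmb_apply]
  have hval : ∀ w : ℂ, imForm ((slEmb φ N).1 *ᵥ lift w) =
      A * (w.re ^ 2 + w.im ^ 2) + B * w.re + W * w.im + C := by
    intro w
    simp [imForm, hA, hB, hC, hW, ha, hb, hc, hd, slEmb_apply]
    ring
  have hcase : ∀ z ∈ realOriented.carrier ∪ (lineOriented h).carrier,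
      z = ∞ ∨ ∃ w : ℂ, z = w ∧ (w.im = 0 ∨ w.im = -h) := by
    rintro z ((rfl | ⟨x, rfl⟩) | hz)
    · exact Or.inl rfl
    · exact Or.inr ⟨x, rfl, by simp⟩
    · rcases (mem_carrier_lineOriented h z).1 hz with h | ⟨w, hw, rfl⟩
      · exact Or.inl h
      · exact Or.inr ⟨w, rfl, Or.inr hw⟩
  by_cases hA0 : A = 0
  · have hW1 : 1 ≤ W ^ 2 := hl ▸ habs l
    rw [hA0] at hdisc
    have hB0 : B = 0 := by nlinarith [sq_nonneg B]
    have hW2 : W = 1 ∨ W = -1 := by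
      rw [hB0] at hdisc
      exact mul_self_eq_one_iff.1 (by linarith)
    -- With `A = 0` the discriminant forces `B = 0` and `W = ±1`. Away from `∞` the form is constant
    -- on each of the two lines, with values that are consecutive multiples of `h`, so they cannot
    -- have opposite signs.
    have hv : ∀ z ∈ realOriented.carrier ∪ (lineOriented h).carrier,
        imForm ((slEmb φ N).1 *ᵥ lift z) = 0 ∨ imForm ((slEmb φ N).1 *ᵥ lift z) = C ∨
          imForm ((slEmb φ N).1 *ᵥ lift z) = C - W * h := by
      intro z hz
      rcases hcase z hz with rfl | ⟨w, rfl, hw⟩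
      · left; rw [hinf, hA0]
      · right
        rw [hval, hA0, hB0]
        rcases hw with hw | hw <;> rw [hw]
        · left; ring
        · right; ring
    have hh : 0 < h := by linarith
    have hk1 : ∀ m n : ℤ, 0 < m * h → n * h < 0 → 2 ≤ m - n := by
      intro m n hm hn
      have h1 : (0 : ℝ) < m := pos_of_mul_pos_left hm hh.le
      have h2 : (n : ℝ) < 0 := by nlinarith
      have h1' : 0 < m := by exact_mod_cast h1
      have h2' : n < 0 := by exact_mod_cast h2
      omega
    obtain ⟨ε, hε, hε'⟩ : ∃ ε : ℤ, (ε = 1 ∨ ε = -1) ∧ W = ε := by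
      rcases hW2 with h | h
      · exact ⟨1, Or.inl rfl, by simp [h]⟩
      · exact ⟨-1, Or.inr rfl, by simp [h]⟩
    have e2 : C - W * h = ((k - ε : ℤ) : ℝ) * h := by push_cast; rw [hk, hε']; ring
    rw [e2, hk] at hv
    rcases hv p hp with e | e | e <;> rcases hv q hq with e' | e' | e' <;> rw [e] at hp' <;>
      rw [e'] at hq' <;> try linarith
    · have := hk1 _ _ hp' hq'; omega
    · have := hk1 _ _ hp' hq'; omega
  -- On the two lines the form is a quadratic polynomial in `Re z` with discriminant `1 - W ^ 2`,
  -- respectively `1 - (W - 2 A h) ^ 2`. Both are at most zero by `habs`, so on both lines the form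
  -- never has the sign opposite to `A`.
  · have hsign : ∀ z ∈ realOriented.carrier ∪ (lineOriented h).carrier,
        0 ≤ A * imForm ((slEmb φ N).1 *ᵥ lift z) := by
      intro z hz
      rcases hcase z hz with rfl | ⟨w, rfl, hw⟩
      · rw [hinf]; exact mul_self_nonneg A
      · rw [hval]
        rcases hw with hw | hw <;> rw [hw]
        · have := quadratic_mul_nonneg (A := A) (B := B) (C := C)
            (by nlinarith [hl ▸ habs l]) w.re
          convert this using 2; ring
        · have := quadratic_mul_nonneg (A := A) (B := B) (C := A * h ^ 2 - W * h + C) (by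
            have e : 1 ≤ (W - 2 * A * h) ^ 2 := by
              have := habs (l - j)
              convert this using 2
              rw [hl, hj]; push_cast; ring
            nlinarith) w.re
          convert this using 2; ring
    have hp2 := hsign p hp
    have hq2 := hsign q hq
    rcases lt_or_gt_of_ne hA0 with h | h
    · nlinarith
    · nlinarith

/-- The next horizontal line is immediately tangent to the real line. -/
theorem immediatelyTangent_lineOriented {h : ℝ} (h1 : 1 ≤ h)
    (hg : ∀ x : 𝓞 K, ∃ k : ℤ, (φ x).im = k * h) {ω : 𝓞 K} (hω : (φ ω).im = h) :
    ImmediatelyTangent φ realOriented (lineOriented h) := by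
  refine ⟨realOriented_mem_schmidt, ?_, ⟨⟨∞, ?_⟩, ?_⟩, ?_⟩
  · let T : SL(2, 𝓞 K) := ⟨!![1, -ω; 0, 1], by simp [Matrix.det_fin_two]⟩
    refine ⟨bianchiHom φ T, ⟨T, rfl⟩, ?_⟩
    have hT : ((bianchiHom φ T : Mob) : Equiv.Perm (OnePoint ℂ)) '' realCircle =
        (OrientedCircle.ofSL (slEmb φ T)).carrier := by
      rw [bianchiHom, MonoidHom.comp_apply, coe_slToMob]; rfl
    rw [hT]
    refine (OrientedCircle.eq_of_carrier_subset (C := lineOriented h)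
      (D := OrientedCircle.ofSL (slEmb φ T)) fun z hz => ?_).1
    rw [OrientedCircle.mem_carrier_ofSL, inv_mulVec_fin_two, slEmb_apply, slEmb_apply, slEmb_apply,
      slEmb_apply]
    rcases (mem_carrier_lineOriented h z).1 hz with rfl | ⟨w, hw, rfl⟩
    · simp [imForm, T]
    · simp [imForm, T, hω, hw]
  · ext z
    rw [Set.mem_inter_iff, mem_carrier_lineOriented, Set.mem_singleton_iff]
    constructor
    · rintro ⟨rfl | ⟨x, rfl⟩, h | ⟨w, hw, h⟩⟩
      · rfl
      · rfl
      · exact h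
      · rw [OnePoint.coe_eq_coe] at h
        rw [← h, Complex.ofReal_im] at hw
        linarith
    · rintro rfl
      exact ⟨Or.inl rfl, Or.inl rfl⟩
  · rw [Set.disjoint_left]
    rintro z ⟨w, hw, rfl⟩ hz
    obtain ⟨w', hw', e⟩ := (mem_interior_lineOriented h _).1 hz
    rw [OnePoint.coe_eq_coe] at e
    rw [Set.mem_ofPred_eq, e] at hw
    linarith
  · rintro D hD ⟨⟨p, hp, hp'⟩, ⟨q, hq, hq'⟩⟩
    obtain ⟨M, rfl | ⟨hM, hM'⟩⟩ := exists_slEmb_of_mem_schmidt hD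
    · rw [OrientedCircle.mem_interior_ofSL, ← map_inv] at hp'
      rw [OrientedCircle.mem_exterior_ofSL, ← map_inv] at hq'
      exact imForm_same_sign h1 hg M⁻¹ hp hq hp' hq'
    · have hq2 : q ∈ (OrientedCircle.ofSL (slEmb φ M)).interior := by
        rw [OrientedCircle.exterior, hM, hM'] at hq'
        rcases (OrientedCircle.ofSL (slEmb φ M)).mem_or q with h | h | h
        · exact absurd (Or.inl h) hq'
        · exact h
        · exact absurd (Or.inr h) hq'
      rw [hM, OrientedCircle.mem_exterior_ofSL, ← map_inv] at hp'
      rw [OrientedCircle.mem_interior_ofSL, ← map_inv] at hq2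
      exact imForm_same_sign h1 hg M⁻¹ hq hp hq2 hp'

end

/-! ### The homomorphism to the orthogonal group -/

/-- The quadratic form `-b' b + r ^ 2 + m ^ 2`. -/
def quadM (v : Fin 4 → ℝ) : ℝ := -(v 0 * v 1) + v 2 ^ 2 + v 3 ^ 2

theorem quadM_eq_dotProduct (v : Fin 4 → ℝ) : quadM v = v ⬝ᵥ (gramM *ᵥ v) := by
  simp [quadM, gramM, Matrix.mulVec, dotProduct, Fin.sum_univ_four]
  ring

theorem det_toHerm (v : Fin 4 → ℝ) : (toHerm v).det = (-quadM v : ℝ) := by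
  simp [toHerm, quadM, Matrix.det_fin_two]
  linear_combination (v 3 : ℂ) ^ 2 * Complex.I_sq

theorem mem_OM {g : GL (Fin 4) ℝ} :
    g ∈ OM ↔ (g : Matrix (Fin 4) (Fin 4) ℝ)ᵀ * gramM * (g : Matrix (Fin 4) (Fin 4) ℝ) = gramM :=
  Iff.rfl

theorem gramM_isSymm : gramMᵀ = gramM := by
  ext i j
  fin_cases i <;> fin_cases j <;> simp [gramM]

/-- Polarization: a symmetric matrix is determined by its quadratic form on the vectors `e i` and `e
i + e j`. -/
theorem mem_OM_iff {g : GL (Fin 4) ℝ} :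
    g ∈ OM ↔ ∀ v, quadM ((g : Matrix (Fin 4) (Fin 4) ℝ) *ᵥ v) = quadM v := by
  have key : ∀ v, quadM ((g : Matrix (Fin 4) (Fin 4) ℝ) *ᵥ v) = v ⬝ᵥ
      (((g : Matrix (Fin 4) (Fin 4) ℝ)ᵀ * gramM * (g : Matrix (Fin 4) (Fin 4) ℝ)) *ᵥ v) := by
    intro v
    rw [quadM_eq_dotProduct, Matrix.mul_assoc, ← Matrix.mulVec_mulVec, ← Matrix.mulVec_mulVec,
      Matrix.dotProduct_mulVec v, Matrix.vecMul_transpose]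
  constructor
  · intro h v
    rw [key, mem_OM.1 h, quadM_eq_dotProduct]
  · intro h
    rw [mem_OM]
    set S := (g : Matrix (Fin 4) (Fin 4) ℝ)ᵀ * gramM * (g : Matrix (Fin 4) (Fin 4) ℝ) with hS
    have hsymm : ∀ i j, S i j = S j i := by
      intro i j
      have : Sᵀ = S := by
        rw [hS, Matrix.transpose_mul, Matrix.transpose_mul, Matrix.transpose_transpose,
          gramM_isSymm, Matrix.mul_assoc]
      exact congrFun (congrFun this j) i
    have hq : ∀ v, v ⬝ᵥ (S *ᵥ v) = v ⬝ᵥ (gramM *ᵥ v) := by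
      intro v
      rw [← key, h, quadM_eq_dotProduct]
    have hd : ∀ i, S i i = gramM i i := by
      intro i
      simpa using hq (Pi.single i 1)
    ext i j
    have h1 := hq (Pi.single i 1 + Pi.single j 1)
    simp [Matrix.mulVec_add, hd, hsymm j i] at h1
    have h2 := congrFun (congrFun gramM_isSymm i) j
    rw [Matrix.transpose_apply] at h2
    linarith

theorem galois_ofReal (σ : ℂ ≃ₐ[ℝ] ℂ) (x : ℝ) : σ x = x := σ.commutes x

/-- The form is minus the determinant of the Hermitian matrix, which is real and is unchanged by
factors of determinant one. -/
theorem quadM_extRho (e : ExtSL) (v : Fin 4 → ℝ) :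
    quadM ((extRho e : Matrix (Fin 4) (Fin 4) ℝ) *ᵥ v) = quadM v := by
  have h1 := det_toHerm ((extRho e : Matrix (Fin 4) (Fin 4) ℝ) *ᵥ v)
  rw [extRho_mulVec, toHerm_ofHerm (hermAct_isHermitian e (toHerm_isHermitian v)), hermAct,
    Matrix.det_mul, Matrix.det_mul, Matrix.det_conjTranspose, e.left.det_coe] at h1
  have h2 : ((toHerm v).map e.right).det = (-quadM v : ℝ) := by
    have := (RingHom.map_det (e.right : ℂ →+* ℂ) (toHerm v)).symm
    rw [det_toHerm] at this
    exact this.trans (galois_ofReal _ _)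
  rw [h2, star_one, one_mul, mul_one, Complex.ofReal_inj] at h1
  rw [extRho_mulVec]
  exact (neg_injective h1).symm

theorem extRho_mem_OM (e : ExtSL) : extRho e ∈ OM := mem_OM_iff.2 (quadM_extRho e)

theorem det_sq_of_mem_OM {g : GL (Fin 4) ℝ} (hg : g ∈ OM) :
    (g : Matrix (Fin 4) (Fin 4) ℝ).det = 1 ∨ (g : Matrix (Fin 4) (Fin 4) ℝ).det = -1 := by
  have h := congrArg Matrix.det (mem_OM.1 hg)
  rw [Matrix.det_mul, Matrix.det_mul, Matrix.det_transpose] at h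
  have hG : gramM.det ≠ 0 := by
    simp [gramM, Matrix.det_succ_row_zero, Fin.sum_univ_succ, Fin.succAbove]
  refine mul_self_eq_one_iff.1 (mul_right_cancel₀ hG ?_)
  linarith

theorem mem_SOM_iff {g : GL (Fin 4) ℝ} :
    g ∈ SOM ↔ g ∈ OM ∧ (g : Matrix (Fin 4) (Fin 4) ℝ).det = 1 := by
  rw [SOM, Subgroup.mem_inf, MonoidHom.mem_ker, Units.ext_iff]
  rfl

/-- Elements of `O_M` have determinant `±1`, so squares have determinant `1`. Since unipotent
matrices have square roots, this replaces an appeal to connectedness. -/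
theorem extRho_sq_mem_SOM (e : ExtSL) : extRho (e * e) ∈ SOM := by
  refine mem_SOM_iff.2 ⟨extRho_mem_OM _, ?_⟩
  rw [map_mul, Units.val_mul, Matrix.det_mul]
  rcases det_sq_of_mem_OM (extRho_mem_OM e) with h | h <;> rw [h] <;> norm_num

theorem toPerm_eq_proj (e : ExtSL) (z : OnePoint ℂ) :
    toPerm e z = proj ((e.left : Matrix (Fin 2) (Fin 2) ℂ) *ᵥ fun i => e.right (lift z i)) := by
  have h : lift (OnePoint.map e.right z) = fun i => e.right (lift z i) := by
    induction z using OnePoint.rec <;> ext i <;> fin_cases i <;> simp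
  rw [toPerm_apply, ← h, ← mobPerm_eq_proj]
  rfl

theorem hermAct_vecMulVec (e : ExtSL) (w : Fin 2 → ℂ) :
    hermAct e (Matrix.vecMulVec w (star w)) =
      Matrix.vecMulVec ((e.left : Matrix (Fin 2) (Fin 2) ℂ) *ᵥ fun i => e.right (w i))
        (star ((e.left : Matrix (Fin 2) (Fin 2) ℂ) *ᵥ fun i => e.right (w i))) := by
  have h : (Matrix.vecMulVec w (star w)).map e.right =
      Matrix.vecMulVec (fun i => e.right (w i)) (star fun i => e.right (w i)) := by
    ext i j
    simp only [Matrix.map_apply, Matrix.vecMulVec_apply, map_mul, Pi.star_apply, algEquiv_star]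
  rw [hermAct, h, Matrix.mul_vecMulVec, Matrix.vecMulVec_mul, Matrix.star_mulVec]

/-- The rank one Hermitian matrices `w w†` are fixed by the kernel, and such a matrix determines the
point with coordinates `w`. -/
theorem ker_extRho_le : extRho.ker ≤ toPerm.ker := by
  intro e he
  rw [MonoidHom.mem_ker] at he ⊢
  refine Equiv.ext fun z => ?_
  have hT : (Matrix.vecMulVec (lift z) (star (lift z))).IsHermitian := by
    rw [Matrix.IsHermitian, Matrix.conjTranspose_vecMulVec, star_star]
  have h1 : hermAct e (Matrix.vecMulVec (lift z) (star (lift z))) =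
      Matrix.vecMulVec (lift z) (star (lift z)) := by
    have h := extRho_mulVec e (ofHerm (Matrix.vecMulVec (lift z) (star (lift z))))
    rw [he, Units.val_one, Matrix.one_mulVec, toHerm_ofHerm hT] at h
    rw [← toHerm_ofHerm (hermAct_isHermitian e hT), ← h, toHerm_ofHerm hT]
  rw [hermAct_vecMulVec] at h1
  rw [toPerm_eq_proj, Equiv.Perm.one_apply]
  conv_rhs => rw [← proj_lift z]
  have hw := lift_ne_zero z
  generalize lift z = w at *
  have hu : ((e.left : Matrix (Fin 2) (Fin 2) ℂ) *ᵥ fun i => e.right (w i)) ≠ 0 := by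
    refine mulVec_ne_zero _ fun h => hw (funext fun i => ?_)
    simpa using congrFun h i
  generalize ((e.left : Matrix (Fin 2) (Fin 2) ℂ) *ᵥ fun i => e.right (w i)) = u at *
  rw [proj_eq_iff hu hw]
  have h01 := congrFun (congrFun h1 0) 1
  have h11 := congrFun (congrFun h1 1) 1
  simp only [Matrix.vecMulVec_apply, Pi.star_apply] at h01 h11
  by_cases hu1 : u 1 = 0
  · have : w 1 = 0 := by simpa [hu1] using h11
    rw [hu1, this]; ring
  · refine mul_right_cancel₀ (star_ne_zero.2 hu1) ?_
    linear_combination w 1 * h01 - w 0 * h11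

theorem rho_injective : Function.Injective rho := by
  rw [injective_iff_map_eq_one]
  rintro ⟨_, e, rfl⟩ h
  rw [rho_toPerm] at h
  exact Subtype.ext (ker_extRho_le h)

section

variable {K : Type*} [Field K] [NumberField K] [Algebra.IsQuadraticExtension ℚ K]
  [NumberField.IsTotallyComplex K] {φ : K →+* ℂ}

theorem exists_galois_ringHom (φ : K →+* ℂ) (σ : ℂ ≃ₐ[ℝ] ℂ) :
    ∃ c : 𝓞 K →+* 𝓞 K, ∀ x : 𝓞 K, φ (c x) = σ (φ x) := by
  rcases Complex.real_algHom_eq_id_or_conj (σ : ℂ →ₐ[ℝ] ℂ) with h | h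
  · exact ⟨RingHom.id _, fun x => (DFunLike.congr_fun h (φ x)).symm⟩
  · have := NumberField.IsCMField.ofCMExtension ℚ K
    refine ⟨NumberField.IsCMField.ringOfIntegersComplexConj K, fun x => ?_⟩
    exact (NumberField.IsCMField.complexEmbedding_complexConj K φ x).trans
      (DFunLike.congr_fun h (φ x)).symm

/-- The pairs `(γ, σ)` with `γ ∈ SL(2, 𝓞 K)`. -/
def extBianchi (φ : K →+* ℂ) : Subgroup ExtSL where
  carrier := {e | ∃ M, slEmb φ M = e.left}
  one_mem' := ⟨1, map_one _⟩
  mul_mem' := by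
    rintro e f ⟨M, hM⟩ ⟨N, hN⟩
    obtain ⟨c, hc⟩ := exists_galois_ringHom φ e.right
    refine ⟨M * Matrix.SpecialLinearGroup.map c N, ?_⟩
    rw [map_mul, hM, SemidirectProduct.mul_left, ← hN]
    congr 1
    ext i j
    exact hc _
  inv_mem' := by
    rintro e ⟨M, hM⟩
    obtain ⟨c, hc⟩ := exists_galois_ringHom φ e.right⁻¹
    refine ⟨Matrix.SpecialLinearGroup.map c M⁻¹, ?_⟩
    rw [SemidirectProduct.inv_left, ← hM, ← map_inv (slEmb φ)]
    ext i j
    exact hc _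

theorem extendedBianchiGroup_le :
    extendedBianchiGroup φ ≤ (extBianchi φ).map toPerm.rangeRestrict := by
  refine (Subgroup.closure_le _).2 ?_
  rintro g (⟨M, rfl⟩ | rfl)
  · exact ⟨SemidirectProduct.inl (slEmb φ M), ⟨M, rfl⟩, rfl⟩
  · exact ⟨SemidirectProduct.inr Complex.conjAe, ⟨1, map_one _⟩, rfl⟩

/-- In this form the stability of the lattice under `T ↦ γ σ(T) γ†` is visible. The diagonal entries
need no condition of their own, because real integers of `K` are rational. -/
theorem mem_hermLattice_iff (v : Fin 4 → ℝ) :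
    v ∈ hermLattice φ ↔ ∃ T : Matrix (Fin 2) (Fin 2) (𝓞 K),
      toHerm v = T.map (φ.comp (algebraMap (𝓞 K) K)) := by
  constructor
  · rintro ⟨⟨k, hk⟩, ⟨l, hl⟩, x, hx⟩
    obtain ⟨y, hy⟩ := exists_conj φ x
    refine ⟨!![(k : 𝓞 K), x; y, (l : 𝓞 K)], ?_⟩
    ext i j
    fin_cases i <;> fin_cases j
    · simp [toHerm, hk]
    · exact hx.symm
    · refine Eq.trans ?_ hy.symm
      rw [hx]
      simp [toHerm, sub_eq_add_neg]
    · simp [toHerm, hl]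
  · rintro ⟨T, hT⟩
    have h : ∀ i j, toHerm v i j = φ (T i j) := fun i j => congrFun (congrFun hT i) j
    refine ⟨?_, ?_, T 0 1, (h 0 1).symm⟩
    · have h0 : φ (T 0 0) = v 0 := (h 0 0).symm
      obtain ⟨k, hk⟩ := exists_int_of_im_eq_zero φ (T 0 0) (by rw [h0, Complex.ofReal_im])
      refine ⟨k, Complex.ofReal_injective ?_⟩
      rw [← h0, hk]
      simp
    · have h0 : φ (T 1 1) = v 1 := (h 1 1).symm
      obtain ⟨k, hk⟩ := exists_int_of_im_eq_zero φ (T 1 1) (by rw [h0, Complex.ofReal_im])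
      refine ⟨k, Complex.ofReal_injective ?_⟩
      rw [← h0, hk]
      simp

theorem extRho_mem_hermLattice {e : ExtSL} (he : e ∈ extBianchi φ) {v : Fin 4 → ℝ}
    (hv : v ∈ hermLattice φ) :
    (extRho e : Matrix (Fin 4) (Fin 4) ℝ) *ᵥ v ∈ hermLattice φ := by
  obtain ⟨T, hT⟩ := (mem_hermLattice_iff v).1 hv
  obtain ⟨M, hM⟩ := he
  obtain ⟨c, hc⟩ := exists_galois_ringHom φ e.right
  obtain ⟨d, hd⟩ := exists_galois_ringHom φ Complex.conjAe
  rw [mem_hermLattice_iff, extRho_mulVec,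
    toHerm_ofHerm (hermAct_isHermitian e (toHerm_isHermitian v)), hermAct, hT, ← hM]
  refine ⟨M.1 * T.map c * (M.1.map d)ᵀ, ?_⟩
  rw [Matrix.map_mul, Matrix.map_mul]
  congr 1
  · congr 1
    ext i j
    exact (hc _).symm
  · ext i j
    exact (hd _).symm

theorem extRho_mem_integralPoints {e : ExtSL} (he : e ∈ extBianchi φ) :
    extRho e ∈ integralPoints (hermLattice φ) := by
  intro v
  refine ⟨fun h => ?_, extRho_mem_hermLattice he⟩
  have := extRho_mem_hermLattice (inv_mem he) h
  rwa [Matrix.mulVec_mulVec, ← Units.val_mul, ← map_mul, inv_mul_cancel, map_one, Units.val_one,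
    Matrix.one_mulVec] at this

theorem map_rho_le {A : Subgroup Mob} (hA : A ≤ extendedBianchiGroup φ) :
    A.map rho ≤ OMInt φ := by
  rintro _ ⟨g, hg, rfl⟩
  obtain ⟨e, he, rfl⟩ := extendedBianchiGroup_le (hA hg)
  have : rho (toPerm.rangeRestrict e) = extRho e := rho_toPerm e
  rw [this]
  exact ⟨extRho_mem_OM e, extRho_mem_integralPoints he⟩

end

/-! ### Integral parabolic elements and infinite index -/

/-- The translation by `z`. -/
def upperSL {R : Type*} [CommRing R] (z : R) : SL(2, R) :=
  ⟨!![1, z; 0, 1], by simp [Matrix.det_fin_two]⟩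

/-- The lower triangular unipotent matrix with lower left entry `z`. -/
def lowerSL {R : Type*} [CommRing R] (z : R) : SL(2, R) :=
  ⟨!![1, 0; z, 1], by simp [Matrix.det_fin_two]⟩

theorem coe_upperSL {R : Type*} [CommRing R] (z : R) :
    (upperSL z : Matrix (Fin 2) (Fin 2) R) = !![1, z; 0, 1] := rfl

theorem coe_lowerSL {R : Type*} [CommRing R] (z : R) :
    (lowerSL z : Matrix (Fin 2) (Fin 2) R) = !![1, 0; z, 1] := rfl

theorem upperSL_add {R : Type*} [CommRing R] (z w : R) :
    upperSL (z + w) = upperSL z * upperSL w := by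
  ext i j
  fin_cases i <;> fin_cases j <;> simp [coe_upperSL, add_comm]

theorem lowerSL_add {R : Type*} [CommRing R] (z w : R) :
    lowerSL (z + w) = lowerSL z * lowerSL w := by
  ext i j
  fin_cases i <;> fin_cases j <;> simp [coe_lowerSL]

theorem lowerSL_mul_neg {R : Type*} [CommRing R] (z : R) : lowerSL (-z) * lowerSL z = 1 := by
  rw [← lowerSL_add, neg_add_cancel]
  ext i j
  fin_cases i <;> fin_cases j <;> simp [coe_lowerSL]

/-- The parabolic matrix conjugate to the translation by `z` that fixes `1 / β`. -/
def parabolicSL {R : Type*} [CommRing R] (β z : R) : SL(2, R) :=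
  lowerSL β * upperSL z * lowerSL (-β)

theorem parabolicSL_add {R : Type*} [CommRing R] (β z w : R) :
    parabolicSL β (z + w) = parabolicSL β z * parabolicSL β w := by
  simp only [parabolicSL, upperSL_add, mul_assoc]
  rw [← mul_assoc (lowerSL (-β)) (lowerSL β), lowerSL_mul_neg, one_mul]

theorem parabolicSL_pow {R : Type*} [CommRing R] (β z : R) (n : ℕ) :
    parabolicSL β z ^ n = parabolicSL β (n * z) := by
  induction n with
  | zero =>
    have := parabolicSL_add β (0 : R) 0
    rw [add_zero] at this
    have h0 := left_eq_mul.1 this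
    simp [h0]
  | succ n ih => rw [pow_succ, ih, ← parabolicSL_add]; congr 1; push_cast; ring

theorem parabolicSL_apply_zero (β z : ℂ) :
    mobPerm (parabolicSL β z) ((0 : ℂ) : OnePoint ℂ) = proj ![z, β * z + 1] := by
  rw [mobPerm_eq_proj]
  congr 1
  ext i
  fin_cases i <;> simp [parabolicSL, coe_lowerSL, coe_upperSL, Matrix.vecHead, Matrix.vecTail]

theorem slEmb_upperSL {K : Type*} [Field K] (φ : K →+* ℂ) (z : 𝓞 K) :
    slEmb φ (upperSL z) = upperSL (φ z) := by
  ext i j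
  rw [slEmb_apply]
  fin_cases i <;> fin_cases j <;> simp [coe_upperSL]

theorem slEmb_lowerSL {K : Type*} [Field K] (φ : K →+* ℂ) (z : 𝓞 K) :
    slEmb φ (lowerSL z) = lowerSL (φ z) := by
  ext i j
  rw [slEmb_apply]
  fin_cases i <;> fin_cases j <;> simp [coe_lowerSL]

theorem slEmb_parabolicSL {K : Type*} [Field K] (φ : K →+* ℂ) (β z : 𝓞 K) :
    slEmb φ (parabolicSL β z) = parabolicSL (φ β) (φ z) := by
  simp [parabolicSL, slEmb_upperSL, slEmb_lowerSL]

/-- If a positive power of a parabolic element lies in a group, its fixed point is a limit point. -/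
theorem proj_mem_limitSet {A : Subgroup Mob} {β : ℂ} {k : ℕ} (hk : 0 < k)
    (h : slToMob (parabolicSL β k) ∈ A) : proj ![1, β] ∈ limitSet A := by
  have hne : ∀ v w : ℂ, ![v, w] ≠ 0 ↔ v ≠ 0 ∨ w ≠ 0 := by
    intro v w
    simp [← not_and_or]
  rw [limitSet, mem_derivedSet, accPt_iff_frequently]
  -- The power `n + 1` of the element carries `0` to the point `[1 : β + 1 / (k (n + 1))]`. Starting
  -- at `n + 1` leaves out the zeroth power.
  have hlim : Tendsto (fun n : ℕ => proj ![1, β + ((k : ℂ) * ((n + 1 : ℕ) : ℂ))⁻¹]) atTop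
      (𝓝 (proj ![1, β])) := by
    refine (continuousAt_proj ((hne _ _).2 (Or.inl one_ne_zero))).tendsto.comp ?_
    have hc : Continuous (fun z : ℂ => ![1, β + (k : ℂ)⁻¹ * z]) := by fun_prop
    have h1 : Tendsto (fun n : ℕ => (((n + 1 : ℕ) : ℂ))⁻¹) atTop (𝓝 0) :=
      (tendsto_inv_atTop_nhds_zero_nat (𝕜 := ℂ)).comp (tendsto_add_atTop_nat 1)
    have h2 := (hc.tendsto 0).comp h1
    rw [mul_zero, add_zero] at h2
    refine h2.congr fun n => ?_
    simp only [Function.comp, mul_inv]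
  refine hlim.frequently (Filter.Frequently.of_forall fun n => ⟨?_, ?_⟩)
  · rw [Ne, proj_eq_iff ((hne _ _).2 (Or.inl one_ne_zero)) ((hne _ _).2 (Or.inl one_ne_zero))]
    have h1 : (k : ℂ) ≠ 0 := by exact_mod_cast hk.ne'
    have h2 : ((n + 1 : ℕ) : ℂ) ≠ 0 := by exact_mod_cast n.succ_ne_zero
    simp only [Matrix.cons_val_zero, Matrix.cons_val_one, one_mul, mul_one]
    intro h
    exact inv_ne_zero (mul_ne_zero h1 h2) (left_eq_add.1 h)
  · refine ⟨slToMob (parabolicSL β k) ^ (n + 1), A.pow_mem h _, ?_⟩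
    rw [← map_pow, parabolicSL_pow, coe_slToMob, parabolicSL_apply_zero]
    have h1 : (k : ℂ) ≠ 0 := by exact_mod_cast hk.ne'
    have h2 : ((n + 1 : ℕ) : ℂ) ≠ 0 := by exact_mod_cast n.succ_ne_zero
    rw [← proj_smul (mul_ne_zero h1 h2) ![1, β + ((k : ℂ) * ((n + 1 : ℕ) : ℂ))⁻¹]]
    congr 1
    ext i
    fin_cases i
    · simp [mul_comm]
    · simp
      field_simp

section

variable {K : Type*} [Field K] [NumberField K] [Algebra.IsQuadraticExtension ℚ K]
  [NumberField.IsTotallyComplex K] {φ : K →+* ℂ}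

/-- A group whose limit set misses the upper half plane has infinite index in every group that
contains a suitable integral parabolic element. -/
theorem exists_forall_not_isFiniteRelIndex {A : Subgroup Mob}
    (hA : Disjoint (limitSet A) upperHalf) :
    ∃ x ∈ SOM ⊓ integralPoints (hermLattice φ), ∀ Q : Subgroup (GL (Fin 4) ℝ), x ∈ Q →
      ¬ (A.map rho).IsFiniteRelIndex Q := by
  obtain ⟨h, ω, h0, hω, -⟩ := exists_im_generator φ
  have hs : slEmb φ (parabolicSL (-ω) 1) = parabolicSL (-φ ω) 1 := by
    rw [slEmb_parabolicSL]; simp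
  refine ⟨extRho (SemidirectProduct.inl (slEmb φ (parabolicSL (-ω) 1))), ⟨?_, ?_⟩, ?_⟩
  -- Over `ℂ` the parabolic element has a square root, so its image has determinant one.
  · have e : (1 : ℂ) = 1 / 2 + 1 / 2 := by norm_num
    rw [hs, e, parabolicSL_add, map_mul]
    exact extRho_sq_mem_SOM _
  · exact extRho_mem_integralPoints ⟨_, rfl⟩
  · intro Q hQ hfin
    -- Finite index would put a positive power in `A`; the fixed point `-1 / ω` is in the upper half
    -- plane because `Im ω > 0`.
    obtain ⟨k, hk, -, hkm⟩ := Subgroup.exists_pow_mem_of_relIndex_ne_zero hfin.relIndex_ne_zero hQ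
    rw [hs, ← map_pow, ← map_pow, parabolicSL_pow, mul_one] at hkm
    obtain ⟨⟨g, hg, hgk⟩, -⟩ := hkm
    have : g = slToMob (parabolicSL (-φ ω) k) := rho_injective (by rw [hgk]; exact (rho_toPerm _).symm)
    rw [this] at hg
    refine Set.disjoint_left.1 hA (proj_mem_limitSet hk hg) ?_
    rw [mem_upperHalf_iff]
    simp [hω, h0]

end

/-! ### The tangent space of a Zariski closure -/

section Tangent

variable {n : Type*} [Fintype n]

/-- The value of a polynomial in the entries of an `n × n` matrix. -/
def evalMat (M : Matrix n n ℝ) (p : MvPolynomial (n × n) ℝ) : ℝ :=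
  MvPolynomial.eval (fun ij : n × n => M ij.1 ij.2) p

/-- The right-invariant vector field on matrices given by `Y`, as a derivation. -/
def lieDeriv (Y : Matrix n n ℝ) :
    Derivation ℝ (MvPolynomial (n × n) ℝ) (MvPolynomial (n × n) ℝ) :=
  MvPolynomial.mkDerivation ℝ fun ij => ∑ k, MvPolynomial.C (Y ij.1 k) * MvPolynomial.X (k, ij.2)

theorem lieDeriv_X (Y : Matrix n n ℝ) (ij : n × n) : lieDeriv Y (MvPolynomial.X ij) =
    ∑ k, MvPolynomial.C (Y ij.1 k) * MvPolynomial.X (k, ij.2) :=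
  MvPolynomial.mkDerivation_X ..

theorem lieDeriv_zero : lieDeriv (0 : Matrix n n ℝ) = 0 :=
  MvPolynomial.derivation_ext fun ij => by simp [lieDeriv_X]

theorem lieDeriv_add (Y Z : Matrix n n ℝ) : lieDeriv (Y + Z) = lieDeriv Y + lieDeriv Z :=
  MvPolynomial.derivation_ext fun ij => by
    simp [lieDeriv_X, add_mul, Finset.sum_add_distrib]

theorem lieDeriv_smul (c : ℝ) (Y : Matrix n n ℝ) : lieDeriv (c • Y) = c • lieDeriv Y :=
  MvPolynomial.derivation_ext fun ij => by
    simp [lieDeriv_X, Finset.smul_sum, MvPolynomial.smul_eq_C_mul, mul_assoc]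

/-- The order is reversed because `lieDeriv Z` applied after `lieDeriv Y` acts on the coordinate
functions as `lieDeriv (Y * Z)`. -/
theorem lieDeriv_lie (Y Z : Matrix n n ℝ) :
    lieDeriv (Y * Z - Z * Y) = ⁅lieDeriv Z, lieDeriv Y⁆ := by
  have key : ∀ (Y Z : Matrix n n ℝ) (ij : n × n),
      lieDeriv Z (lieDeriv Y (MvPolynomial.X ij)) = lieDeriv (Y * Z) (MvPolynomial.X ij) := by
    intro Y Z ij
    have h : ∀ (a : ℝ) q, lieDeriv Z (MvPolynomial.C a * q) = MvPolynomial.C a * lieDeriv Z q := by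
      intro a q
      rw [← MvPolynomial.smul_eq_C_mul, Derivation.map_smul, MvPolynomial.smul_eq_C_mul]
    simp only [lieDeriv_X, map_sum, h, Matrix.mul_apply, Finset.mul_sum, Finset.sum_mul, map_mul,
      mul_assoc]
    rw [Finset.sum_comm]
  refine MvPolynomial.derivation_ext fun ij => ?_
  rw [Derivation.commutator_apply, key, key, sub_eq_add_neg, lieDeriv_add, ← neg_one_smul ℝ (Z * Y),
    lieDeriv_smul]
  simp [sub_eq_add_neg]

/-- The derivative of a polynomial along an integral curve of a right-invariant vector field. -/
theorem hasDerivAt_evalMat {c : ℝ → Matrix n n ℝ} {Y : Matrix n n ℝ} {t : ℝ}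
    (hc : ∀ i j, HasDerivAt (fun s => c s i j) ((Y * c t) i j) t) (p : MvPolynomial (n × n) ℝ) :
    HasDerivAt (fun s => evalMat (c s) p) (evalMat (c t) (lieDeriv Y p)) t := by
  induction p using MvPolynomial.induction_on with
  | C a => simpa [evalMat, MvPolynomial.algebraMap_eq] using hasDerivAt_const t a
  | add p q hp hq =>
    simp only [evalMat, map_add] at *
    exact hp.add hq
  | mul_X p ij hp =>
    simp only [evalMat, map_mul, MvPolynomial.eval_X, Derivation.leibniz, map_add, smul_eq_mul,
      lieDeriv_X, map_sum, MvPolynomial.eval_C] at *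
    refine (hp.fun_mul (hc ij.1 ij.2)).congr_deriv ?_
    rw [Matrix.mul_apply]
    ring

/-- A straight line is an integral curve to first order at its starting point. Unlike an
exponential, it is easily conjugated. -/
theorem hasDerivAt_evalMat_add_smul (Y M : Matrix n n ℝ) (p : MvPolynomial (n × n) ℝ) :
    HasDerivAt (fun s : ℝ => evalMat (M + s • (Y * M)) p) (evalMat M (lieDeriv Y p)) 0 := by
  have h : HasDerivAt (fun s : ℝ => evalMat (M + s • (Y * M)) p)
      (evalMat (M + (0 : ℝ) • (Y * M)) (lieDeriv Y p)) 0 := by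
    refine hasDerivAt_evalMat (fun i j => ?_) p
    simp only [zero_smul, add_zero, Matrix.add_apply, Matrix.smul_apply, smul_eq_mul]
    simpa using ((hasDerivAt_id (0 : ℝ)).mul_const ((Y * M) i j)).const_add (M i j)
  simpa using h

theorem exists_evalMat_translate (A B : Matrix n n ℝ) (p : MvPolynomial (n × n) ℝ) :
    ∃ q : MvPolynomial (n × n) ℝ, ∀ M : Matrix n n ℝ, evalMat M q = evalMat (A * M * B) p := by
  refine ⟨MvPolynomial.bind₁ (fun ij : n × n => ∑ k, (∑ l,
    MvPolynomial.C (A ij.1 l) * MvPolynomial.X (l, k)) * MvPolynomial.C (B k ij.2)) p,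
    fun M => ?_⟩
  simp only [evalMat, MvPolynomial.eval, MvPolynomial.eval₂Hom_bind₁]
  congr 2
  funext ij
  simp [Matrix.mul_apply]

variable [DecidableEq n]

theorem evalAt_eq_evalMat (g : GL n ℝ) (p : MvPolynomial (n × n) ℝ) :
    evalAt g p = evalMat (g : Matrix n n ℝ) p := rfl

/-- The vectors `Y` whose right-invariant vector fields preserve the ideal of the polynomials that
vanish on `H`. -/
def tangent (H : Subgroup (GL n ℝ)) : Submodule ℝ (Matrix n n ℝ) where
  carrier := {Y | ∀ p, (∀ h ∈ H, evalAt h p = 0) → ∀ h ∈ H, evalAt h (lieDeriv Y p) = 0}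
  zero_mem' := fun p _ h _ => by simp [lieDeriv_zero, evalAt]
  add_mem' := by
    intro Y Z hY hZ p hp h hh
    have h1 := hY p hp h hh
    have h2 := hZ p hp h hh
    simp only [evalAt] at *
    rw [lieDeriv_add, Derivation.add_apply, map_add, h1, h2, add_zero]
  smul_mem' := by
    intro c Y hY p hp h hh
    have h1 := hY p hp h hh
    simp only [evalAt] at *
    rw [lieDeriv_smul, Derivation.smul_apply, MvPolynomial.smul_eval, h1, mul_zero]

theorem mem_tangent {H : Subgroup (GL n ℝ)} {Y : Matrix n n ℝ} : Y ∈ tangent H ↔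
    ∀ p, (∀ h ∈ H, evalAt h p = 0) → ∀ h ∈ H, evalAt h (lieDeriv Y p) = 0 := Iff.rfl

/-- Derivations that preserve the vanishing ideal are closed under commutators. -/
theorem lie_mem_tangent {H : Subgroup (GL n ℝ)} {Y Z : Matrix n n ℝ} (hY : Y ∈ tangent H)
    (hZ : Z ∈ tangent H) : Y * Z - Z * Y ∈ tangent H := by
  intro p hp h hh
  rw [lieDeriv_lie, Derivation.commutator_apply]
  have h1 := hZ _ (hY p hp) h hh
  have h2 := hY _ (hZ p hp) h hh
  simp only [evalAt] at *
  rw [map_sub, h1, h2, sub_zero]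

theorem le_zariskiClosure (H : Subgroup (GL n ℝ)) : H ≤ zariskiClosure H :=
  fun h hh _ hp => hp h hh

/-- The initial velocity of a curve in the Zariski closure is tangent. -/
theorem mem_tangent_of_curve {H : Subgroup (GL n ℝ)} {Y : Matrix n n ℝ} (c : ℝ → GL n ℝ)
    (hc : ∀ t, c t ∈ zariskiClosure H) (h0 : c 0 = 1)
    (hd : ∀ i j, HasDerivAt (fun s => (c s : Matrix n n ℝ) i j) (Y i j) 0) : Y ∈ tangent H := by
  intro p hp h hh
  -- Right translation by `h` moves the curve to one through `h` inside the closure, where `p`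
  -- vanishes identically; its velocity there is `Y * h`.
  have h1 : HasDerivAt (fun s => evalMat ((c s : Matrix n n ℝ) * (h : Matrix n n ℝ)) p)
      (evalMat ((c 0 : Matrix n n ℝ) * (h : Matrix n n ℝ)) (lieDeriv Y p)) 0 := by
    refine hasDerivAt_evalMat (fun i j => ?_) p
    simp only [h0, Units.val_one, one_mul, Matrix.mul_apply]
    exact HasDerivAt.fun_sum fun k _ => (hd i k).mul_const _
  have h2 : (fun s => evalMat ((c s : Matrix n n ℝ) * (h : Matrix n n ℝ)) p) = fun _ => 0 := by
    funext s
    exact (zariskiClosure H).mul_mem (hc s) (le_zariskiClosure H hh) p hp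
  rw [h2] at h1
  rw [evalAt_eq_evalMat]
  have := h1.unique (hasDerivAt_const _ _)
  rwa [h0, Units.val_one, one_mul] at this

/-- Conjugation by an element of `H` maps `H` to itself, hence preserves the vanishing ideal;
differentiating the conjugated polynomial `q` along `Y` is differentiating `p` along the conjugate
of `Y`. -/
theorem conj_mem_tangent {H : Subgroup (GL n ℝ)} {Y : Matrix n n ℝ} (hY : Y ∈ tangent H)
    {h : GL n ℝ} (hh : h ∈ H) :
    (h : Matrix n n ℝ) * Y * ((h⁻¹ : GL n ℝ) : Matrix n n ℝ) ∈ tangent H := by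
  rw [mem_tangent] at hY ⊢
  intro p hp g hg
  obtain ⟨q, hq⟩ := exists_evalMat_translate (h : Matrix n n ℝ) ((h⁻¹ : GL n ℝ) : Matrix n n ℝ) p
  have hq0 : ∀ k ∈ H, evalAt k q = 0 := fun k hk => by
    rw [evalAt_eq_evalMat, hq, ← Units.val_mul, ← Units.val_mul]
    exact hp _ (H.mul_mem (H.mul_mem hh hk) (H.inv_mem hh))
  have hk : h⁻¹ * g * h ∈ H := H.mul_mem (H.mul_mem (H.inv_mem hh) hg) hh
  have h1 := hY q hq0 _ hk
  have hi : (h : Matrix n n ℝ) * ((h⁻¹ : GL n ℝ) : Matrix n n ℝ) = 1 := by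
    rw [← Units.val_mul, mul_inv_cancel, Units.val_one]
  rw [evalAt_eq_evalMat, Units.val_mul, Units.val_mul] at h1
  rw [evalAt_eq_evalMat]
  generalize (h : Matrix n n ℝ) = A at *
  generalize ((h⁻¹ : GL n ℝ) : Matrix n n ℝ) = B at *
  generalize (g : Matrix n n ℝ) = G at *
  have d1 := hasDerivAt_evalMat_add_smul Y (B * G * A) q
  have d2 := hasDerivAt_evalMat_add_smul (A * Y * B) G p
  have e : ∀ s : ℝ, A * (B * G * A + s • (Y * (B * G * A))) * B = G + s • (A * Y * B * G) := by
    intro s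
    have e1 : A * (B * G * A) * B = G := by
      calc A * (B * G * A) * B = (A * B) * G * (A * B) := by simp only [Matrix.mul_assoc]
        _ = G := by rw [hi, Matrix.one_mul, Matrix.mul_one]
    have e2 : A * (Y * (B * G * A)) * B = A * Y * B * G := by
      calc A * (Y * (B * G * A)) * B = A * Y * B * G * (A * B) := by simp only [Matrix.mul_assoc]
        _ = A * Y * B * G := by rw [hi, Matrix.mul_one]
    rw [Matrix.mul_add, Matrix.add_mul, Matrix.mul_smul, Matrix.smul_mul, e1, e2]
  simp only [hq, e] at d1
  rw [d2.unique d1, h1]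

/-- An integral curve through the identity of a tangent vector, with polynomial entries, stays in
the Zariski closure. -/
theorem mem_zariskiClosure_of_curve {H : Subgroup (GL n ℝ)} {Y : Matrix n n ℝ}
    (hY : Y ∈ tangent H) (P : Matrix n n (Polynomial ℝ))
    (h0 : ∀ i j, (P i j).eval 0 = (1 : Matrix n n ℝ) i j)
    (hP : ∀ i j, Polynomial.derivative (P i j) = ∑ k, Polynomial.C (Y i k) * P k j)
    (t : ℝ) (g : GL n ℝ) (hg : ∀ i j, (g : Matrix n n ℝ) i j = (P i j).eval t) :
    g ∈ zariskiClosure H := by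
  intro p hp
  let F : MvPolynomial (n × n) ℝ → Polynomial ℝ := MvPolynomial.aeval fun ij => P ij.1 ij.2
  have hF : ∀ q s, (F q).eval s = evalMat (Matrix.of fun i j => (P i j).eval s) q := by
    intro q s
    induction q using MvPolynomial.induction_on with
    | C a => simp [F, evalMat]
    | add q r hq hr => simp only [F, evalMat, map_add, Polynomial.eval_add] at *; rw [hq, hr]
    | mul_X q ij hq =>
      simp only [F, evalMat, map_mul, Polynomial.eval_mul, MvPolynomial.aeval_X,
        MvPolynomial.eval_X, Matrix.of_apply] at *
      rw [hq]
  have hD : ∀ q, Polynomial.derivative (F q) = F (lieDeriv Y q) := by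
    intro q
    refine Polynomial.funext fun s => ?_
    rw [hF]
    have h1 : HasDerivAt (fun s => evalMat (Matrix.of fun i j => (P i j).eval s) q) _ s :=
      hasDerivAt_evalMat (Y := Y) (fun i j => by
        simp only [Matrix.mul_apply, Matrix.of_apply]
        have := (P i j).hasDerivAt s
        rw [hP] at this
        simpa [Polynomial.eval_finsetSum] using this) q
    have h2 := (F q).hasDerivAt s
    simp only [hF] at h2
    exact h2.unique h1
  -- `F q` is the restriction of `q` to the curve, and differentiating it is applying the vector
  -- field, which preserves the ideal. So every derivative of `F p` at `0` vanishes, and the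
  -- polynomial `F p` is zero.
  have hz : ∀ k : ℕ, ∀ q, (∀ h ∈ H, evalAt h q = 0) →
      (Polynomial.derivative^[k] (F q)).eval 0 = 0 := by
    intro k
    induction k with
    | zero =>
      intro q hq
      rw [Function.iterate_zero, id, hF]
      convert hq 1 H.one_mem using 1
      rw [evalAt_eq_evalMat]
      congr 1
      ext i j
      exact h0 i j
    | succ k ih =>
      intro q hq
      rw [Function.iterate_succ_apply, hD]
      exact ih _ (hY q hq)
  have hF0 : F p = 0 := by
    ext k
    have h1 := hz k p hp
    rw [← Polynomial.coeff_zero_eq_eval_zero, Polynomial.coeff_iterate_derivative] at h1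
    simpa [Nat.descFactorial_self, Nat.factorial_ne_zero] using h1
  have h1 := hF p t
  rw [hF0, Polynomial.eval_zero] at h1
  rw [evalAt_eq_evalMat, h1]
  congr 1
  ext i j
  exact hg i j

end Tangent

section

/-! ### Tori -/

/-- If all power sums `∑ c i * w i ^ n` vanish, so do the sums `∑ c i * f (w i)`. -/
theorem sum_mul_eq_zero_of_forall_pow {ι : Type*} (s : Finset ι) (c w : ι → ℂ)
    (h : ∀ n : ℕ, ∑ i ∈ s, c i * w i ^ n = 0) (f : ℂ → ℂ) : ∑ i ∈ s, c i * f (w i) = 0 := by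
  classical
  let P := Lagrange.interpolate (s.image w) id f
  have hP : ∀ i ∈ s, P.eval (w i) = f (w i) := fun i hi =>
    Lagrange.eval_interpolate_at_node f Function.injective_id.injOn (Finset.mem_image_of_mem w hi)
  calc ∑ i ∈ s, c i * f (w i) = ∑ i ∈ s, c i * P.eval (w i) :=
        Finset.sum_congr rfl fun i hi => by rw [hP i hi]
    _ = ∑ i ∈ s, ∑ k ∈ Finset.range (P.natDegree + 1), P.coeff k * (c i * w i ^ k) := by
        refine Finset.sum_congr rfl fun i _ => ?_
        rw [Polynomial.eval_eq_sum_range, Finset.mul_sum]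
        exact Finset.sum_congr rfl fun k _ => by ring
    _ = 0 := by
        rw [Finset.sum_comm]
        refine Finset.sum_eq_zero fun k _ => ?_
        rw [← Finset.mul_sum, h, mul_zero]

/-- The matrix that multiplies the coordinates `b'`, `b`, `r + m i` by `a`, `b`, `u`. -/
def torusMat (a b : ℝ) (u : ℂ) : Matrix (Fin 4) (Fin 4) ℝ :=
  !![a, 0, 0, 0; 0, b, 0, 0; 0, 0, u.re, -u.im; 0, 0, u.im, u.re]

theorem torusMat_mul (a b a' b' : ℝ) (u u' : ℂ) :
    torusMat a b u * torusMat a' b' u' = torusMat (a * a') (b * b') (u * u') := by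
  ext i j
  fin_cases i <;> fin_cases j <;> simp [torusMat, Matrix.mul_apply, Fin.sum_univ_four] <;> ring

theorem torusMat_one : torusMat 1 1 1 = 1 := by
  ext i j
  fin_cases i <;> fin_cases j <;> simp [torusMat]

theorem torusMat_pow (a b : ℝ) (u : ℂ) (n : ℕ) :
    torusMat a b u ^ n = torusMat (a ^ n) (b ^ n) (u ^ n) := by
  induction n with
  | zero => simp [torusMat_one]
  | succ n ih => rw [pow_succ, ih, torusMat_mul, pow_succ, pow_succ, pow_succ]

/-- In the complex coordinates `u` and `star u` the torus is diagonal, so a polynomial in the matrix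
entries becomes a polynomial in the characters. -/
theorem exists_torus_polynomial (q : MvPolynomial (Fin 4 × Fin 4) ℝ) :
    ∃ Q : MvPolynomial (Fin 4) ℂ, ∀ (a b : ℝ) (u : ℂ),
      MvPolynomial.eval ![(a : ℂ), (b : ℂ), u, star u] Q = evalMat (torusMat a b u) q := by
  let re : MvPolynomial (Fin 4) ℂ := MvPolynomial.C (1 / 2) * (MvPolynomial.X 2 + MvPolynomial.X 3)
  let im : MvPolynomial (Fin 4) ℂ :=
    MvPolynomial.C (-Complex.I / 2) * (MvPolynomial.X 2 - MvPolynomial.X 3)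
  let E : Matrix (Fin 4) (Fin 4) (MvPolynomial (Fin 4) ℂ) :=
    !![MvPolynomial.X 0, 0, 0, 0; 0, MvPolynomial.X 1, 0, 0; 0, 0, re, -im; 0, 0, im, re]
  have hre : ∀ (a b : ℝ) (u : ℂ), MvPolynomial.eval ![(a : ℂ), (b : ℂ), u, star u] re = u.re := by
    intro a b u
    simp [re]
    rw [Complex.re_eq_add_conj]; ring
  have him : ∀ (a b : ℝ) (u : ℂ), MvPolynomial.eval ![(a : ℂ), (b : ℂ), u, star u] im = u.im := by
    intro a b u
    simp [im]
    rw [Complex.im_eq_sub_conj]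
    field_simp
    linear_combination (-u + (starRingEnd ℂ) u) * Complex.I_sq
  refine ⟨MvPolynomial.eval₂ (MvPolynomial.C.comp Complex.ofRealHom) (fun ij => E ij.1 ij.2) q,
    fun a b u => ?_⟩
  have hE : ∀ i j, MvPolynomial.eval ![(a : ℂ), (b : ℂ), u, star u] (E i j) =
      (torusMat a b u i j : ℂ) := by
    intro i j
    fin_cases i <;> fin_cases j <;> simp [E, torusMat]
    all_goals first | exact hre a b u | exact him a b u
  induction q using MvPolynomial.induction_on with
  | C c => simp [evalMat]
  | add p q hp hq =>
    rw [MvPolynomial.eval₂_add, map_add, hp, hq]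
    simp [evalMat]
  | mul_X p ij hp =>
    rw [MvPolynomial.eval₂_mul, map_mul, hp, MvPolynomial.eval₂_X, hE]
    simp [evalMat]

/-- A polynomial that vanishes at the powers of a hyperbolic element of the torus vanishes on the
split torus. -/
theorem evalMat_torusMat_eq_zero {q : MvPolynomial (Fin 4 × Fin 4) ℝ} {x : ℝ} (hx : 1 < x) {u : ℂ}
    (hu : ‖u‖ = 1) (h : ∀ n : ℕ, evalMat (torusMat x x⁻¹ u ^ n) q = 0) {y : ℝ} (hy : y ≠ 0) :
    evalMat (torusMat y y⁻¹ 1) q = 0 := by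
  obtain ⟨Q, hQ⟩ := exists_torus_polynomial q
  have hx0 : 0 < x := by linarith
  have hlog : Real.log x ≠ 0 := (Real.log_pos hx).ne'
  -- `w m` is the value of the monomial `m` at the hyperbolic element. Its absolute value is `x ^ (m
  -- 0 - m 1)`, so `f` recovers the exponent from the logarithm, replaces `x` by `y` and forgets the
  -- rotation.
  let w : (Fin 4 →₀ ℕ) → ℂ := fun m => (x : ℂ) ^ m 0 * (x⁻¹ : ℂ) ^ m 1 * u ^ m 2 * (star u) ^ m 3
  let f : ℂ → ℂ := fun z => (y : ℂ) ^ round (Real.log ‖z‖ / Real.log x)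
  have hsum := sum_mul_eq_zero_of_forall_pow Q.support Q.coeff w (fun n => ?_) f
  · have hw : ∀ m : Fin 4 →₀ ℕ, f (w m) = (y : ℂ) ^ m 0 * ((y⁻¹ : ℝ) : ℂ) ^ m 1 := by
      intro m
      have e1 : ‖w m‖ = x ^ m 0 * x⁻¹ ^ m 1 := by
        simp only [w, norm_mul, norm_pow, norm_star, hu, one_pow, mul_one, norm_inv]
        simp [abs_of_pos hx0]
      have e2 : Real.log ‖w m‖ / Real.log x = ((m 0 - m 1 : ℤ) : ℝ) := by
        rw [e1, Real.log_mul (by positivity) (by positivity), Real.log_pow, Real.log_pow,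
          Real.log_inv]
        push_cast
        field_simp
        ring
      simp only [f]
      rw [e2, round_intCast, zpow_sub₀ (by exact_mod_cast hy), zpow_natCast, zpow_natCast]
      push_cast
      rw [inv_pow, div_eq_mul_inv]
    have h1 := hQ y y⁻¹ 1
    rw [MvPolynomial.eval_eq'] at h1
    rw [← Complex.ofReal_inj, ← h1, Complex.ofReal_zero, ← hsum]
    refine Finset.sum_congr rfl fun m _ => ?_
    rw [hw, Fin.prod_univ_four]
    simp
  · have h1 := hQ (x ^ n) (x⁻¹ ^ n) (u ^ n)
    rw [← torusMat_pow, h n, MvPolynomial.eval_eq', Complex.ofReal_zero] at h1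
    rw [← h1]
    refine Finset.sum_congr rfl fun m _ => ?_
    rw [Fin.prod_univ_four]
    simp [w]
    left
    ring

/-! ### The differential of the homomorphism to the orthogonal group -/

/-- The differential `X ↦ (T ↦ X T + T X†)` of the action on Hermitian matrices. -/
def diffRho : Matrix (Fin 2) (Fin 2) ℂ →ₗ[ℝ] Matrix (Fin 4) (Fin 4) ℝ where
  toFun X := Matrix.of fun i j =>
    ofHerm (X * toHerm (Pi.single j 1) + toHerm (Pi.single j 1) * Xᴴ) i
  map_add' X Y := by
    ext i j
    simp only [Matrix.of_apply, Matrix.add_apply, Matrix.conjTranspose_add, Matrix.add_mul,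
      Matrix.mul_add]
    fin_cases i <;> simp [ofHerm] <;> ring
  map_smul' c X := by
    ext i j
    have h : (c • X)ᴴ = c • Xᴴ := by rw [Matrix.conjTranspose_smul, star_trivial]
    simp only [Matrix.of_apply, Matrix.smul_apply, h, Matrix.smul_mul, Matrix.mul_smul]
    fin_cases i <;> simp [ofHerm] <;> ring

theorem ofHerm_add (S T : Matrix (Fin 2) (Fin 2) ℂ) : ofHerm (S + T) = ofHerm S + ofHerm T := by
  ext i
  fin_cases i <;> simp [ofHerm]

theorem ofHerm_sub (S T : Matrix (Fin 2) (Fin 2) ℂ) : ofHerm (S - T) = ofHerm S - ofHerm T := by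
  ext i
  fin_cases i <;> simp [ofHerm]

theorem diffRho_mulVec (X : Matrix (Fin 2) (Fin 2) ℂ) (v : Fin 4 → ℝ) :
    diffRho X *ᵥ v = ofHerm (X * toHerm v + toHerm v * Xᴴ) := by
  ext i
  simp only [Matrix.mulVec, dotProduct, Fin.sum_univ_four, diffRho, LinearMap.coe_mk,
    AddHom.coe_mk, Matrix.of_apply, ofHerm, Matrix.add_apply, Matrix.mul_apply, Fin.sum_univ_two,
    Matrix.conjTranspose_apply]
  fin_cases i <;> simp [toHerm] <;> ring

theorem isHermitian_mul_add (X T : Matrix (Fin 2) (Fin 2) ℂ) (hT : T.IsHermitian) :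
    (X * T + T * Xᴴ).IsHermitian := by
  rw [Matrix.IsHermitian, Matrix.conjTranspose_add, Matrix.conjTranspose_mul,
    Matrix.conjTranspose_mul, Matrix.conjTranspose_conjTranspose, hT.eq, add_comm]

theorem toHerm_diffRho_mulVec (X : Matrix (Fin 2) (Fin 2) ℂ) (v : Fin 4 → ℝ) :
    toHerm (diffRho X *ᵥ v) = X * toHerm v + toHerm v * Xᴴ := by
  rw [diffRho_mulVec, toHerm_ofHerm (isHermitian_mul_add X _ (toHerm_isHermitian v))]

theorem diffRho_lie (X Y : Matrix (Fin 2) (Fin 2) ℂ) :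
    diffRho (X * Y - Y * X) = diffRho X * diffRho Y - diffRho Y * diffRho X := by
  refine Matrix.ext_of_mulVec_single fun i => ?_
  rw [Matrix.sub_mulVec, ← Matrix.mulVec_mulVec, ← Matrix.mulVec_mulVec, diffRho_mulVec,
    diffRho_mulVec X, diffRho_mulVec Y (diffRho X *ᵥ _), toHerm_diffRho_mulVec,
    toHerm_diffRho_mulVec, ← ofHerm_sub]
  congr 1
  simp only [Matrix.conjTranspose_sub, Matrix.conjTranspose_mul]
  noncomm_ring

/-- The image of `SL(2, ℂ)` in the orthogonal group. -/
def slRho : SL(2, ℂ) →* GL (Fin 4) ℝ := extRho.comp SemidirectProduct.inl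

theorem slRho_mulVec (γ : SL(2, ℂ)) (v : Fin 4 → ℝ) :
    (slRho γ : Matrix (Fin 4) (Fin 4) ℝ) *ᵥ v =
      ofHerm ((γ : Matrix (Fin 2) (Fin 2) ℂ) * toHerm v * (γ : Matrix (Fin 2) (Fin 2) ℂ)ᴴ) :=
  extRho_mulVec _ v

theorem toHerm_slRho_mulVec (γ : SL(2, ℂ)) (v : Fin 4 → ℝ) :
    toHerm ((slRho γ : Matrix (Fin 4) (Fin 4) ℝ) *ᵥ v) =
      (γ : Matrix (Fin 2) (Fin 2) ℂ) * toHerm v * (γ : Matrix (Fin 2) (Fin 2) ℂ)ᴴ := by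
  rw [slRho_mulVec]
  exact toHerm_ofHerm (Matrix.isHermitian_mul_mul_conjTranspose _ (toHerm_isHermitian v))

theorem coe_mul_coe_inv (γ : SL(2, ℂ)) :
    (γ : Matrix (Fin 2) (Fin 2) ℂ) * ((γ⁻¹ : SL(2, ℂ)) : Matrix (Fin 2) (Fin 2) ℂ) = 1 := by
  rw [← Matrix.SpecialLinearGroup.coe_mul, mul_inv_cancel, Matrix.SpecialLinearGroup.coe_one]

theorem coe_inv_mul_coe (γ : SL(2, ℂ)) :
    ((γ⁻¹ : SL(2, ℂ)) : Matrix (Fin 2) (Fin 2) ℂ) * (γ : Matrix (Fin 2) (Fin 2) ℂ) = 1 := by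
  rw [← Matrix.SpecialLinearGroup.coe_mul, inv_mul_cancel, Matrix.SpecialLinearGroup.coe_one]

/-- The differential is equivariant, so conjugations of the tangent space of the closure can be
carried out on `2 × 2` matrices. -/
theorem diffRho_conj (γ : SL(2, ℂ)) (X : Matrix (Fin 2) (Fin 2) ℂ) :
    diffRho ((γ : Matrix (Fin 2) (Fin 2) ℂ) * X * ((γ⁻¹ : SL(2, ℂ)) : Matrix (Fin 2) (Fin 2) ℂ)) =
      (slRho γ : Matrix (Fin 4) (Fin 4) ℝ) * diffRho X *
        (((slRho γ)⁻¹ : GL (Fin 4) ℝ) : Matrix (Fin 4) (Fin 4) ℝ) := by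
  refine Matrix.ext_of_mulVec_single fun i => ?_
  rw [← map_inv, ← Matrix.mulVec_mulVec, ← Matrix.mulVec_mulVec, slRho_mulVec,
    toHerm_diffRho_mulVec, toHerm_slRho_mulVec, diffRho_mulVec]
  congr 1
  have h : ((γ⁻¹ : SL(2, ℂ)) : Matrix (Fin 2) (Fin 2) ℂ)ᴴ * (γ : Matrix (Fin 2) (Fin 2) ℂ)ᴴ = 1 := by
    rw [← Matrix.conjTranspose_mul, coe_mul_coe_inv, Matrix.conjTranspose_one]
  have h' := coe_mul_coe_inv γ
  generalize toHerm (Pi.single i 1) = T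
  simp only [Matrix.conjTranspose_mul]
  generalize (γ : Matrix (Fin 2) (Fin 2) ℂ)ᴴ = C at *
  generalize ((γ⁻¹ : SL(2, ℂ)) : Matrix (Fin 2) (Fin 2) ℂ)ᴴ = D at *
  generalize (γ : Matrix (Fin 2) (Fin 2) ℂ) = A at *
  generalize ((γ⁻¹ : SL(2, ℂ)) : Matrix (Fin 2) (Fin 2) ℂ) = B at *
  have e1 : A * (X * (B * T * D)) * C = A * X * B * T * (D * C) := by simp only [Matrix.mul_assoc]
  have e2 : A * (B * T * D * Xᴴ) * C = (A * B) * T * (D * (Xᴴ * C)) := by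
    simp only [Matrix.mul_assoc]
  rw [Matrix.mul_add, Matrix.add_mul, e1, e2, h, h', Matrix.mul_one, Matrix.one_mul]

/-- The real Lie algebra in `2 × 2` matrices of the Zariski closure of `H`. -/
def tangentSL (H : Subgroup (GL (Fin 4) ℝ)) : Submodule ℝ (Matrix (Fin 2) (Fin 2) ℂ) :=
  (tangent H).comap diffRho

variable {H : Subgroup (GL (Fin 4) ℝ)}

theorem lie_mem_tangentSL {X Y : Matrix (Fin 2) (Fin 2) ℂ} (hX : X ∈ tangentSL H)
    (hY : Y ∈ tangentSL H) : X * Y - Y * X ∈ tangentSL H := by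
  rw [tangentSL, Submodule.mem_comap, diffRho_lie]
  exact lie_mem_tangent hX hY

theorem conj_mem_tangentSL {X : Matrix (Fin 2) (Fin 2) ℂ} (hX : X ∈ tangentSL H) {γ : SL(2, ℂ)}
    (hγ : slRho γ ∈ H) : (γ : Matrix (Fin 2) (Fin 2) ℂ) * X *
      ((γ⁻¹ : SL(2, ℂ)) : Matrix (Fin 2) (Fin 2) ℂ) ∈ tangentSL H := by
  rw [tangentSL, Submodule.mem_comap, diffRho_conj]
  exact conj_mem_tangent hX hγ

/-- The diagonal matrix with entries `μ` and `μ⁻¹`. -/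
def diagSL (μ : ℂ) (hμ : μ ≠ 0) : SL(2, ℂ) :=
  ⟨!![μ, 0; 0, μ⁻¹], by simp [Matrix.det_fin_two, hμ]⟩

theorem coe_diagSL (μ : ℂ) (hμ : μ ≠ 0) :
    (diagSL μ hμ : Matrix (Fin 2) (Fin 2) ℂ) = !![μ, 0; 0, μ⁻¹] := rfl

theorem slRho_diagSL (μ : ℂ) (hμ : μ ≠ 0) : (slRho (diagSL μ hμ) : Matrix (Fin 4) (Fin 4) ℝ) =
    torusMat (‖μ‖ ^ 2) (‖μ‖ ^ 2)⁻¹ (μ * star μ⁻¹) := by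
  have h1 : μ * star μ = (‖μ‖ ^ 2 : ℝ) := by
    rw [Complex.star_def, Complex.mul_conj, Complex.normSq_eq_norm_sq]
  have h2 : μ⁻¹ * star μ⁻¹ = ((‖μ‖ ^ 2)⁻¹ : ℝ) := by
    rw [star_inv₀, ← mul_inv, h1, Complex.ofReal_inv]
  refine Matrix.ext_of_mulVec_single fun i => ?_
  rw [slRho_mulVec, coe_diagSL]
  have key : ∀ v : Fin 4 → ℝ, !![μ, 0; 0, μ⁻¹] * toHerm v * !![μ, 0; 0, μ⁻¹]ᴴ =
      !![μ * star μ * v 0, μ * star μ⁻¹ * (v 2 + v 3 * Complex.I);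
        μ⁻¹ * star μ * (v 2 - v 3 * Complex.I), μ⁻¹ * star μ⁻¹ * v 1] := by
    intro v
    ext i j
    fin_cases i <;> fin_cases j <;>
      simp [toHerm, Matrix.mul_apply, Matrix.conjTranspose_apply] <;> ring
  rw [key, h1, h2]
  generalize μ * star μ⁻¹ = u
  generalize ‖μ‖ ^ 2 = x
  ext j
  fin_cases i <;> fin_cases j <;> simp [ofHerm, torusMat]

/-- The exponential of a nilpotent tangent vector lies in the Zariski closure. -/
theorem mem_zariskiClosure_of_cube_eq_zero {n : Type*} [Fintype n] [DecidableEq n]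
    {H : Subgroup (GL n ℝ)} {Y : Matrix n n ℝ} (hY : Y ∈ tangent H) (h3 : Y * (Y * Y) = 0)
    {g : GL n ℝ} (hg : (g : Matrix n n ℝ) = 1 + Y + (1 / 2 : ℝ) • (Y * Y)) :
    g ∈ zariskiClosure H := by
  have e : ∀ (A B D : Matrix n n ℝ) (i j : n), ∑ k, Polynomial.C (Y i k) * (Polynomial.C (A k j) +
      Polynomial.C (B k j) * Polynomial.X + Polynomial.C (D k j) * Polynomial.X ^ 2) =
      Polynomial.C ((Y * A) i j) + Polynomial.C ((Y * B) i j) * Polynomial.X +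
        Polynomial.C ((Y * D) i j) * Polynomial.X ^ 2 := by
    intro A B D i j
    simp only [Matrix.mul_apply, map_sum, map_mul, Finset.sum_mul]
    rw [← Finset.sum_add_distrib, ← Finset.sum_add_distrib]
    exact Finset.sum_congr rfl fun k _ => by ring
  -- The curve is `exp (s Y)`, a quadratic polynomial in `s` because `Y ^ 3 = 0`; it is evaluated at
  -- `s = 1`.
  refine mem_zariskiClosure_of_curve hY
    (Matrix.of fun i j => Polynomial.C ((1 : Matrix n n ℝ) i j) +
      Polynomial.C (Y i j) * Polynomial.X +
      Polynomial.C (((1 / 2 : ℝ) • (Y * Y)) i j) * Polynomial.X ^ 2)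
    (fun i j => by simp) (fun i j => ?_) 1 _ (fun i j => ?_)
  · simp only [Matrix.of_apply]
    rw [e, Matrix.mul_smul, h3, Matrix.mul_one]
    generalize Y * Y = Z
    have h : Polynomial.C (Z i j) = Polynomial.C (1 / 2 * Z i j) * Polynomial.C 2 := by
      rw [← Polynomial.C_mul]
      congr 1
      ring
    simp only [Polynomial.derivative_add, Polynomial.derivative_C, Polynomial.derivative_C_mul,
      Polynomial.derivative_X, Polynomial.derivative_X_pow, Matrix.smul_apply, Matrix.zero_apply,
      smul_eq_mul, mul_zero, map_zero, zero_mul, add_zero, mul_one, zero_add, h]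
    norm_num
    ring
  · rw [hg]
    simp

/-- With `E ^ 2 = 0` the map `T ↦ E T + T E†` has square `T ↦ 2 E T E†` and cube zero, so its
exponential is `T ↦ (1 + E) T (1 + E)†`. -/
theorem slRho_mem_zariskiClosure {E : Matrix (Fin 2) (Fin 2) ℂ} (hE : E ∈ tangentSL H)
    (hE2 : E * E = 0) {γ : SL(2, ℂ)} (hγ : (γ : Matrix (Fin 2) (Fin 2) ℂ) = 1 + E) :
    slRho γ ∈ zariskiClosure H := by
  have hEE : Eᴴ * Eᴴ = 0 := by rw [← Matrix.conjTranspose_mul, hE2, Matrix.conjTranspose_zero]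
  have h2 : ∀ v, toHerm (diffRho E *ᵥ (diffRho E *ᵥ v)) = (2 : ℂ) • (E * toHerm v * Eᴴ) := by
    intro v
    rw [toHerm_diffRho_mulVec, toHerm_diffRho_mulVec, Matrix.mul_add, Matrix.add_mul,
      ← Matrix.mul_assoc E E, hE2, Matrix.zero_mul, Matrix.mul_assoc (toHerm v), hEE,
      Matrix.mul_zero, two_smul, ← Matrix.mul_assoc]
    simp
  refine mem_zariskiClosure_of_cube_eq_zero hE ?_ ?_
  · refine Matrix.ext_of_mulVec_single fun i => ?_
    rw [← Matrix.mulVec_mulVec, ← Matrix.mulVec_mulVec, Matrix.zero_mulVec, diffRho_mulVec,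
      h2, Matrix.mul_smul, Matrix.smul_mul]
    have e1 : ∀ T, E * (E * T * Eᴴ) = 0 := fun T => by
      rw [← Matrix.mul_assoc, ← Matrix.mul_assoc, hE2, Matrix.zero_mul, Matrix.zero_mul]
    have e2 : ∀ T, E * T * Eᴴ * Eᴴ = 0 := fun T => by
      rw [Matrix.mul_assoc, hEE, Matrix.mul_zero]
    rw [e1, e2]
    ext j
    fin_cases j <;> simp [ofHerm]
  · refine Matrix.ext_of_mulVec_single fun i => ?_
    generalize (Pi.single i 1 : Fin 4 → ℝ) = v
    have hh : (2 : ℝ) • ofHerm (E * toHerm v * Eᴴ) = diffRho E *ᵥ (diffRho E *ᵥ v) := by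
      rw [← ofHerm_toHerm (diffRho E *ᵥ (diffRho E *ᵥ v)), h2, two_smul, two_smul, ofHerm_add]
    rw [slRho_mulVec, hγ, Matrix.add_mulVec, Matrix.add_mulVec, Matrix.smul_mulVec,
      ← Matrix.mulVec_mulVec, ← hh, smul_smul, Matrix.one_mulVec, diffRho_mulVec,
      Matrix.conjTranspose_add, Matrix.conjTranspose_one]
    have e3 : v = ofHerm (toHerm v) := (ofHerm_toHerm v).symm
    generalize toHerm v = T at *
    rw [e3, show (1 / 2 * 2 : ℝ) = 1 by norm_num, one_smul, ← ofHerm_add, ← ofHerm_add]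
    congr 1
    noncomm_ring

theorem slRho_upperSL_mem {z : ℂ} (hz : !![0, z; 0, 0] ∈ tangentSL H) :
    slRho (upperSL z) ∈ zariskiClosure H := by
  refine slRho_mem_zariskiClosure hz ?_ ?_
  · ext i j
    fin_cases i <;> fin_cases j <;> simp
  · rw [coe_upperSL]
    ext i j
    fin_cases i <;> fin_cases j <;> simp

theorem slRho_lowerSL_mem {z : ℂ} (hz : !![0, 0; z, 0] ∈ tangentSL H) :
    slRho (lowerSL z) ∈ zariskiClosure H := by
  refine slRho_mem_zariskiClosure hz ?_ ?_
  · ext i j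
    fin_cases i <;> fin_cases j <;> simp
  · rw [coe_lowerSL]
    ext i j
    fin_cases i <;> fin_cases j <;> simp

end

/-! ### From the Lie algebra to the group: tori, generation of `SO_M` -/

section

variable {H : Subgroup (GL (Fin 4) ℝ)}

/-- An element of the split torus of the orthogonal group. -/
def torusGL (y : ℝ) (hy : y ≠ 0) : GL (Fin 4) ℝ where
  val := torusMat y y⁻¹ 1
  inv := torusMat y⁻¹ y 1
  val_inv := by rw [torusMat_mul, mul_inv_cancel₀ hy, inv_mul_cancel₀ hy, mul_one, torusMat_one]
  inv_val := by rw [torusMat_mul, mul_inv_cancel₀ hy, inv_mul_cancel₀ hy, mul_one, torusMat_one]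

theorem coe_torusGL (y : ℝ) (hy : y ≠ 0) :
    (torusGL y hy : Matrix (Fin 4) (Fin 4) ℝ) = torusMat y y⁻¹ 1 := rfl

theorem norm_mul_star_inv {μ : ℂ} (hμ : μ ≠ 0) : ‖μ * star μ⁻¹‖ = 1 := by
  rw [norm_mul, norm_star, norm_inv, mul_inv_cancel₀ (norm_ne_zero_iff.2 hμ)]

/-- The split torus that contains a loxodromic element of the Zariski closure lies in the Zariski
closure. -/
theorem conj_torusGL_mem {μ : ℂ} (hμ : μ ≠ 0) (hμ1 : 1 < ‖μ‖) (S : SL(2, ℂ))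
    (h : slRho (S * diagSL μ hμ * S⁻¹) ∈ zariskiClosure H) {y : ℝ} (hy : y ≠ 0) :
    slRho S * torusGL y hy * (slRho S)⁻¹ ∈ zariskiClosure H := by
  intro p hp
  -- Conjugating the polynomial by `slRho S` reduces the claim to the diagonal element and its
  -- powers.
  obtain ⟨q, hq⟩ := exists_evalMat_translate (slRho S : Matrix (Fin 4) (Fin 4) ℝ)
    (((slRho S)⁻¹ : GL (Fin 4) ℝ) : Matrix (Fin 4) (Fin 4) ℝ) p
  rw [evalAt_eq_evalMat, Units.val_mul, Units.val_mul, ← hq, coe_torusGL]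
  refine evalMat_torusMat_eq_zero (x := ‖μ‖ ^ 2) (by nlinarith) (norm_mul_star_inv hμ)
    (fun n => ?_) hy
  rw [← slRho_diagSL μ hμ, ← Units.val_pow_eq_pow_val, hq, ← Units.val_mul, ← Units.val_mul,
    ← map_pow, ← map_inv, ← map_mul, ← map_mul, ← conj_pow, map_pow]
  exact (zariskiClosure H).pow_mem h n p hp

/-- The infinitesimal generator of the hyperbolic part of a loxodromic element lies in the Lie
algebra. -/
theorem conj_mem_tangentSL_of_loxodromic {μ : ℂ} (hμ : μ ≠ 0) (hμ1 : 1 < ‖μ‖) (S : SL(2, ℂ))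
    (h : slRho (S * diagSL μ hμ * S⁻¹) ∈ H) :
    (S : Matrix (Fin 2) (Fin 2) ℂ) * !![1, 0; 0, -1] *
      ((S⁻¹ : SL(2, ℂ)) : Matrix (Fin 2) (Fin 2) ℂ) ∈ tangentSL H := by
  let D : Matrix (Fin 4) (Fin 4) ℝ := !![1, 0, 0, 0; 0, -1, 0, 0; 0, 0, 0, 0; 0, 0, 0, 0]
  have hc : (!![1, 0; 0, -1] : Matrix (Fin 2) (Fin 2) ℂ)ᴴ = !![1, 0; 0, -1] := by
    ext i j
    fin_cases i <;> fin_cases j <;> simp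
  -- `D` is the velocity at `t = 0` of the torus element with parameter `exp t`, whose conjugates by
  -- `slRho S` are in the closure.
  have hD : diffRho !![1, 0; 0, -1] = (2 : ℝ) • D := by
    refine Matrix.ext_of_mulVec_single fun i => ?_
    rw [diffRho_mulVec, hc]
    ext j
    fin_cases i <;> fin_cases j <;>
      simp [D, ofHerm, toHerm, Matrix.vecHead, Matrix.vecTail] <;>
      norm_num
  rw [tangentSL, Submodule.mem_comap, diffRho_conj, hD, Matrix.mul_smul, Matrix.smul_mul]
  refine Submodule.smul_mem _ _ ?_
  refine mem_tangent_of_curve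
    (fun t => slRho S * torusGL (Real.exp t) (Real.exp_pos t).ne' * (slRho S)⁻¹)
    (fun t => conj_torusGL_mem hμ hμ1 S (le_zariskiClosure H h) _) ?_ fun i j => ?_
  · have : torusGL (Real.exp 0) (Real.exp_pos 0).ne' = 1 := by
      apply Units.ext
      rw [coe_torusGL, Real.exp_zero, inv_one, torusMat_one, Units.val_one]
    rw [this, mul_one, mul_inv_cancel]
  · have hT : ∀ k l, HasDerivAt (fun s => torusMat (Real.exp s) (Real.exp s)⁻¹ 1 k l) (D k l) 0 := by
      have h1 : HasDerivAt Real.exp 1 0 := by simpa using Real.hasDerivAt_exp 0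
      have h2 : HasDerivAt (fun s => (Real.exp s)⁻¹) (-1) 0 := by
        simpa using h1.fun_inv (Real.exp_pos 0).ne'
      intro k l
      fin_cases k <;> fin_cases l <;> simp only [torusMat, D] <;>
        first | exact h1 | exact h2 | exact hasDerivAt_const _ _
    simp only [Units.val_mul, coe_torusGL, Matrix.mul_apply]
    exact HasDerivAt.fun_sum fun k _ => (HasDerivAt.fun_sum fun l _ =>
      (hT l k).const_mul _).mul_const _

/-- The entries of `gᵀ G g - G`, with `G` the Gram matrix, are polynomials in the entries of `g`. -/
theorem zariskiClosure_le_OM (hH : H ≤ OM) : zariskiClosure H ≤ OM := by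
  intro g hg
  let X : Matrix (Fin 4) (Fin 4) (MvPolynomial (Fin 4 × Fin 4) ℝ) :=
    Matrix.of fun i j => MvPolynomial.X (i, j)
  let P := Xᵀ * gramM.map MvPolynomial.C * X - gramM.map MvPolynomial.C
  have hP : ∀ (h : GL (Fin 4) ℝ) i j, evalAt h (P i j) =
      ((h : Matrix (Fin 4) (Fin 4) ℝ)ᵀ * gramM * (h : Matrix (Fin 4) (Fin 4) ℝ)) i j -
        gramM i j := by
    intro h i j
    simp [evalAt, P, X, Matrix.mul_apply]
  show _ = _
  ext i j
  have h0 := hg (P i j) fun h hh => by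
    have h1 : (h : Matrix (Fin 4) (Fin 4) ℝ)ᵀ * gramM * (h : Matrix (Fin 4) (Fin 4) ℝ) = gramM :=
      hH hh
    rw [hP, h1, sub_self]
  rw [hP] at h0
  exact sub_eq_zero.1 h0

/-- The diagonal matrix is the quotient of two antidiagonal ones, each a product of three unipotent
matrices. -/
theorem diagSL_eq (μ : ℂ) (hμ : μ ≠ 0) : diagSL μ hμ =
    upperSL μ * lowerSL (-μ⁻¹) * upperSL μ * (upperSL 1 * lowerSL (-1) * upperSL 1)⁻¹ := by
  rw [eq_mul_inv_iff_mul_eq]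
  ext i j
  fin_cases i <;> fin_cases j <;>
    simp [coe_diagSL, coe_upperSL, coe_lowerSL, Matrix.mul_apply, hμ]

theorem slRho_mem_SOM_of_sq {γ δ : SL(2, ℂ)} (h : γ = δ * δ) : slRho γ ∈ SOM := by
  rw [h]
  exact extRho_sq_mem_SOM (SemidirectProduct.inl δ)

theorem slRho_upperSL_mem_SOM (z : ℂ) : slRho (upperSL z) ∈ SOM :=
  slRho_mem_SOM_of_sq (δ := upperSL (z / 2)) (by rw [← upperSL_add, add_halves])

theorem slRho_lowerSL_mem_SOM (z : ℂ) : slRho (lowerSL z) ∈ SOM :=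
  slRho_mem_SOM_of_sq (δ := lowerSL (z / 2)) (by rw [← lowerSL_add, add_halves])

theorem slRho_diagSL_mem {G : Subgroup (GL (Fin 4) ℝ)} (hU : ∀ z, slRho (upperSL z) ∈ G)
    (hL : ∀ z, slRho (lowerSL z) ∈ G) (μ : ℂ) (hμ : μ ≠ 0) : slRho (diagSL μ hμ) ∈ G := by
  rw [diagSL_eq]
  simp only [map_mul, map_inv]
  exact G.mul_mem (G.mul_mem (G.mul_mem (hU _) (hL _)) (hU _))
    (G.inv_mem (G.mul_mem (G.mul_mem (hU _) (hL _)) (hU _)))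

theorem torusGL_mem_SOM (y : ℝ) (hy : y ≠ 0) : torusGL y hy ∈ SOM := by
  refine mem_SOM_iff.2 ⟨?_, ?_⟩
  · show _ = _
    rw [coe_torusGL]
    ext i j
    fin_cases i <;> fin_cases j <;>
      simp [torusMat, gramM, Matrix.mul_apply, Fin.sum_univ_four] <;> field_simp
  · rw [coe_torusGL]
    simp [torusMat, Matrix.det_succ_row_zero, Fin.sum_univ_succ, hy]

/-- An element of `SO_M` that fixes the first two basis vectors is a rotation. -/
theorem eq_torusMat_of_mem_SOM {g : GL (Fin 4) ℝ} (hg : g ∈ SOM)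
    (h0 : (g : Matrix (Fin 4) (Fin 4) ℝ) *ᵥ Pi.single 0 1 = Pi.single 0 1)
    (h1 : (g : Matrix (Fin 4) (Fin 4) ℝ) *ᵥ Pi.single 1 1 = Pi.single 1 1) :
    ∃ u : ℂ, ‖u‖ = 1 ∧ (g : Matrix (Fin 4) (Fin 4) ℝ) = torusMat 1 1 u := by
  obtain ⟨hO, hdet⟩ := mem_SOM_iff.1 hg
  rw [mem_OM] at hO
  generalize (g : Matrix (Fin 4) (Fin 4) ℝ) = m at *
  rw [Matrix.mulVec_single_one] at h0 h1
  have c0 : ∀ i, m i 0 = (Pi.single 0 1 : Fin 4 → ℝ) i := fun i => congrFun h0 i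
  have c1 : ∀ i, m i 1 = (Pi.single 1 1 : Fin 4 → ℝ) i := fun i => congrFun h1 i
  have hE : ∀ i j, -(m 0 i * m 1 j + m 1 i * m 0 j) / 2 + m 2 i * m 2 j + m 3 i * m 3 j =
      gramM i j := by
    intro i j
    rw [← hO]
    simp [Matrix.mul_apply, Fin.sum_univ_four, gramM]
    ring
  have c00 := c0 0; have c01 := c0 1; have c02 := c0 2; have c03 := c0 3
  have c10 := c1 0; have c11 := c1 1; have c12 := c1 2; have c13 := c1 3
  simp at c00 c01 c02 c03 c10 c11 c12 c13
  -- Orthogonality to the two fixed vectors makes the matrix block diagonal; the remaining block is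
  -- orthogonal of determinant one.
  have e02 := hE 0 2; have e03 := hE 0 3; have e12 := hE 1 2; have e13 := hE 1 3
  have e22 := hE 2 2; have e23 := hE 2 3; have e33 := hE 3 3
  simp [c00, c01, c02, c03, c10, c11, c12, c13, gramM] at e02 e03 e12 e13 e22 e23 e33
  simp [e02, e03, e12, e13] at e22 e23 e33
  simp [Matrix.det_succ_row_zero, Fin.sum_univ_succ, Fin.succAbove, c00, c01, c02, c03, c11,
    c12, c13, e02, e03] at hdet
  have e1 : m 3 3 = m 2 2 := by
    linear_combination m 2 2 * hdet + m 3 2 * e23 - m 3 3 * e22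
  have e2 : m 2 3 = -m 3 2 := by
    linear_combination m 2 2 * e23 - m 3 2 * hdet - m 2 3 * e22
  refine ⟨⟨m 2 2, m 3 2⟩, ?_, ?_⟩
  · rw [← sq_eq_sq₀ (norm_nonneg _) zero_le_one, ← Complex.normSq_eq_norm_sq, Complex.normSq_mk,
      e22, one_pow]
  · ext i j
    fin_cases i <;> fin_cases j <;>
      simp [torusMat, c00, c01, c02, c03, c10, c11, c12, c13, e02, e03, e12, e13, e1, e2]

/-- The group `SO_M` is generated by unipotent elements and the split torus. -/
theorem SOM_le_of_mem {G : Subgroup (GL (Fin 4) ℝ)} (hU : ∀ z, slRho (upperSL z) ∈ G)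
    (hL : ∀ z, slRho (lowerSL z) ∈ G) (hT : ∀ y hy, torusGL y hy ∈ G) : SOM ≤ G := by
  -- A null vector is a singular Hermitian matrix, here brought to the first diagonal entry by row
  -- and column operations, or by the antidiagonal matrix if that entry is zero.
  have step0 : ∀ v : Fin 4 → ℝ, quadM v = 0 → ∃ x ∈ G ⊓ SOM, ∃ c : ℝ,
      (x : Matrix (Fin 4) (Fin 4) ℝ) *ᵥ v = c • Pi.single 0 1 := by
    intro v hv
    rw [quadM] at hv
    by_cases h : v 0 = 0
    · have h2 : v 2 = 0 := by rw [h] at hv; nlinarith [sq_nonneg (v 2), sq_nonneg (v 3)]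
      have h3 : v 3 = 0 := by rw [h] at hv; nlinarith [sq_nonneg (v 2), sq_nonneg (v 3)]
      refine ⟨slRho (upperSL 1) * slRho (lowerSL (-1)) * slRho (upperSL 1),
        ⟨G.mul_mem (G.mul_mem (hU _) (hL _)) (hU _), SOM.mul_mem (SOM.mul_mem
          (slRho_upperSL_mem_SOM _) (slRho_lowerSL_mem_SOM _)) (slRho_upperSL_mem_SOM _)⟩,
        v 1, ?_⟩
      have e : ((upperSL 1 * lowerSL (-1) * upperSL 1 : SL(2, ℂ)) : Matrix (Fin 2) (Fin 2) ℂ) =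
          !![0, 1; -1, 0] := by
        ext i j
        fin_cases i <;> fin_cases j <;>
          simp [coe_upperSL, coe_lowerSL, Matrix.mul_apply]
      have ec : (!![0, 1; -1, 0] : Matrix (Fin 2) (Fin 2) ℂ)ᴴ = !![0, -1; 1, 0] := by
        ext i j
        fin_cases i <;> fin_cases j <;> simp
      rw [← map_mul, ← map_mul, slRho_mulVec, e, ec]
      ext i
      fin_cases i <;> simp [ofHerm, toHerm, h, h2, h3]
    · refine ⟨slRho (lowerSL (-(v 2 - v 3 * Complex.I) / v 0)),
        ⟨hL _, slRho_lowerSL_mem_SOM _⟩, v 0, ?_⟩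
      have hv' : (v 0 * v 1 : ℂ) = v 2 ^ 2 + v 3 ^ 2 := by
        norm_cast
        linarith
      have hc : (v 0 : ℂ) ≠ 0 := by exact_mod_cast h
      have e : (lowerSL (-(v 2 - v 3 * Complex.I) / v 0) : Matrix (Fin 2) (Fin 2) ℂ) * toHerm v *
          (lowerSL (-(v 2 - v 3 * Complex.I) / v 0) : Matrix (Fin 2) (Fin 2) ℂ)ᴴ =
          !![(v 0 : ℂ), 0; 0, 0] := by
        rw [coe_lowerSL]
        ext i j
        fin_cases i <;> fin_cases j <;>
          simp [toHerm, Matrix.mul_apply, Matrix.conjTranspose_apply] <;> field_simp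
        · ring
        · ring
        · linear_combination hv' + (v 3 : ℂ) ^ 2 * Complex.I_sq
      rw [slRho_mulVec, e]
      ext i
      fin_cases i <;> simp [ofHerm]
  -- Upper unipotent matrices fix the first basis vector, so the second null vector can be moved
  -- without disturbing the first.
  have step1 : ∀ v : Fin 4 → ℝ, quadM v = 0 → v 1 ≠ 0 → ∃ x ∈ G ⊓ SOM,
      (x : Matrix (Fin 4) (Fin 4) ℝ) *ᵥ Pi.single 0 1 = Pi.single 0 1 ∧
      (x : Matrix (Fin 4) (Fin 4) ℝ) *ᵥ v = v 1 • Pi.single 1 1 := by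
    intro v hv h
    rw [quadM] at hv
    refine ⟨slRho (upperSL (-(v 2 + v 3 * Complex.I) / v 1)),
      ⟨hU _, slRho_upperSL_mem_SOM _⟩, ?_, ?_⟩
    · have e : ∀ z : ℂ, (upperSL z : Matrix (Fin 2) (Fin 2) ℂ) * toHerm (Pi.single 0 1) *
          (upperSL z : Matrix (Fin 2) (Fin 2) ℂ)ᴴ = !![1, 0; 0, 0] := by
        intro z
        rw [coe_upperSL]
        ext i j
        fin_cases i <;> fin_cases j <;>
          simp [toHerm, Matrix.mul_apply, Matrix.conjTranspose_apply]
      rw [slRho_mulVec, e]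
      ext i
      fin_cases i <;> simp [ofHerm]
    · have hv' : (v 0 * v 1 : ℂ) = v 2 ^ 2 + v 3 ^ 2 := by
        norm_cast
        linarith
      have hc : (v 1 : ℂ) ≠ 0 := by exact_mod_cast h
      have e : (upperSL (-(v 2 + v 3 * Complex.I) / v 1) : Matrix (Fin 2) (Fin 2) ℂ) * toHerm v *
          (upperSL (-(v 2 + v 3 * Complex.I) / v 1) : Matrix (Fin 2) (Fin 2) ℂ)ᴴ =
          !![0, 0; 0, (v 1 : ℂ)] := by
        rw [coe_upperSL]
        ext i j
        fin_cases i <;> fin_cases j <;>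
          simp [toHerm, Matrix.mul_apply, Matrix.conjTranspose_apply] <;> field_simp
        · linear_combination hv' + (v 3 : ℂ) ^ 2 * Complex.I_sq
        · ring
        · ring
      rw [slRho_mulVec, e]
      ext i
      fin_cases i <;> simp [ofHerm]
  intro g hg
  have hO := mem_OM_iff.1 (mem_SOM_iff.1 hg).1
  obtain ⟨x, hx, c, hxc⟩ := step0 ((g : Matrix (Fin 4) (Fin 4) ℝ) *ᵥ Pi.single 0 1)
    (by rw [hO]; simp [quadM])
  have hxO := mem_OM_iff.1 (mem_SOM_iff.1 hx.2).1
  set w := (x : Matrix (Fin 4) (Fin 4) ℝ) *ᵥ ((g : Matrix (Fin 4) (Fin 4) ℝ) *ᵥ Pi.single 1 1)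
    with hw
  have hw0 : quadM w = 0 := by
    rw [hw, hxO, hO]
    simp [quadM]
  -- The pairing of the images of the two basis null vectors is that of the basis vectors, so one
  -- torus element normalizes both scalars. What remains of `g` is a rotation.
  have hcw : c * w 1 = 1 := by
    have h1 : quadM (c • Pi.single 0 1 + w) = -1 := by
      rw [hw, ← hxc, ← Matrix.mulVec_add, ← Matrix.mulVec_add, hxO, hO]
      simp [quadM]
    simp only [quadM, Pi.add_apply, Pi.smul_apply, Pi.single_apply] at h1 hw0
    simp at h1
    linarith
  have hc : c ≠ 0 := left_ne_zero_of_mul_eq_one hcw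
  obtain ⟨x', hx', hx0, hx1⟩ := step1 w hw0 (right_ne_zero_of_mul_eq_one hcw)
  set t := torusGL c⁻¹ (inv_ne_zero hc) with ht
  have ht0 : (t : Matrix (Fin 4) (Fin 4) ℝ) *ᵥ Pi.single 0 1 = c⁻¹ • Pi.single 0 1 := by
    rw [ht, coe_torusGL, Matrix.mulVec_single_one]
    ext i
    fin_cases i <;> simp [torusMat]
  have ht1 : (t : Matrix (Fin 4) (Fin 4) ℝ) *ᵥ Pi.single 1 1 = c • Pi.single 1 1 := by
    rw [ht, coe_torusGL, Matrix.mulVec_single_one]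
    ext i
    fin_cases i <;> simp [torusMat]
  have hy : t * (x' * x) ∈ G ⊓ SOM :=
    mul_mem ⟨hT _ _, torusGL_mem_SOM _ _⟩ (mul_mem hx' hx)
  obtain ⟨u, hu, hgu⟩ := eq_torusMat_of_mem_SOM (g := t * (x' * x) * g) (SOM.mul_mem hy.2 hg)
    (by
      simp only [Units.val_mul, ← Matrix.mulVec_mulVec, hxc, Matrix.mulVec_smul, hx0, ht0]
      rw [smul_smul, mul_inv_cancel₀ hc, one_smul])
    (by
      simp only [Units.val_mul, ← Matrix.mulVec_mulVec]
      rw [← hw, hx1, Matrix.mulVec_smul, ht1, smul_smul, mul_comm, hcw, one_smul])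
  -- For `‖μ‖ = 1` the matrix with diagonal `μ, μ⁻¹` rotates `r + m i` by `μ ^ 2`, hence the square
  -- root.
  obtain ⟨μ, rfl⟩ := Complex.isSquare u
  have hμ1 : ‖μ‖ = 1 := by
    rw [norm_mul] at hu
    nlinarith [norm_nonneg μ]
  have hμ0 : μ ≠ 0 := by
    rintro rfl
    simp at hμ1
  rw [← Subgroup.mul_mem_cancel_left _ hy.1]
  have : t * (x' * x) * g = slRho (diagSL μ hμ0) := by
    apply Units.ext
    rw [hgu, slRho_diagSL, hμ1, Complex.inv_eq_conj hμ1, Complex.star_def, Complex.conj_conj,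
      one_pow, inv_one]
  rw [this]
  exact slRho_diagSL_mem hU hL μ hμ0

/-- The unipotent elements of the closure produce the loxodromic matrix with diagonal `2, 1 / 2`,
and it brings its whole split torus, including negative parameters. -/
theorem SOM_le_zariskiClosure (hU : ∀ z, !![0, z; 0, 0] ∈ tangentSL H)
    (hL : ∀ z, !![0, 0; z, 0] ∈ tangentSL H) : SOM ≤ zariskiClosure H := by
  refine SOM_le_of_mem (fun z => slRho_upperSL_mem (hU z)) (fun z => slRho_lowerSL_mem (hL z))
    fun y hy => ?_
  have h := conj_torusGL_mem (H := H) (μ := 2) two_ne_zero (by norm_num) 1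
    (by
      rw [one_mul, inv_one, mul_one]
      exact slRho_diagSL_mem (fun z => slRho_upperSL_mem (hU z))
        (fun z => slRho_lowerSL_mem (hL z)) _ _) hy
  rwa [map_one, one_mul, inv_one, mul_one] at h

/-- `SO_M` has index at most two in `O_M`: the product of two elements of determinant `-1` is in
`SO_M`. -/
theorem eq_OM_or_eq_SOM {G : Subgroup (GL (Fin 4) ℝ)} (h1 : SOM ≤ G) (h2 : G ≤ OM) :
    G = OM ∨ G = SOM := by
  by_cases h : G ≤ SOM
  · exact Or.inr (le_antisymm h h1)
  · left
    refine le_antisymm h2 fun g hg => ?_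
    obtain ⟨x, hx, hxS⟩ := SetLike.not_le_iff_exists.1 h
    have hdet : ∀ y ∈ OM, y ∉ SOM → (y : Matrix (Fin 4) (Fin 4) ℝ).det = -1 := fun y hy hyS =>
      (det_sq_of_mem_OM hy).resolve_left fun h => hyS (mem_SOM_iff.2 ⟨hy, h⟩)
    by_cases hgS : g ∈ SOM
    · exact h1 hgS
    · rw [← Subgroup.mul_mem_cancel_right G hx]
      refine h1 (mem_SOM_iff.2 ⟨OM.mul_mem hg (h2 hx), ?_⟩)
      rw [Units.val_mul, Matrix.det_mul, hdet g hg hgS, hdet x (h2 hx) hxS]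
      norm_num

end

section

/-! ### Nilpotent elements of a real Lie algebra of `2 × 2` matrices -/

/-- The points of the Riemann sphere that are kernels of nonzero nilpotent elements of `t`. -/
def nilpotentKernels (t : Submodule ℝ (Matrix (Fin 2) (Fin 2) ℂ)) : Set (OnePoint ℂ) :=
  {p | ∃ N ∈ t, N ≠ 0 ∧ N * N = 0 ∧ N *ᵥ lift p = 0}

section Lie

variable {t : Submodule ℝ (Matrix (Fin 2) (Fin 2) ℂ)}

theorem exists_of_coe_mem_nilpotentKernels {z : ℂ} (hz : (z : OnePoint ℂ) ∈ nilpotentKernels t) :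
    ∃ c : ℂ, c ≠ 0 ∧ c • !![z, -z ^ 2; 1, -z] ∈ t := by
  obtain ⟨N, hN, h0, h2, hk⟩ := hz
  have k0 := congrFun hk 0
  have k1 := congrFun hk 1
  have m0 := congrFun (congrFun h2 0) 0
  have m1 := congrFun (congrFun h2 1) 0
  simp [Matrix.mulVec, dotProduct, Fin.sum_univ_two, Matrix.mul_apply] at k0 k1 m0 m1
  have e0 : N 0 1 = -(N 0 0 * z) := by linear_combination k0
  have e1 : N 1 1 = -(N 1 0 * z) := by linear_combination k1
  have hc : N 1 0 ≠ 0 := by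
    intro hc
    have ha : N 0 0 = 0 := by simpa [hc] using m0
    refine h0 ?_
    ext i j
    fin_cases i <;> fin_cases j <;> simp [e0, e1, ha, hc]
  have ha : N 0 0 = N 1 0 * z := by
    rw [e1] at m1
    have : N 1 0 * (N 0 0 - N 1 0 * z) = 0 := by linear_combination m1
    exact sub_eq_zero.1 ((mul_eq_zero.1 this).resolve_left hc)
  refine ⟨N 1 0, hc, ?_⟩
  convert hN using 1
  ext i j
  fin_cases i <;> fin_cases j <;> simp [e0, e1, ha]
  ring

theorem exists_of_infty_mem_nilpotentKernels (h : ∞ ∈ nilpotentKernels t) :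
    ∃ c : ℂ, c ≠ 0 ∧ c • !![0, 1; 0, 0] ∈ t := by
  obtain ⟨N, hN, h0, h2, hk⟩ := h
  have k0 := congrFun hk 0
  have k1 := congrFun hk 1
  have m1 := congrFun (congrFun h2 1) 1
  simp [Matrix.mulVec, dotProduct, Fin.sum_univ_two, Matrix.mul_apply] at k0 k1 m1
  simp [k1] at m1
  have e : N = N 0 1 • !![0, 1; 0, 0] := by
    ext i j
    fin_cases i <;> fin_cases j <;> simp [k0, k1, m1]
  refine ⟨N 0 1, fun hc => h0 (by rw [e, hc, zero_smul]), ?_⟩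
  rwa [← e]

/-- A singular `P` is a column `x` times a row `y`, and `P Q P = x (y Q x) y`, where the scalar in
the middle is the trace of `P Q`. -/
theorem mul_mul_eq_trace_smul {P : Matrix (Fin 2) (Fin 2) ℂ} (hP : P.det = 0)
    (Q : Matrix (Fin 2) (Fin 2) ℂ) : P * Q * P = (P * Q).trace • P := by
  rw [Matrix.det_fin_two] at hP
  ext i j
  fin_cases i <;> fin_cases j <;>
    simp [Matrix.mul_apply, Matrix.trace_fin_two, Fin.sum_univ_two]
  · linear_combination -(Q 1 1) * hP
  · linear_combination Q 0 1 * hP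
  · linear_combination Q 1 0 * hP
  · linear_combination -(Q 0 0) * hP

theorem det_eq_zero_of_mul_self {P : Matrix (Fin 2) (Fin 2) ℂ} (hP : P * P = 0) : P.det = 0 := by
  have := congrArg Matrix.det hP
  rw [Matrix.det_mul, Matrix.det_zero] at this
  exact mul_self_eq_zero.1 this

/-- For `P ^ 2 = 0` the double bracket `[[P, Q], P]` is `2 P Q P`, a multiple of `P` by `2 tr (P
Q)`. A trace that is not real thus enlarges the real line through `P` to a complex one. -/
theorem trace_smul_mem (hlie : ∀ X ∈ t, ∀ Y ∈ t, X * Y - Y * X ∈ t)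
    {P Q : Matrix (Fin 2) (Fin 2) ℂ} (hP : P ∈ t) (hPP : P * P = 0) (hQ : Q ∈ t) :
    (P * Q).trace • P ∈ t := by
  have h := hlie _ (hlie _ hP _ hQ) _ hP
  have e : (P * Q - Q * P) * P - P * (P * Q - Q * P) = (2 : ℝ) • ((P * Q).trace • P) := by
    rw [← mul_mul_eq_trace_smul (det_eq_zero_of_mul_self hPP), Matrix.sub_mul, Matrix.mul_sub,
      Matrix.mul_assoc Q, hPP, Matrix.mul_zero, ← Matrix.mul_assoc P P, hPP, Matrix.zero_mul,
      two_smul, Matrix.mul_assoc]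
    abel
  rw [e] at h
  simpa [smul_smul] using t.smul_mem (2⁻¹ : ℝ) h

theorem smul_mem_of_im_ne_zero {P : Matrix (Fin 2) (Fin 2) ℂ} (hP : P ∈ t) {w : ℂ}
    (hw : w.im ≠ 0) (hwP : w • P ∈ t) (z : ℂ) : z • P ∈ t := by
  have e : z • P = (z.re - z.im / w.im * w.re) • P + (z.im / w.im) • (w • P) := by
    have hz : z = ((z.re - z.im / w.im * w.re : ℝ) : ℂ) + ((z.im / w.im : ℝ) : ℂ) * w := by
      apply Complex.ext <;> simp
      field_simp
    conv_lhs => rw [hz]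
    rw [add_smul, mul_smul, Complex.coe_smul, Complex.coe_smul]
  rw [e]
  exact t.add_mem (t.smul_mem _ hP) (t.smul_mem _ hwP)

/-- The free complex multiple of `P` is chosen so that the trace becomes `i`. -/
theorem smul_mem_of_trace_ne_zero (hlie : ∀ X ∈ t, ∀ Y ∈ t, X * Y - Y * X ∈ t)
    {P Q : Matrix (Fin 2) (Fin 2) ℂ} (hP : ∀ z : ℂ, z • P ∈ t) (hQ : Q ∈ t) (hQQ : Q * Q = 0)
    (h : (Q * P).trace ≠ 0) (z : ℂ) : z • Q ∈ t := by
  refine smul_mem_of_im_ne_zero hQ (w := Complex.I) (by simp) ?_ z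
  have := trace_smul_mem hlie hQ hQQ (hP (Complex.I / (Q * P).trace))
  rwa [Matrix.mul_smul, Matrix.trace_smul, smul_eq_mul, div_mul_cancel₀ _ h] at this

/-- A real Lie algebra of `2 × 2` matrices with nilpotents whose kernels are `∞`, `0`, `1` and a
point `q` with `q ^ 2` not real contains all strictly triangular matrices. -/
theorem triangular_mem_of_nilpotentKernels (hlie : ∀ X ∈ t, ∀ Y ∈ t, X * Y - Y * X ∈ t)
    (h0 : ((0 : ℂ) : OnePoint ℂ) ∈ nilpotentKernels t)
    (h1 : ((1 : ℂ) : OnePoint ℂ) ∈ nilpotentKernels t) (hi : ∞ ∈ nilpotentKernels t) {q : ℂ}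
    (hq : (q : OnePoint ℂ) ∈ nilpotentKernels t) (hq2 : (q ^ 2).im ≠ 0) :
    (∀ z : ℂ, !![0, z; 0, 0] ∈ t) ∧ ∀ z : ℂ, !![0, 0; z, 0] ∈ t := by
  obtain ⟨α, hα, hα'⟩ := exists_of_infty_mem_nilpotentKernels hi
  obtain ⟨β, hβ, hβ'⟩ := exists_of_coe_mem_nilpotentKernels h0
  obtain ⟨γ, hγ, hγ'⟩ := exists_of_coe_mem_nilpotentKernels h1
  obtain ⟨δ, hδ, hδ'⟩ := exists_of_coe_mem_nilpotentKernels hq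
  have hq0 : q ≠ 0 := by
    rintro rfl
    simp at hq2
  set U : Matrix (Fin 2) (Fin 2) ℂ := !![0, 1; 0, 0] with hU
  set N : ℂ → Matrix (Fin 2) (Fin 2) ℂ := fun z => !![z, -z ^ 2; 1, -z] with hN
  have hUU : U * U = 0 := by
    ext i j
    fin_cases i <;> fin_cases j <;> simp [hU]
  have hNN : ∀ z, N z * N z = 0 := by
    intro z
    ext i j
    fin_cases i <;> fin_cases j <;> simp [hN] <;> ring
  have sq : ∀ (c : ℂ) (P : Matrix (Fin 2) (Fin 2) ℂ), P * P = 0 → (c • P) * (c • P) = 0 := by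
    intro c P h
    rw [Matrix.smul_mul, Matrix.mul_smul, h, smul_zero, smul_zero]
  have tr : ∀ (a b : ℂ) (P Q : Matrix (Fin 2) (Fin 2) ℂ),
      ((a • P) * (b • Q)).trace = a * b * (P * Q).trace := by
    intro a b P Q
    rw [Matrix.smul_mul, Matrix.mul_smul, Matrix.trace_smul, Matrix.trace_smul, smul_eq_mul,
      smul_eq_mul, mul_assoc]
  have hUN : ∀ z, (U * N z).trace = 1 := by
    intro z
    simp [hU, hN, Matrix.trace_fin_two]
  have hNU : ∀ z, (N z * U).trace = 1 := by
    intro z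
    simp [hU, hN, Matrix.trace_fin_two]
  have hN0 : ∀ z, (N z * N 0).trace = -z ^ 2 := by
    intro z
    simp [hN, Matrix.trace_fin_two]
  have finish : (∀ z : ℂ, z • U ∈ t) → (∀ z : ℂ, z • N 0 ∈ t) →
      (∀ z : ℂ, !![0, z; 0, 0] ∈ t) ∧ ∀ z : ℂ, !![0, 0; z, 0] ∈ t := by
    intro hu hn
    refine ⟨fun z => ?_, fun z => ?_⟩
    · convert hu z using 1
      ext i j
      fin_cases i <;> fin_cases j <;> simp [hU]
    · convert hn z using 1
      ext i j
      fin_cases i <;> fin_cases j <;> simp [hN]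
  have scale : ∀ (c : ℂ) (P : Matrix (Fin 2) (Fin 2) ℂ), c ≠ 0 → (∀ z : ℂ, z • (c • P) ∈ t) →
      ∀ z : ℂ, z • P ∈ t := by
    intro c P hc h z
    have := h (z * c⁻¹)
    rwa [smul_smul, inv_mul_cancel_right₀ hc] at this
  -- One complex line of nilpotents suffices: any two of the nilpotents used have a product of
  -- nonzero trace, so the property passes from one to the next.
  have fromU : (∀ z : ℂ, z • U ∈ t) → (∀ z : ℂ, !![0, z; 0, 0] ∈ t) ∧
      ∀ z : ℂ, !![0, 0; z, 0] ∈ t := fun hu => finish hu <| scale β _ hβ <|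
    smul_mem_of_trace_ne_zero hlie hu hβ' (sq _ _ (hNN 0)) (by
      rw [Matrix.smul_mul, Matrix.trace_smul, hNU, smul_eq_mul, mul_one]
      exact hβ)
  have fromN : ∀ z : ℂ, (∀ w : ℂ, w • N z ∈ t) → (∀ z : ℂ, !![0, z; 0, 0] ∈ t) ∧
      ∀ z : ℂ, !![0, 0; z, 0] ∈ t := fun z hn => fromU <| scale α _ hα <|
    smul_mem_of_trace_ne_zero hlie hn hα' (sq _ _ hUU) (by
      rw [Matrix.smul_mul, Matrix.trace_smul, hUN, smul_eq_mul, mul_one]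
      exact hα)
  have caseU : ∀ (c z : ℂ), c • N z ∈ t → (α * c).im ≠ 0 → (∀ z : ℂ, !![0, z; 0, 0] ∈ t) ∧
      ∀ z : ℂ, !![0, 0; z, 0] ∈ t := by
    intro c z hc him
    refine fromU (scale α _ hα (smul_mem_of_im_ne_zero hα' him ?_))
    have := trace_smul_mem hlie hα' (sq _ _ hUU) hc
    rwa [tr, hUN, mul_one] at this
  have caseN : ∀ (c z : ℂ), c ≠ 0 → c • N z ∈ t → (c * β * z ^ 2).im ≠ 0 →
      (∀ z : ℂ, !![0, z; 0, 0] ∈ t) ∧ ∀ z : ℂ, !![0, 0; z, 0] ∈ t := by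
    intro c z hc0 hc him
    refine fromN z (scale c _ hc0 (smul_mem_of_im_ne_zero hc (w := -(c * β * z ^ 2))
      (by rwa [Complex.neg_im, neg_ne_zero]) ?_))
    have := trace_smul_mem hlie hc (sq _ _ (hNN z)) hβ'
    rwa [tr, hN0, mul_neg] at this
  by_cases e1 : (α * γ).im = 0
  swap
  · exact caseU γ 1 hγ' e1
  by_cases e2 : (α * δ).im = 0
  swap
  · exact caseU δ q hδ' e2
  by_cases e3 : (γ * β * 1 ^ 2).im = 0
  swap
  · exact caseN γ 1 hγ hγ' e3
  by_cases e4 : (δ * β * q ^ 2).im = 0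
  swap
  · exact caseN δ q hδ hδ' e4
  -- If the four traces are all real, then `q ^ 2` is the real number `(δ β q ^ 2) (α γ) / ((α δ) (γ
  -- β))`.
  exfalso
  have real : ∀ z : ℂ, z.im = 0 → ∃ x : ℝ, z = x := fun z hz => ⟨z.re, Complex.ext rfl (by simpa)⟩
  obtain ⟨x1, e1⟩ := real _ e1
  obtain ⟨x2, e2⟩ := real _ e2
  obtain ⟨x3, e3⟩ := real _ e3
  obtain ⟨x4, e4⟩ := real _ e4
  have : q ^ 2 = ((x4 * x1 / (x2 * x3) : ℝ) : ℂ) := by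
    push_cast
    rw [← e1, ← e2, ← e3, ← e4]
    field_simp
  rw [this, Complex.ofReal_im] at hq2
  exact hq2 rfl

end Lie

attribute [local instance] Matrix.normedAddCommGroup Matrix.normedSpace

theorem isClosed_nilpotentKernels (t : Submodule ℝ (Matrix (Fin 2) (Fin 2) ℂ)) :
    IsClosed (nilpotentKernels t) := by
  -- Both the vector and the nilpotent can be normalized to norm one, so the set is a continuous
  -- image of a compact set of pairs.
  let C : Set ((Fin 2 → ℂ) × Matrix (Fin 2) (Fin 2) ℂ) :=
    (Metric.sphere 0 1 ×ˢ Metric.sphere 0 1) ∩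
      {x | x.2 ∈ t ∧ x.2 * x.2 = 0 ∧ x.2 *ᵥ x.1 = 0}
  have hP : ProperSpace (Matrix (Fin 2) (Fin 2) ℂ) := FiniteDimensional.proper ℝ _
  have hC : IsCompact C := by
    refine ((isCompact_sphere _ _).prod (isCompact_sphere _ _)).inter_right ?_
    refine ((Submodule.closed_of_finiteDimensional t).preimage continuous_snd).inter
      (IsClosed.inter ?_ ?_)
    · exact isClosed_eq (by fun_prop) continuous_const
    · exact isClosed_eq (continuous_snd.matrix_mulVec continuous_fst) continuous_const
  have hne : ∀ v ∈ Prod.fst '' C, v ≠ 0 := by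
    rintro _ ⟨⟨v, N⟩, ⟨⟨hv, -⟩, -⟩, rfl⟩ h0
    simp only [mem_sphere_iff_norm, sub_zero] at hv
    simp [show v = 0 from h0] at hv
  have : nilpotentKernels t = proj '' (Prod.fst '' C) := by
    ext p
    constructor
    · rintro ⟨N, hN, h0, h2, hk⟩
      have hl : ‖lift p‖ ≠ 0 := norm_ne_zero_iff.2 (lift_ne_zero p)
      have hN0 : ‖N‖ ≠ 0 := norm_ne_zero_iff.2 h0
      refine ⟨(‖lift p‖⁻¹ : ℂ) • lift p, ⟨⟨(‖lift p‖⁻¹ : ℂ) • lift p, ‖N‖⁻¹ • N⟩,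
        ⟨⟨?_, ?_⟩, t.smul_mem _ hN, ?_, ?_⟩, rfl⟩, ?_⟩
      · simp [norm_smul, hl]
      · simp [norm_smul, hN0]
      · simp [h2]
      · simp [Matrix.mulVec_smul, Matrix.smul_mulVec, hk]
      · rw [proj_smul (by simpa using lift_ne_zero p), proj_lift]
    · rintro ⟨v, hv, rfl⟩
      have hv0 := hne v hv
      obtain ⟨⟨v, N⟩, ⟨⟨-, hN⟩, ht, h2, hk⟩, rfl⟩ := hv
      obtain ⟨c, hc, e⟩ := exists_smul_lift_proj hv0
      refine ⟨N, ht, ?_, h2, ?_⟩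
      · rintro h0
        simp only [mem_sphere_iff_norm, sub_zero] at hN
        simp [show N = 0 from h0] at hN
      · simp only at e hk
        rw [e, Matrix.mulVec_smul] at hk
        exact (smul_eq_zero.1 hk).resolve_left hc
  rw [this]
  exact ((hC.image continuous_fst).image_of_continuousOn fun v hv =>
    (continuousAt_proj (hne v hv)).continuousWithinAt).isClosed

end

section

attribute [local instance] Matrix.normedAddCommGroup Matrix.normedSpace

/-! ### Limits of the projective classes of the elements of a discrete group -/

theorem mul_eq_mul_of_mulVec_eq_zero {M : Matrix (Fin 2) (Fin 2) ℂ} (hM : M ≠ 0) {v w : Fin 2 → ℂ}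
    (hv : M *ᵥ v = 0) (hw : M *ᵥ w = 0) : v 0 * w 1 = v 1 * w 0 := by
  by_contra h
  have h' : v 0 * w 1 - v 1 * w 0 ≠ 0 := sub_ne_zero.2 h
  refine hM ?_
  have e : ∀ i, M i 0 * v 0 + M i 1 * v 1 = 0 ∧ M i 0 * w 0 + M i 1 * w 1 = 0 := fun i => by
    have h1 := congrFun hv i
    have h2 := congrFun hw i
    simp only [Matrix.mulVec, dotProduct, Fin.sum_univ_two, Pi.zero_apply] at h1 h2
    exact ⟨h1, h2⟩
  ext i j
  refine (mul_eq_zero.1 ?_).resolve_right h'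
  fin_cases j
  · show M i 0 * _ = 0
    linear_combination w 1 * (e i).1 - v 1 * (e i).2
  · show M i 1 * _ = 0
    linear_combination -(w 0) * (e i).1 + v 0 * (e i).2

theorem exists_eq_smul {v w : Fin 2 → ℂ} (hv : v ≠ 0) (h : v 0 * w 1 = v 1 * w 0) :
    ∃ c : ℂ, w = c • v := by
  by_cases h0 : v 0 = 0
  · have h1 : v 1 ≠ 0 := fun h1 => hv (by ext i; fin_cases i <;> simp [h0, h1])
    have hw : w 0 = 0 := by simpa [h0, h1] using h
    refine ⟨w 1 / v 1, ?_⟩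
    ext i
    fin_cases i <;> simp [h0, h1, hw]
  · refine ⟨w 0 / v 0, ?_⟩
    ext i
    fin_cases i
    · simp [h0]
    · simp
      field_simp
      linear_combination h

/-- The nonzero limits of positive multiples of elements of `Γ`, with the multiples tending to
zero. -/
def limitMatrices (Γ : Subgroup SL(2, ℂ)) : Set (Matrix (Fin 2) (Fin 2) ℂ) :=
  {M | M ≠ 0 ∧ ((0 : ℝ), M) ∈ closure {x : ℝ × Matrix (Fin 2) (Fin 2) ℂ |
    0 < x.1 ∧ ∃ γ ∈ Γ, x.2 = x.1 • (γ : Matrix (Fin 2) (Fin 2) ℂ)}}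

section

variable {Γ : Subgroup SL(2, ℂ)} {M : Matrix (Fin 2) (Fin 2) ℂ}

/-- A closed relation between the scale `r` and the matrix `r • γ` persists at scale `0`. Keeping
the scale as a coordinate avoids choosing sequences. -/
theorem mem_of_isClosed_of_mem_limitMatrices (hM : M ∈ limitMatrices Γ)
    {F : Set (ℝ × Matrix (Fin 2) (Fin 2) ℂ)} (hF : IsClosed F)
    (h : ∀ r : ℝ, 0 < r → ∀ γ ∈ Γ, (r, r • (γ : Matrix (Fin 2) (Fin 2) ℂ)) ∈ F) :
    ((0 : ℝ), M) ∈ F := by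
  refine closure_minimal ?_ hF hM.2
  rintro ⟨r, N⟩ ⟨hr, γ, hγ, h'⟩
  simp only at hr h'
  rw [h']
  exact h r hr γ hγ

theorem adjugate_smul_real (r : ℝ) (N : Matrix (Fin 2) (Fin 2) ℂ) :
    (r • N).adjugate = r • N.adjugate := by
  ext i j
  fin_cases i <;> fin_cases j <;> simp [Matrix.adjugate_fin_two]

/-- On `2 × 2` matrices the adjugate is linear and is the inverse on `SL(2, ℂ)`, so these are the
limits of the inverses at the same scale. -/
theorem adjugate_mem_limitMatrices (hM : M ∈ limitMatrices Γ) : M.adjugate ∈ limitMatrices Γ := by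
  refine ⟨fun h => hM.1 ?_, ?_⟩
  · have : M.adjugate.adjugate = M := by
      ext i j
      fin_cases i <;> fin_cases j <;> simp [Matrix.adjugate_fin_two]
    rw [← this, h]
    ext i j
    fin_cases i <;> fin_cases j <;> simp
  · refine map_mem_closure (f := fun x : ℝ × Matrix (Fin 2) (Fin 2) ℂ => (x.1, x.2.adjugate))
      (continuous_fst.prodMk continuous_snd.matrix_adjugate) hM.2 ?_
    rintro ⟨r, N⟩ ⟨hr, γ, hγ, h⟩
    refine ⟨hr, γ⁻¹, Γ.inv_mem hγ, ?_⟩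
    simp only at h ⊢
    rw [h, adjugate_smul_real, Matrix.SpecialLinearGroup.coe_inv]

theorem mul_mem_limitMatrices (hM : M ∈ limitMatrices Γ) {γ : SL(2, ℂ)} (hγ : γ ∈ Γ) :
    M * (γ : Matrix (Fin 2) (Fin 2) ℂ) ∈ limitMatrices Γ := by
  refine ⟨fun h => hM.1 ?_, ?_⟩
  · have := congrArg (· * ((γ⁻¹ : SL(2, ℂ)) : Matrix (Fin 2) (Fin 2) ℂ)) h
    simpa only [Matrix.mul_assoc, coe_mul_coe_inv, Matrix.mul_one, Matrix.zero_mul] using this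
  · refine map_mem_closure (f := fun x : ℝ × Matrix (Fin 2) (Fin 2) ℂ =>
      (x.1, x.2 * (γ : Matrix (Fin 2) (Fin 2) ℂ)))
      (continuous_fst.prodMk (continuous_snd.matrix_mul continuous_const)) hM.2 ?_
    rintro ⟨r, N⟩ ⟨hr, δ, hδ, h⟩
    refine ⟨hr, δ * γ, Γ.mul_mem hδ hγ, ?_⟩
    simp only at h ⊢
    rw [h, Matrix.SpecialLinearGroup.coe_mul, Matrix.smul_mul]

/-- `det (r • γ) = r ^ 2`, which tends to zero. -/
theorem det_eq_zero_of_mem_limitMatrices (hM : M ∈ limitMatrices Γ) : M.det = 0 := by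
  have := mem_of_isClosed_of_mem_limitMatrices hM (F := {x | x.2.det = (x.1 : ℂ) ^ 2})
    (isClosed_eq continuous_snd.matrix_det (by fun_prop)) fun r hr γ hγ => by
      have h : r • (γ : Matrix (Fin 2) (Fin 2) ℂ) = (r : ℂ) • (γ : Matrix (Fin 2) (Fin 2) ℂ) := by
        ext i j
        simp
      show (r • (γ : Matrix (Fin 2) (Fin 2) ℂ)).det = (r : ℂ) ^ 2
      rw [h, Matrix.det_smul, γ.det_coe]
      simp
  simpa using this

theorem mul_adjugate_of_mem_limitMatrices (hM : M ∈ limitMatrices Γ) : M * M.adjugate = 0 := by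
  rw [Matrix.mul_adjugate, det_eq_zero_of_mem_limitMatrices hM, zero_smul]

theorem adjugate_mul_of_mem_limitMatrices (hM : M ∈ limitMatrices Γ) : M.adjugate * M = 0 := by
  rw [Matrix.adjugate_mul, det_eq_zero_of_mem_limitMatrices hM, zero_smul]

theorem trace_eq_zero_of_mem_limitMatrices
    (h : ∀ γ ∈ Γ, ‖(γ : Matrix (Fin 2) (Fin 2) ℂ).trace‖ ≤ 2) (hM : M ∈ limitMatrices Γ) :
    M.trace = 0 := by
  have := mem_of_isClosed_of_mem_limitMatrices hM (F := {x | ‖x.2.trace‖ ≤ x.1 * 2})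
    (isClosed_le continuous_snd.matrix_trace.norm (by fun_prop)) fun r hr γ hγ => by
      show ‖(r • (γ : Matrix (Fin 2) (Fin 2) ℂ)).trace‖ ≤ r * 2
      rw [Matrix.trace_smul, norm_smul, Real.norm_of_nonneg hr.le]
      exact mul_le_mul_of_nonneg_left (h γ hγ) hr.le
  simpa using this

/-- `M X adj M` is the limit of `r ^ 2 • γ X γ⁻¹`, and a finite-dimensional subspace is closed. -/
theorem mul_mul_adjugate_mem {t : Submodule ℝ (Matrix (Fin 2) (Fin 2) ℂ)}
    (ht : ∀ γ ∈ Γ, ∀ X ∈ t, (γ : Matrix (Fin 2) (Fin 2) ℂ) * X *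
      ((γ⁻¹ : SL(2, ℂ)) : Matrix (Fin 2) (Fin 2) ℂ) ∈ t) (hM : M ∈ limitMatrices Γ)
    {X : Matrix (Fin 2) (Fin 2) ℂ} (hX : X ∈ t) : M * X * M.adjugate ∈ t := by
  refine mem_of_isClosed_of_mem_limitMatrices hM (F := {x | x.2 * X * x.2.adjugate ∈ t})
    ((Submodule.closed_of_finiteDimensional t).preimage
      ((continuous_snd.matrix_mul continuous_const).matrix_mul
        continuous_snd.matrix_adjugate)) fun r hr γ hγ => ?_
  show (r • (γ : Matrix (Fin 2) (Fin 2) ℂ)) * X * (r • (γ : Matrix (Fin 2) (Fin 2) ℂ)).adjugate ∈ t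
  rw [adjugate_smul_real, ← Matrix.SpecialLinearGroup.coe_inv, Matrix.smul_mul, Matrix.smul_mul,
    Matrix.mul_smul]
  exact t.smul_mem _ (t.smul_mem _ (ht γ hγ X hX))

/-- The accumulation points of the orbits of `Γ` on the Riemann sphere. -/
def accumulationSet (Γ : Subgroup SL(2, ℂ)) : Set (OnePoint ℂ) :=
  ⋃ x, derivedSet {z | ∃ γ ∈ Γ, mobPerm γ x = z}

theorem exists_mem_limitMatrices
    (hfin : ∀ B : ℝ, {γ | γ ∈ Γ ∧ ‖(γ : Matrix (Fin 2) (Fin 2) ℂ)‖ ≤ B}.Finite)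
    {x p : OnePoint ℂ} (hp : p ∈ derivedSet {z | ∃ γ ∈ Γ, mobPerm γ x = z}) :
    ∃ M ∈ limitMatrices Γ, M *ᵥ lift x ≠ 0 → proj (M *ᵥ lift x) = p := by
  let f : Γ → OnePoint ℂ := fun γ => mobPerm γ x
  have hne : (comap f (𝓝[≠] p)).NeBot := by
    refine comap_neBot_iff.2 fun s hs => ?_
    obtain ⟨U, hU, hUs⟩ := mem_nhdsWithin_iff_exists_mem_nhds_inter.1 hs
    obtain ⟨_, ⟨hyU, γ, hγ, rfl⟩, hy⟩ := accPt_iff_nhds.1 hp U hU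
    exact ⟨⟨γ, hγ⟩, hUs ⟨hyU, hy⟩⟩
  -- Along `u` the points `γ x` tend to `p` without being equal to `p`. Bounded norms would leave
  -- finitely many `γ` and make `u` principal, so the norms tend to infinity; compactness of the
  -- unit sphere then gives the limit matrix.
  let u := Ultrafilter.of (comap f (𝓝[≠] p))
  have hu : Tendsto f u (𝓝[≠] p) := tendsto_iff_comap.2 (Ultrafilter.of_le _)
  have hpos : ∀ γ : Γ, 0 < ‖((γ : SL(2, ℂ)) : Matrix (Fin 2) (Fin 2) ℂ)‖ := fun γ => by
    refine norm_pos_iff.2 fun h => ?_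
    have := (γ : SL(2, ℂ)).det_coe
    rw [h] at this
    simp at this
  have htop : Tendsto (fun γ : Γ => ‖((γ : SL(2, ℂ)) : Matrix (Fin 2) (Fin 2) ℂ)‖) u atTop := by
    refine tendsto_atTop.2 fun B => ?_
    by_contra h
    rw [← Ultrafilter.eventually_not] at h
    have hS : {γ : Γ | ‖((γ : SL(2, ℂ)) : Matrix (Fin 2) (Fin 2) ℂ)‖ ≤ B}.Finite :=
      Set.Finite.of_finite_image ((hfin B).subset (by
        rintro _ ⟨γ, hγ, rfl⟩
        exact ⟨γ.2, hγ⟩)) Subtype.coe_injective.injOn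
    obtain ⟨γ, -, hγ⟩ := Ultrafilter.eq_pure_of_finite_mem hS
      (h.mono fun γ hγ => (not_le.1 hγ).le)
    rw [hγ] at hu
    have h1 : f γ ≠ p := by
      have := hu (self_mem_nhdsWithin)
      simpa using this
    have h2 := hu (mem_nhdsWithin_of_mem_nhds (isOpen_compl_singleton.mem_nhds
      (show p ∈ ({f γ}ᶜ : Set (OnePoint ℂ)) from fun h => h1 h.symm)))
    simp at h2
  let r : Γ → ℝ := fun γ => ‖((γ : SL(2, ℂ)) : Matrix (Fin 2) (Fin 2) ℂ)‖⁻¹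
  have hr : Tendsto r u (𝓝 0) := tendsto_inv_atTop_zero.comp htop
  have hP : ProperSpace (Matrix (Fin 2) (Fin 2) ℂ) := FiniteDimensional.proper ℝ _
  obtain ⟨M, hM1, hM⟩ := (isCompact_sphere (0 : Matrix (Fin 2) (Fin 2) ℂ) 1).ultrafilter_le_nhds
    (u.map fun γ : Γ => r γ • ((γ : SL(2, ℂ)) : Matrix (Fin 2) (Fin 2) ℂ)) (by
      refine le_principal_iff.2 (Filter.mem_map.2 (Filter.univ_mem' fun γ => ?_))
      simp only [Set.mem_preimage, mem_sphere_iff_norm, sub_zero]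
      rw [norm_smul, norm_inv, norm_norm, inv_mul_cancel₀ (hpos γ).ne'])
  have hM : Tendsto (fun γ : Γ => r γ • ((γ : SL(2, ℂ)) : Matrix (Fin 2) (Fin 2) ℂ)) u (𝓝 M) := hM
  refine ⟨M, ⟨?_, ?_⟩, fun hx => ?_⟩
  · rintro rfl
    simp at hM1
  · refine mem_closure_of_tendsto (hr.prodMk_nhds hM) (Eventually.of_forall fun γ => ?_)
    exact ⟨inv_pos.2 (hpos γ), γ, γ.2, rfl⟩
  · have h1 : Tendsto (fun γ : Γ => (r γ • ((γ : SL(2, ℂ)) : Matrix (Fin 2) (Fin 2) ℂ)) *ᵥ lift x)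
        u (𝓝 (M *ᵥ lift x)) :=
      ((continuous_id.matrix_mulVec continuous_const).tendsto M).comp hM
    have h2 := (continuousAt_proj hx).tendsto.comp h1
    refine tendsto_nhds_unique h2 ?_
    have h3 : Tendsto f u (𝓝 p) := hu.mono_right nhdsWithin_le_nhds
    refine h3.congr fun γ => ?_
    simp only [f, Function.comp_apply]
    rw [mobPerm_eq_proj, Matrix.smul_mulVec, ← Complex.coe_smul, proj_smul]
    exact_mod_cast (inv_pos.2 (hpos γ)).ne'

/-- A closed invariant set that contains the images of all limit matrices contains all accumulation
points. -/
theorem accumulationSet_subset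
    (hfin : ∀ B : ℝ, {γ | γ ∈ Γ ∧ ‖(γ : Matrix (Fin 2) (Fin 2) ℂ)‖ ≤ B}.Finite)
    {P : Set (OnePoint ℂ)} (hP : IsClosed P) (hΓ : ∀ γ ∈ Γ, ∀ p ∈ P, mobPerm γ p ∈ P)
    (h : ∀ M ∈ limitMatrices Γ, ∀ v, M *ᵥ v ≠ 0 → proj (M *ᵥ v) ∈ P) :
    accumulationSet Γ ⊆ P := by
  refine Set.iUnion_subset fun x p hp => ?_
  obtain ⟨M, hM, hMp⟩ := exists_mem_limitMatrices hfin hp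
  by_cases hx : M *ᵥ lift x = 0
  -- In the exceptional case `x` is the kernel of `M`, which is the image of its adjugate. So `x`
  -- itself is in `P`, and with it its orbit and the closure of the orbit.
  · have hA := adjugate_mem_limitMatrices hM
    obtain ⟨v, hv⟩ : ∃ v, M.adjugate *ᵥ v ≠ 0 := by
      by_contra! hv
      exact hA.1 (Matrix.ext_of_mulVec_single fun i => by rw [hv, Matrix.zero_mulVec])
    have hxP : x ∈ P := by
      have := h _ hA v hv
      rwa [(proj_eq_iff hv (lift_ne_zero x)).2, proj_lift] at this
      refine mul_eq_mul_of_mulVec_eq_zero hM.1 ?_ hx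
      rw [Matrix.mulVec_mulVec, mul_adjugate_of_mem_limitMatrices hM, Matrix.zero_mulVec]
    refine closure_minimal ?_ hP (derivedSet_subset_closure _ hp)
    rintro _ ⟨γ, hγ, rfl⟩
    exact hΓ γ hγ x hxP
  · rw [← hMp hx]
    exact h M hM _ hx

end

end

section

attribute [local instance] Matrix.normedAddCommGroup Matrix.normedSpace

/-! ### Eigenvectors of elements of `SL(2, ℂ)` -/

theorem sq_sub_trace_mul_add_one_eq_zero {g : Matrix (Fin 2) (Fin 2) ℂ} (hg : g.det = 1)
    {v : Fin 2 → ℂ} (hv : v ≠ 0) {c : ℂ} (h : g *ᵥ v = c • v) : c ^ 2 - g.trace * c + 1 = 0 := by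
  have h0 : (g - c • 1).det = 0 := by
    refine Matrix.exists_mulVec_eq_zero_iff.1 ⟨v, hv, ?_⟩
    rw [Matrix.sub_mulVec, Matrix.smul_mulVec, Matrix.one_mulVec, h, sub_self]
  rw [Matrix.det_fin_two] at h0 hg
  simp at h0
  rw [Matrix.trace_fin_two]
  linear_combination h0 - hg

/-- The trace is `c + c⁻¹`, of absolute value at most `2` if `‖c‖ = 1`. -/
theorem norm_ne_one_of_eigenvalue {g : Matrix (Fin 2) (Fin 2) ℂ} (hg : g.det = 1)
    (htr : 2 < ‖g.trace‖) {v : Fin 2 → ℂ} (hv : v ≠ 0) {c : ℂ} (h : g *ᵥ v = c • v) :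
    ‖c‖ ≠ 1 := by
  intro hc
  have h1 := sq_sub_trace_mul_add_one_eq_zero hg hv h
  have h2 : g.trace * c = c ^ 2 + 1 := by linear_combination -h1
  have h3 : ‖g.trace‖ ≤ 2 := by
    calc ‖g.trace‖ = ‖g.trace * c‖ := by rw [norm_mul, hc, mul_one]
      _ = ‖c ^ 2 + 1‖ := by rw [h2]
      _ ≤ ‖c ^ 2‖ + ‖(1 : ℂ)‖ := norm_add_le _ _
      _ = 2 := by rw [norm_pow, hc, norm_one]; norm_num
  linarith

theorem exists_eigenvalues {g : Matrix (Fin 2) (Fin 2) ℂ} (htr : 2 < ‖g.trace‖) :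
    ∃ μ : ℂ, 1 < ‖μ‖ ∧ μ + μ⁻¹ = g.trace := by
  obtain ⟨s, hs⟩ := Complex.isSquare (g.trace ^ 2 - 4)
  have h1 : (g.trace + s) / 2 * ((g.trace - s) / 2) = 1 := by linear_combination hs / 4
  have h2 : (g.trace + s) / 2 + (g.trace - s) / 2 = g.trace := by ring
  generalize (g.trace + s) / 2 = a at *
  generalize (g.trace - s) / 2 = b at *
  by_cases ha : 1 < ‖a‖
  · exact ⟨a, ha, by rw [← h2, eq_inv_of_mul_eq_one_right h1]⟩
  · refine ⟨b, ?_, by rw [← h2, eq_inv_of_mul_eq_one_left h1, add_comm]⟩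
    by_contra hb
    have := norm_add_le a b
    rw [h2] at this
    linarith

/-- An element of `SL(2, ℂ)` whose trace has absolute value above `2` is loxodromic. -/
theorem exists_eq_conj_diagSL {g : SL(2, ℂ)}
    (htr : 2 < ‖(g : Matrix (Fin 2) (Fin 2) ℂ).trace‖) :
    ∃ (S : SL(2, ℂ)) (μ : ℂ) (hμ : μ ≠ 0), 1 < ‖μ‖ ∧ g = S * diagSL μ hμ * S⁻¹ := by
  obtain ⟨μ, hμ1, hμ⟩ := exists_eigenvalues htr
  have hμ0 : μ ≠ 0 := by
    rintro rfl
    simp at hμ1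
    linarith
  have hdet : g 0 0 * g 1 1 - g 0 1 * g 1 0 = 1 := by rw [← Matrix.det_fin_two, g.det_coe]
  rw [Matrix.trace_fin_two] at hμ
  have hex : ∀ c : ℂ, c ^ 2 - (μ + μ⁻¹) * c + 1 = 0 → ∃ v : Fin 2 → ℂ, v ≠ 0 ∧
      g 0 0 * v 0 + g 0 1 * v 1 = c * v 0 ∧ g 1 0 * v 0 + g 1 1 * v 1 = c * v 1 := by
    intro c hc
    have h0 : ((g : Matrix (Fin 2) (Fin 2) ℂ) - c • 1).det = 0 := by
      rw [Matrix.det_fin_two]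
      simp
      rw [hμ] at hc
      linear_combination hc + hdet
    obtain ⟨v, hv, hv'⟩ := Matrix.exists_mulVec_eq_zero_iff.2 h0
    rw [Matrix.sub_mulVec, Matrix.smul_mulVec, Matrix.one_mulVec, sub_eq_zero] at hv'
    have e0 := congrFun hv' 0
    have e1 := congrFun hv' 1
    simp only [Matrix.mulVec, dotProduct, Fin.sum_univ_two, Pi.smul_apply, smul_eq_mul] at e0 e1
    exact ⟨v, hv, e0, e1⟩
  obtain ⟨v, hv, v0, v1⟩ := hex μ (by field_simp; ring)
  obtain ⟨w, hw, w0, w1⟩ := hex μ⁻¹ (by field_simp; ring)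
  have hne : μ ≠ μ⁻¹ := by
    intro h
    have h' := congrArg norm h
    rw [norm_inv] at h'
    have := inv_lt_one_of_one_lt₀ hμ1
    linarith
  have hδ : v 0 * w 1 - v 1 * w 0 ≠ 0 := by
    intro h
    obtain ⟨c, rfl⟩ := exists_eq_smul hv (sub_eq_zero.1 h)
    simp only [Pi.smul_apply, smul_eq_mul] at w0 w1
    refine hw ?_
    have hz : ∀ i, (c • v) i * (μ - μ⁻¹) = 0 := by
      intro i
      fin_cases i
      · show c * v 0 * _ = 0
        linear_combination w0 - c * v0
      · show c * v 1 * _ = 0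
        linear_combination w1 - c * v1
    ext i
    exact (mul_eq_zero.1 (hz i)).resolve_right (sub_ne_zero.2 hne)
  obtain ⟨S, hS⟩ : ∃ S : SL(2, ℂ), (S : Matrix (Fin 2) (Fin 2) ℂ) =
      !![v 0, w 0 / (v 0 * w 1 - v 1 * w 0); v 1, w 1 / (v 0 * w 1 - v 1 * w 0)] := by
    refine ⟨⟨_, ?_⟩, rfl⟩
    rw [Matrix.det_fin_two]
    simp
    field_simp
  refine ⟨S, μ, hμ0, hμ1, ?_⟩
  rw [eq_mul_inv_iff_mul_eq]
  ext i j
  rw [Matrix.SpecialLinearGroup.coe_mul, Matrix.SpecialLinearGroup.coe_mul, hS, coe_diagSL]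
  fin_cases i <;> fin_cases j <;> simp [Matrix.mul_apply]
  · linear_combination v0
  · linear_combination (v 0 * w 1 - v 1 * w 0)⁻¹ * w0
  · linear_combination v1
  · linear_combination (v 0 * w 1 - v 1 * w 0)⁻¹ * w1

/-- A traceless `N` that kills `v` is a multiple of the column `v` times the row `(v 1, -v 0)`.
Since `g` preserves the symplectic form, conjugation by `g` replaces `v` by `c v` in both factors.
-/
theorem mul_eq_smul_of_mulVec {g N : Matrix (Fin 2) (Fin 2) ℂ} (hg : g.det = 1) {v : Fin 2 → ℂ}
    (hv : v ≠ 0) {c : ℂ} (h : g *ᵥ v = c • v) (hN : N *ᵥ v = 0) (htr : N.trace = 0) :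
    g * N = c ^ 2 • (N * g) := by
  rw [Matrix.det_fin_two] at hg
  have e0 := congrFun h 0
  have e1 := congrFun h 1
  have n0 := congrFun hN 0
  have n1 := congrFun hN 1
  rw [Matrix.trace_fin_two] at htr
  simp only [Matrix.mulVec, dotProduct, Fin.sum_univ_two, Pi.smul_apply, smul_eq_mul,
    Pi.zero_apply] at e0 e1 n0 n1
  obtain ⟨d, d00, d01, d10, d11⟩ : ∃ d : ℂ, N 0 0 = d * (v 0 * v 1) ∧ N 0 1 = -(d * v 0 ^ 2) ∧
      N 1 0 = d * v 1 ^ 2 ∧ N 1 1 = -(d * (v 0 * v 1)) := by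
    by_cases h0 : v 0 = 0
    · have h1 : v 1 ≠ 0 := fun h1 => hv (by ext i; fin_cases i <;> simp [h0, h1])
      rw [h0] at n0 n1
      have a01 : N 0 1 = 0 := by simpa [h1] using n0
      have a11 : N 1 1 = 0 := by simpa [h1] using n1
      refine ⟨N 1 0 / v 1 ^ 2, ?_, ?_, ?_, ?_⟩
      · rw [h0]
        linear_combination htr - a11
      · rw [h0, a01]
        ring
      · field_simp
      · rw [h0, a11]
        ring
    · have a00 : N 0 0 = -(N 0 1 * v 1) / v 0 := by
        field_simp
        linear_combination n0
      have a11 : N 1 1 = N 0 1 * v 1 / v 0 := by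
        rw [eq_neg_of_add_eq_zero_right htr, a00]
        ring
      have a10 : N 1 0 = -(N 0 1 * v 1 ^ 2) / v 0 ^ 2 := by
        rw [a11] at n1
        field_simp at n1 ⊢
        linear_combination n1
      refine ⟨-(N 0 1) / v 0 ^ 2, ?_, ?_, ?_, ?_⟩
      · rw [a00]
        field_simp
      · field_simp
      · rw [a10]
        ring
      · rw [a11]
        field_simp
  have f0 : c * (v 1 * g 0 0 - v 0 * g 1 0) = v 1 := by
    linear_combination v 1 * hg + g 1 0 * e0 - g 0 0 * e1
  have f1 : c * (v 1 * g 0 1 - v 0 * g 1 1) = -v 0 := by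
    linear_combination -(v 0) * hg + g 1 1 * e0 - g 0 1 * e1
  ext i j
  fin_cases i <;> fin_cases j <;>
    simp [Matrix.mul_apply, Fin.sum_univ_two, d00, d01, d10, d11]
  · linear_combination d * v 1 * e0 - c * d * v 0 * f0
  · linear_combination -(d * v 0) * e0 - c * d * v 0 * f1
  · linear_combination d * v 1 * e1 - c * d * v 1 * f0
  · linear_combination -(d * v 0) * e1 - c * d * v 1 * f1

/-- Elements of `SL(2, ℂ)` with the same trace and two common eigenvectors are equal or inverse. -/
theorem eq_or_eq_inv_of_eigenvectors {g Y : SL(2, ℂ)}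
    (htr : (Y : Matrix (Fin 2) (Fin 2) ℂ).trace = (g : Matrix (Fin 2) (Fin 2) ℂ).trace)
    {v w : Fin 2 → ℂ} (hvw : v 0 * w 1 ≠ v 1 * w 0) {a b c d : ℂ}
    (ha : (g : Matrix (Fin 2) (Fin 2) ℂ) *ᵥ v = a • v)
    (hb : (g : Matrix (Fin 2) (Fin 2) ℂ) *ᵥ w = b • w)
    (hc : (Y : Matrix (Fin 2) (Fin 2) ℂ) *ᵥ v = c • v)
    (hd : (Y : Matrix (Fin 2) (Fin 2) ℂ) *ᵥ w = d • w) : Y = g ∨ Y = g⁻¹ := by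
  have hv : v ≠ 0 := by
    rintro rfl
    simp at hvw
  have key : ∀ (g : SL(2, ℂ)) {a b : ℂ}, (g : Matrix (Fin 2) (Fin 2) ℂ) *ᵥ v = a • v →
      (g : Matrix (Fin 2) (Fin 2) ℂ) *ᵥ w = b • w → a * b = 1 := by
    intro g a b ha hb
    have hdet : g 0 0 * g 1 1 - g 0 1 * g 1 0 = 1 := by rw [← Matrix.det_fin_two, g.det_coe]
    have a0 := congrFun ha 0
    have a1 := congrFun ha 1
    have b0 := congrFun hb 0
    have b1 := congrFun hb 1
    simp only [Matrix.mulVec, dotProduct, Fin.sum_univ_two, Pi.smul_apply, smul_eq_mul]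
      at a0 a1 b0 b1
    have : (a * b - 1) * (v 0 * w 1 - v 1 * w 0) = 0 := by
      have : (a * v 0) * (b * w 1) - (a * v 1) * (b * w 0) = v 0 * w 1 - v 1 * w 0 := by
        rw [← a0, ← a1, ← b0, ← b1]
        linear_combination (v 0 * w 1 - v 1 * w 0) * hdet
      linear_combination this
    exact sub_eq_zero.1 ((mul_eq_zero.1 this).resolve_right (sub_ne_zero.2 hvw))
  have hab := key g ha hb
  have hcd := key Y hc hd
  have h1 := sq_sub_trace_mul_add_one_eq_zero g.det_coe hv ha
  have h2 := sq_sub_trace_mul_add_one_eq_zero Y.det_coe hv hc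
  rw [htr] at h2
  -- The eigenvalues `a` and `c` on `v` are roots of the same quadratic with product of roots `1`,
  -- so they are equal or inverse.
  have h3 : (c - a) * (a * c - 1) = 0 := by linear_combination a * h2 - c * h1
  have zero : ∀ A : Matrix (Fin 2) (Fin 2) ℂ, A *ᵥ v = 0 → A *ᵥ w = 0 → A = 0 := by
    intro A hv hw
    by_contra hA
    exact hvw (mul_eq_mul_of_mulVec_eq_zero hA hv hw)
  rcases mul_eq_zero.1 h3 with h | h
  · left
    have hca : c = a := sub_eq_zero.1 h
    have hdb : d = b := by
      have ha0 : a ≠ 0 := left_ne_zero_of_mul_eq_one hab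
      refine mul_left_cancel₀ ha0 ?_
      rw [hab, ← hca, hcd]
    refine Subtype.ext (sub_eq_zero.1 (zero _ ?_ ?_))
    · rw [Matrix.sub_mulVec, ha, hc, hca, sub_self]
    · rw [Matrix.sub_mulVec, hb, hd, hdb, sub_self]
  · right
    have hac : a * c = 1 := sub_eq_zero.1 h
    have hbd : b * d = 1 := by linear_combination hcd + c * d * hab - b * d * hac
    rw [eq_inv_iff_mul_eq_one]
    refine Subtype.ext (sub_eq_zero.1 (zero _ ?_ ?_))
    · rw [Matrix.sub_mulVec, Matrix.SpecialLinearGroup.coe_mul, ← Matrix.mulVec_mulVec, ha,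
        Matrix.mulVec_smul, hc, smul_smul, hac, one_smul, Matrix.SpecialLinearGroup.coe_one,
        Matrix.one_mulVec, sub_self]
    · rw [Matrix.sub_mulVec, Matrix.SpecialLinearGroup.coe_mul, ← Matrix.mulVec_mulVec, hb,
        Matrix.mulVec_smul, hd, smul_smul, hbd, one_smul, Matrix.SpecialLinearGroup.coe_one,
        Matrix.one_mulVec, sub_self]

theorem mobPerm_eq_self_iff {g : SL(2, ℂ)} {p : OnePoint ℂ} :
    mobPerm g p = p ↔ ∃ c : ℂ, (g : Matrix (Fin 2) (Fin 2) ℂ) *ᵥ lift p = c • lift p := by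
  have hp := lift_ne_zero p
  have hg := mulVec_ne_zero g hp
  rw [mobPerm_eq_proj]
  conv_lhs => rw [← proj_lift p]
  rw [proj_lift]
  constructor
  · intro h
    rw [← proj_lift p, proj_lift p] at h
    refine exists_eq_smul hp ?_
    have := (proj_eq_iff hg hp).1 (by rw [h, proj_lift])
    linear_combination -this
  · rintro ⟨c, hc⟩
    have hc0 : c ≠ 0 := by
      rintro rfl
      rw [zero_smul] at hc
      exact hg hc
    rw [hc, proj_smul hc0, proj_lift]

/-- A Möbius transformation that fixes `0`, `1` and `∞` is given by a scalar matrix. -/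
theorem eq_smul_one_of_fixes {g : SL(2, ℂ)} (h0 : mobPerm g ((0 : ℂ) : OnePoint ℂ) = (0 : ℂ))
    (h1 : mobPerm g ((1 : ℂ) : OnePoint ℂ) = (1 : ℂ)) (hi : mobPerm g ∞ = ∞) :
    ∃ c : ℂ, (g : Matrix (Fin 2) (Fin 2) ℂ) = c • 1 := by
  obtain ⟨a, ha⟩ := mobPerm_eq_self_iff.1 h0
  obtain ⟨b, hb⟩ := mobPerm_eq_self_iff.1 h1
  obtain ⟨c, hc⟩ := mobPerm_eq_self_iff.1 hi
  have a0 := congrFun ha 0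
  have b0 := congrFun hb 0
  have b1 := congrFun hb 1
  have c1 := congrFun hc 1
  simp [Matrix.mulVec, dotProduct, Fin.sum_univ_two] at a0 b0 b1 c1
  refine ⟨b, ?_⟩
  ext i j
  fin_cases i <;> fin_cases j <;> simp [a0, c1]
  · linear_combination b0 - a0
  · linear_combination b1 - c1

/-! ### Loxodromic elements of subgroups of Bianchi groups -/

section

variable {K : Type*} [Field K] [NumberField K] [Algebra.IsQuadraticExtension ℚ K]
  [NumberField.IsTotallyComplex K] {φ : K →+* ℂ} {Γ : Subgroup SL(2, ℂ)}

theorem finite_norm_le_of_le_range (hΓ : Γ ≤ (slEmb φ).range) (B : ℝ) :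
    {γ | γ ∈ Γ ∧ ‖(γ : Matrix (Fin 2) (Fin 2) ℂ)‖ ≤ B}.Finite := by
  have hT : (Set.pi Set.univ fun _ : Fin 2 => Set.pi Set.univ fun _ : Fin 2 =>
      {x : 𝓞 K | ‖φ x‖ ≤ B}).Finite :=
    Set.Finite.pi fun _ => Set.Finite.pi fun _ => finite_norm_le φ B
  refine Set.Finite.of_finite_image (f := fun γ : SL(2, ℂ) => (γ : Matrix (Fin 2) (Fin 2) ℂ))
    ((hT.image fun M => Matrix.of fun i j => φ (M i j)).subset ?_)
    Subtype.coe_injective.injOn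
  rintro _ ⟨γ, ⟨hγ, hB⟩, rfl⟩
  obtain ⟨M, rfl⟩ := hΓ hγ
  refine ⟨fun i j => M i j, fun i _ j _ => ?_, rfl⟩
  exact (Matrix.norm_entry_le_entrywise_sup_norm _ (i := i) (j := j)).trans hB

/-- Conjugation does not contract the differences of group elements from the identity. -/
theorem eq_one_of_contracted (hΓ : Γ ≤ (slEmb φ).range) {k u : SL(2, ℂ)} (hk : k ∈ Γ)
    (hu : u ∈ Γ) {ν : ℂ} (hν : ‖ν‖ < 1)
    (h : (k : Matrix (Fin 2) (Fin 2) ℂ) * ((u : Matrix (Fin 2) (Fin 2) ℂ) - 1) =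
      ν • (((u : Matrix (Fin 2) (Fin 2) ℂ) - 1) * (k : Matrix (Fin 2) (Fin 2) ℂ))) : u = 1 := by
  set N := (u : Matrix (Fin 2) (Fin 2) ℂ) - 1 with hN
  by_contra hu1
  have hN0 : N ≠ 0 := fun h0 => hu1 (Subtype.ext (sub_eq_zero.1 h0))
  have hν0 : ν ≠ 0 := by
    rintro rfl
    rw [zero_smul] at h
    refine hN0 ?_
    have := congrArg (((k⁻¹ : SL(2, ℂ)) : Matrix (Fin 2) (Fin 2) ℂ) * ·) h
    simpa only [← Matrix.mul_assoc, coe_inv_mul_coe, Matrix.one_mul, Matrix.mul_zero] using this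
  have hpow : ∀ n : ℕ, ((k ^ n : SL(2, ℂ)) : Matrix (Fin 2) (Fin 2) ℂ) * N =
      ν ^ n • (N * ((k ^ n : SL(2, ℂ)) : Matrix (Fin 2) (Fin 2) ℂ)) := by
    intro n
    induction n with
    | zero => simp
    | succ n ih =>
      rw [pow_succ, Matrix.SpecialLinearGroup.coe_mul, Matrix.mul_assoc, h, Matrix.mul_smul,
        ← Matrix.mul_assoc, ih, Matrix.smul_mul, smul_smul, Matrix.mul_assoc, pow_succ, mul_comm]
  -- Conjugating by powers of `k` shrinks `u - 1` geometrically, but its entries stay integers of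
  -- `K`, and the nonzero ones have absolute value at least one.
  have hconj : ∀ n : ℕ, ((k ^ n * u * (k ^ n)⁻¹ : SL(2, ℂ)) : Matrix (Fin 2) (Fin 2) ℂ) - 1 =
      ν ^ n • N := by
    intro n
    have e : (u : Matrix (Fin 2) (Fin 2) ℂ) = N + 1 := by rw [hN, sub_add_cancel]
    rw [Matrix.SpecialLinearGroup.coe_mul, Matrix.SpecialLinearGroup.coe_mul, e, Matrix.mul_add,
      hpow, Matrix.mul_one, Matrix.add_mul, coe_mul_coe_inv, add_sub_cancel_right,
      Matrix.smul_mul, Matrix.mul_assoc, coe_mul_coe_inv, Matrix.mul_one]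
  obtain ⟨i, j, hij⟩ : ∃ i j, N i j ≠ 0 := by
    by_contra! h0
    exact hN0 (Matrix.ext h0)
  obtain ⟨n, hn⟩ := exists_pow_lt_of_lt_one (inv_pos.2 (norm_pos_iff.2 hij)) hν
  obtain ⟨M, hM⟩ := hΓ (Γ.mul_mem (Γ.mul_mem (Γ.pow_mem hk n) hu) (Γ.inv_mem (Γ.pow_mem hk n)))
  have he : φ ((M i j - (1 : Matrix (Fin 2) (Fin 2) (𝓞 K)) i j : 𝓞 K) : K) = ν ^ n * N i j := by
    have := congrFun (congrFun (hconj n) i) j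
    rw [← hM, Matrix.sub_apply, slEmb_apply, Matrix.smul_apply, smul_eq_mul] at this
    rw [← this]
    by_cases e : i = j
    · subst e
      simp
    · simp [e]
  have hne : M i j - (1 : Matrix (Fin 2) (Fin 2) (𝓞 K)) i j ≠ 0 := by
    intro h0
    rw [h0] at he
    simp [hν0, hij] at he
  have h1 := one_le_norm φ hne
  rw [he, norm_mul, norm_pow] at h1
  have := mul_lt_mul_of_pos_right hn (norm_pos_iff.2 hij)
  rw [inv_mul_cancel₀ (norm_ne_zero_iff.2 hij)] at this
  linarith

/-- In a subgroup of a Bianchi group, an element that fixes a fixed point of a loxodromic element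
commutes with it. -/
theorem mul_comm_of_common_eigenvector (hΓ : Γ ≤ (slEmb φ).range) {g h : SL(2, ℂ)} (hg : g ∈ Γ)
    (hh : h ∈ Γ) (htr : 2 < ‖(g : Matrix (Fin 2) (Fin 2) ℂ).trace‖) {v : Fin 2 → ℂ} (hv : v ≠ 0)
    {a c : ℂ} (ha : (g : Matrix (Fin 2) (Fin 2) ℂ) *ᵥ v = a • v)
    (hc : (h : Matrix (Fin 2) (Fin 2) ℂ) *ᵥ v = c • v) : h * g * h⁻¹ = g := by
  have inv : ∀ (g : SL(2, ℂ)) {a : ℂ}, (g : Matrix (Fin 2) (Fin 2) ℂ) *ᵥ v = a • v → a ≠ 0 ∧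
      ((g⁻¹ : SL(2, ℂ)) : Matrix (Fin 2) (Fin 2) ℂ) *ᵥ v = a⁻¹ • v := by
    intro g a ha
    have ha0 : a ≠ 0 := by
      rintro rfl
      rw [zero_smul] at ha
      exact mulVec_ne_zero g hv ha
    refine ⟨ha0, ?_⟩
    have := congrArg (fun w => a⁻¹ • ((g⁻¹ : SL(2, ℂ)) : Matrix (Fin 2) (Fin 2) ℂ) *ᵥ w) ha
    simp only [Matrix.mulVec_mulVec, coe_inv_mul_coe, Matrix.one_mulVec, Matrix.mulVec_smul,
      smul_smul, inv_mul_cancel₀ ha0, one_smul] at this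
    exact this.symm
  obtain ⟨ha0, ha'⟩ := inv g ha
  obtain ⟨hc0, hc'⟩ := inv h hc
  -- The commutator is unipotent with fixed vector `v`, so conjugation by `g` or by `g⁻¹`, whichever
  -- contracts, forces it to be trivial.
  set u := h * g * h⁻¹ * g⁻¹ with hu
  have huΓ : u ∈ Γ := Γ.mul_mem (Γ.mul_mem (Γ.mul_mem hh hg) (Γ.inv_mem hh)) (Γ.inv_mem hg)
  have huv : (u : Matrix (Fin 2) (Fin 2) ℂ) *ᵥ v = (1 : ℂ) • v := by
    rw [hu]
    simp only [Matrix.SpecialLinearGroup.coe_mul, ← Matrix.mulVec_mulVec, ha', hc',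
      Matrix.mulVec_smul, ha, hc, smul_smul]
    congr 1
    field_simp
  have hN : ((u : Matrix (Fin 2) (Fin 2) ℂ) - 1) *ᵥ v = 0 := by
    rw [Matrix.sub_mulVec, huv, one_smul, Matrix.one_mulVec, sub_self]
  have hNtr : ((u : Matrix (Fin 2) (Fin 2) ℂ) - 1).trace = 0 := by
    have := sq_sub_trace_mul_add_one_eq_zero u.det_coe hv huv
    rw [Matrix.trace_sub, Matrix.trace_one, Fintype.card_fin]
    push_cast
    linear_combination -this
  have h1 : ‖a‖ ≠ 1 := norm_ne_one_of_eigenvalue g.det_coe htr hv ha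
  suffices u = 1 by rwa [hu, mul_inv_eq_one] at this
  rcases lt_or_gt_of_ne h1 with h1 | h1
  · refine eq_one_of_contracted hΓ hg huΓ (ν := a ^ 2) ?_
      (mul_eq_smul_of_mulVec g.det_coe hv ha hN hNtr)
    rw [norm_pow]
    exact pow_lt_one₀ (norm_nonneg _) h1 two_ne_zero
  · refine eq_one_of_contracted hΓ (Γ.inv_mem hg) huΓ (ν := a⁻¹ ^ 2) ?_
      (mul_eq_smul_of_mulVec g⁻¹.det_coe hv ha' hN hNtr)
    rw [norm_pow, norm_inv]
    exact pow_lt_one₀ (inv_nonneg.2 (norm_nonneg _)) (inv_lt_one_of_one_lt₀ h1) two_ne_zero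

/-- If an orbit of a subgroup of a Bianchi group consists of fixed points of a loxodromic element,
then its conjugates are itself and its inverse. -/
theorem conj_eq_or_eq_inv (hΓ : Γ ≤ (slEmb φ).range) {g : SL(2, ℂ)} (hg : g ∈ Γ)
    (htr : 2 < ‖(g : Matrix (Fin 2) (Fin 2) ℂ).trace‖) {v : Fin 2 → ℂ} (hv : v ≠ 0)
    (hfix : ∀ h ∈ Γ, ∃ c : ℂ, (g : Matrix (Fin 2) (Fin 2) ℂ) *ᵥ
      ((h : Matrix (Fin 2) (Fin 2) ℂ) *ᵥ v) = c • ((h : Matrix (Fin 2) (Fin 2) ℂ) *ᵥ v))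
    {h : SL(2, ℂ)} (hh : h ∈ Γ) : h * g * h⁻¹ = g ∨ h * g * h⁻¹ = g⁻¹ := by
  obtain ⟨a, ha⟩ : ∃ a : ℂ, (g : Matrix (Fin 2) (Fin 2) ℂ) *ᵥ v = a • v := by
    simpa using hfix 1 Γ.one_mem
  -- Either all of `Γ` fixes the point of `v`, and everything commutes with `g`; or the orbit
  -- contains both fixed points of `g`, and each conjugate of `g` has the same two eigenvectors and
  -- the same trace.
  by_cases hall : ∀ k ∈ Γ, v 0 * ((k : Matrix (Fin 2) (Fin 2) ℂ) *ᵥ v) 1 =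
      v 1 * ((k : Matrix (Fin 2) (Fin 2) ℂ) *ᵥ v) 0
  · obtain ⟨c, hc⟩ := exists_eq_smul hv (hall h hh)
    exact Or.inl (mul_comm_of_common_eigenvector hΓ hg hh htr hv ha hc)
  · push Not at hall
    obtain ⟨k, hk, hkv⟩ := hall
    obtain ⟨b, hb⟩ := hfix k hk
    have hY : ∀ l ∈ Γ, ∃ c : ℂ, ((h * g * h⁻¹ : SL(2, ℂ)) : Matrix (Fin 2) (Fin 2) ℂ) *ᵥ
        ((l : Matrix (Fin 2) (Fin 2) ℂ) *ᵥ v) = c • ((l : Matrix (Fin 2) (Fin 2) ℂ) *ᵥ v) := by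
      intro l hl
      obtain ⟨c, hc⟩ := hfix (h⁻¹ * l) (Γ.mul_mem (Γ.inv_mem hh) hl)
      refine ⟨c, ?_⟩
      have := congrArg (fun w => (h : Matrix (Fin 2) (Fin 2) ℂ) *ᵥ w) hc
      simp only [Matrix.SpecialLinearGroup.coe_mul, Matrix.mulVec_smul, Matrix.mulVec_mulVec,
        ← Matrix.mul_assoc, coe_mul_coe_inv, Matrix.one_mul] at this
      simp only [Matrix.SpecialLinearGroup.coe_mul, Matrix.mulVec_mulVec]
      exact this
    obtain ⟨c, hc⟩ := hY 1 Γ.one_mem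
    rw [Matrix.SpecialLinearGroup.coe_one, Matrix.one_mulVec] at hc
    obtain ⟨d, hd⟩ := hY k hk
    refine eq_or_eq_inv_of_eigenvectors ?_ hkv ha hb hc hd
    rw [Matrix.SpecialLinearGroup.coe_mul, Matrix.trace_mul_comm,
      Matrix.SpecialLinearGroup.coe_mul, ← Matrix.mul_assoc, coe_inv_mul_coe, Matrix.one_mul]

theorem accumulationSet_subset_fixedPoints (hΓ : Γ ≤ (slEmb φ).range) {g : SL(2, ℂ)}
    (hconj : ∀ h ∈ Γ, h * g * h⁻¹ = g ∨ h * g * h⁻¹ = g⁻¹) :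
    accumulationSet Γ ⊆ {p | mobPerm g p = p} := by
  refine accumulationSet_subset (finite_norm_le_of_le_range hΓ)
    (isClosed_eq (continuous_mobPerm g) continuous_id) (fun h hh p hp => ?_) fun M hM v hv => ?_
  · have hp' : mobPerm g⁻¹ p = p := by
      rw [map_inv, Equiv.Perm.inv_eq_iff_eq]
      exact (show mobPerm g p = p from hp).symm
    have e : mobPerm g (mobPerm h p) = mobPerm h (mobPerm (h⁻¹ * g * h) p) := by
      rw [← Equiv.Perm.mul_apply, ← Equiv.Perm.mul_apply, ← map_mul, ← map_mul, mul_assoc h⁻¹,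
        mul_inv_cancel_left]
    show mobPerm g (mobPerm h p) = mobPerm h p
    rw [e]
    have := hconj h⁻¹ (Γ.inv_mem hh)
    rw [inv_inv] at this
    rcases this with h1 | h1 <;> rw [h1]
    · rw [show mobPerm g p = p from hp]
    · rw [hp']
  · have hA := adjugate_mem_limitMatrices hM
    -- The conjugates of `g` take only two values, so `r ^ 2` times them tends to zero. Hence `g`
    -- maps the image of `M` into the kernel of its adjugate, which is the image of `M`.
    have h0 : M.adjugate * (g : Matrix (Fin 2) (Fin 2) ℂ) * M = 0 := by
      have hcl : IsClosed ({x : ℝ × Matrix (Fin 2) (Fin 2) ℂ |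
          x.2 * (g : Matrix (Fin 2) (Fin 2) ℂ) * x.2.adjugate =
            (x.1 ^ 2) • (g : Matrix (Fin 2) (Fin 2) ℂ)} ∪ {x |
          x.2 * (g : Matrix (Fin 2) (Fin 2) ℂ) * x.2.adjugate =
            (x.1 ^ 2) • ((g⁻¹ : SL(2, ℂ)) : Matrix (Fin 2) (Fin 2) ℂ)}) := by
        have c1 : Continuous fun x : ℝ × Matrix (Fin 2) (Fin 2) ℂ =>
            x.2 * (g : Matrix (Fin 2) (Fin 2) ℂ) * x.2.adjugate :=
          (continuous_snd.matrix_mul continuous_const).matrix_mul continuous_snd.matrix_adjugate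
        have c2 : ∀ N : Matrix (Fin 2) (Fin 2) ℂ,
            Continuous fun x : ℝ × Matrix (Fin 2) (Fin 2) ℂ => (x.1 ^ 2) • N := fun N =>
          (continuous_fst.pow 2).smul continuous_const
        exact (isClosed_eq c1 (c2 _)).union (isClosed_eq c1 (c2 _))
      have := mem_of_isClosed_of_mem_limitMatrices hA hcl fun r hr h hh => by
        have e : ∀ Y : SL(2, ℂ), h * g * h⁻¹ = Y →
            (r • (h : Matrix (Fin 2) (Fin 2) ℂ)) * (g : Matrix (Fin 2) (Fin 2) ℂ) *
              (r • (h : Matrix (Fin 2) (Fin 2) ℂ)).adjugate =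
            (r ^ 2) • (Y : Matrix (Fin 2) (Fin 2) ℂ) := by
          rintro Y rfl
          rw [adjugate_smul_real, ← Matrix.SpecialLinearGroup.coe_inv, Matrix.smul_mul,
            Matrix.smul_mul, Matrix.mul_smul, smul_smul, sq, Matrix.SpecialLinearGroup.coe_mul,
            Matrix.SpecialLinearGroup.coe_mul]
        exact (hconj h hh).imp (e _) (e _)
      have hAA : M.adjugate.adjugate = M := by
        ext i j
        fin_cases i <;> fin_cases j <;> simp [Matrix.adjugate_fin_two]
      simpa [hAA] using this
    show mobPerm g (proj (M *ᵥ v)) = _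
    rw [mobPerm_proj g hv, proj_eq_iff (mulVec_ne_zero g hv) hv]
    refine mul_eq_mul_of_mulVec_eq_zero hA.1 ?_ ?_
    · rw [Matrix.mulVec_mulVec, Matrix.mulVec_mulVec, h0, Matrix.zero_mulVec]
    · rw [Matrix.mulVec_mulVec, adjugate_mul_of_mem_limitMatrices hM, Matrix.zero_mulVec]

/-- Otherwise every accumulation point would be fixed by `g`; three fixed points make `g` scalar,
with trace of absolute value `2`. -/
theorem not_forall_conj_eq (hΓ : Γ ≤ (slEmb φ).range) {g : SL(2, ℂ)}
    (htr : 2 < ‖(g : Matrix (Fin 2) (Fin 2) ℂ).trace‖)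
    (h0 : ((0 : ℂ) : OnePoint ℂ) ∈ accumulationSet Γ)
    (h1 : ((1 : ℂ) : OnePoint ℂ) ∈ accumulationSet Γ) (hi : ∞ ∈ accumulationSet Γ) :
    ¬ ∀ h ∈ Γ, h * g * h⁻¹ = g ∨ h * g * h⁻¹ = g⁻¹ := by
  intro hconj
  have hsub := accumulationSet_subset_fixedPoints hΓ hconj
  obtain ⟨c, hc⟩ := eq_smul_one_of_fixes (hsub h0) (hsub h1) (hsub hi)
  have hdet := g.det_coe
  rw [hc, Matrix.det_smul, Matrix.det_one, Fintype.card_fin, mul_one] at hdet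
  have hc1 : ‖c‖ = 1 := by
    have := congrArg norm hdet
    rw [norm_pow, norm_one] at this
    exact (pow_eq_one_iff_of_nonneg (norm_nonneg c) two_ne_zero).1 this
  rw [hc, Matrix.trace_smul, Matrix.trace_one, Fintype.card_fin, norm_smul, hc1] at htr
  norm_num at htr

/-- If all traces are bounded by `2`, then `M` and `M γ` are traceless for each limit matrix `M`, so
`M ^ 2 = 0` and `M γ M = 0`, and `γ` fixes the image of `M`. So all of `Γ` fixes three points and is
scalar, and its orbits are single points without accumulation. -/
theorem exists_two_lt_norm_trace (hΓ : Γ ≤ (slEmb φ).range)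
    (h0 : ((0 : ℂ) : OnePoint ℂ) ∈ accumulationSet Γ)
    (h1 : ((1 : ℂ) : OnePoint ℂ) ∈ accumulationSet Γ) (hi : ∞ ∈ accumulationSet Γ) :
    ∃ g ∈ Γ, 2 < ‖(g : Matrix (Fin 2) (Fin 2) ℂ).trace‖ := by
  by_contra! hle
  have hsub : accumulationSet Γ ⊆ ⋂ γ ∈ Γ, {p | mobPerm γ p = p} := by
    refine accumulationSet_subset (finite_norm_le_of_le_range hΓ)
      (isClosed_biInter fun γ _ => isClosed_eq (continuous_mobPerm γ) continuous_id)
      (fun γ hγ p hp => ?_) fun M hM v hv => ?_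
    · have := Set.mem_iInter₂.1 hp γ hγ
      rwa [show mobPerm γ p = p from this]
    · refine Set.mem_iInter₂.2 fun γ hγ => ?_
      show mobPerm γ (proj (M *ᵥ v)) = _
      rw [mobPerm_proj γ hv, proj_eq_iff (mulVec_ne_zero γ hv) hv]
      have tr := fun N hN => trace_eq_zero_of_mem_limitMatrices (M := N) hle hN
      have hdet := det_eq_zero_of_mem_limitMatrices hM
      have e := mul_mul_eq_trace_smul hdet
      refine mul_eq_mul_of_mulVec_eq_zero hM.1 ?_ ?_
      · rw [Matrix.mulVec_mulVec, Matrix.mulVec_mulVec, e, tr _ (mul_mem_limitMatrices hM hγ),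
          zero_smul, Matrix.zero_mulVec]
      · have := e 1
        rw [Matrix.mul_one, tr _ hM, zero_smul] at this
        rw [Matrix.mulVec_mulVec, this, Matrix.zero_mulVec]
  obtain ⟨x, hx⟩ := Set.mem_iUnion.1 h0
  have hγ : ∀ γ ∈ Γ, mobPerm γ x = x := by
    intro γ hγ
    obtain ⟨c, hc⟩ := eq_smul_one_of_fixes (Set.mem_iInter₂.1 (hsub h0) γ hγ)
      (Set.mem_iInter₂.1 (hsub h1) γ hγ) (Set.mem_iInter₂.1 (hsub hi) γ hγ)
    refine mobPerm_eq_self_iff.2 ⟨c, ?_⟩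
    rw [hc, Matrix.smul_mulVec, Matrix.one_mulVec]
  have hx' := derivedSet_mono _ {x} (by
    rintro _ ⟨γ, h, rfl⟩
    exact hγ γ h) hx
  by_cases hx0 : ((0 : ℂ) : OnePoint ℂ) = x
  · obtain ⟨y, hy, hne⟩ := accPt_iff_nhds.1 hx' Set.univ univ_mem
    exact hne (hy.2.trans hx0.symm)
  · obtain ⟨y, hy, -⟩ := accPt_iff_nhds.1 hx' {x}ᶜ (isOpen_compl_singleton.mem_nhds hx0)
    exact hy.1 hy.2

/-- If a real Lie algebra is normalized by a subgroup of a Bianchi group and contains the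
infinitesimal generators of its loxodromic elements, then all accumulation points are kernels of its
nilpotent elements. -/
theorem accumulationSet_subset_nilpotentKernels (hΓ : Γ ≤ (slEmb φ).range)
    {t : Submodule ℝ (Matrix (Fin 2) (Fin 2) ℂ)}
    (ht : ∀ γ ∈ Γ, ∀ X ∈ t, (γ : Matrix (Fin 2) (Fin 2) ℂ) * X *
      ((γ⁻¹ : SL(2, ℂ)) : Matrix (Fin 2) (Fin 2) ℂ) ∈ t)
    (hlox : ∀ (S : SL(2, ℂ)) (μ : ℂ) (hμ : μ ≠ 0), 1 < ‖μ‖ → S * diagSL μ hμ * S⁻¹ ∈ Γ →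
      (S : Matrix (Fin 2) (Fin 2) ℂ) * !![1, 0; 0, -1] *
        ((S⁻¹ : SL(2, ℂ)) : Matrix (Fin 2) (Fin 2) ℂ) ∈ t)
    (h0 : ((0 : ℂ) : OnePoint ℂ) ∈ accumulationSet Γ)
    (h1 : ((1 : ℂ) : OnePoint ℂ) ∈ accumulationSet Γ) (hi : ∞ ∈ accumulationSet Γ) :
    accumulationSet Γ ⊆ nilpotentKernels t := by
  obtain ⟨g, hg, htr⟩ := exists_two_lt_norm_trace hΓ h0 h1 hi
  have hnot := not_forall_conj_eq hΓ htr h0 h1 hi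
  obtain ⟨S, μ, hμ, hμ1, hgS⟩ := exists_eq_conj_diagSL htr
  have hX := hlox S μ hμ hμ1 (hgS ▸ hg)
  set X := (S : Matrix (Fin 2) (Fin 2) ℂ) * !![1, 0; 0, -1] *
    ((S⁻¹ : SL(2, ℂ)) : Matrix (Fin 2) (Fin 2) ℂ) with hXdef
  -- As `g` is a combination of `1` and `X`, statements about `X` below turn into statements about
  -- `g`: the scalar part contributes a multiple of `M h adj(M h) = 0`.
  have hgX : (g : Matrix (Fin 2) (Fin 2) ℂ) = ((μ + μ⁻¹) / 2) • 1 + ((μ - μ⁻¹) / 2) • X := by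
    have e : !![μ, 0; 0, μ⁻¹] = ((μ + μ⁻¹) / 2) • (1 : Matrix (Fin 2) (Fin 2) ℂ) +
        ((μ - μ⁻¹) / 2) • !![1, 0; 0, -1] := by
      ext i j
      fin_cases i <;> fin_cases j <;> simp <;> ring
    rw [hgS, Matrix.SpecialLinearGroup.coe_mul, Matrix.SpecialLinearGroup.coe_mul, coe_diagSL, e,
      Matrix.mul_add, Matrix.add_mul, Matrix.mul_smul, Matrix.mul_smul, Matrix.smul_mul,
      Matrix.smul_mul, Matrix.mul_one, coe_mul_coe_inv]
  refine accumulationSet_subset (finite_norm_le_of_le_range hΓ) (isClosed_nilpotentKernels t)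
    (fun γ hγ p hp => ?_) fun M hM v hv => ?_
  · obtain ⟨N, hN, hN0, hNN, hNp⟩ := hp
    obtain ⟨c, hc, e⟩ := exists_smul_lift_proj (mulVec_ne_zero γ (lift_ne_zero p))
    rw [← mobPerm_eq_proj] at e
    refine ⟨_, ht γ hγ N hN, fun h => hN0 ?_, ?_, ?_⟩
    · have := congrArg (fun A => ((γ⁻¹ : SL(2, ℂ)) : Matrix (Fin 2) (Fin 2) ℂ) * A *
        (γ : Matrix (Fin 2) (Fin 2) ℂ)) h
      simpa only [Matrix.mul_assoc, coe_inv_mul_coe, Matrix.mul_one, Matrix.mul_zero,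
        Matrix.zero_mul, ← Matrix.mul_assoc ((γ⁻¹ : SL(2, ℂ)) : Matrix (Fin 2) (Fin 2) ℂ) _ N,
        Matrix.one_mul] using this
    · calc _ = (γ : Matrix (Fin 2) (Fin 2) ℂ) * N *
          (((γ⁻¹ : SL(2, ℂ)) : Matrix (Fin 2) (Fin 2) ℂ) * (γ : Matrix (Fin 2) (Fin 2) ℂ)) * N *
          ((γ⁻¹ : SL(2, ℂ)) : Matrix (Fin 2) (Fin 2) ℂ) := by simp only [Matrix.mul_assoc]
        _ = _ := by
          rw [coe_inv_mul_coe, Matrix.mul_one, Matrix.mul_assoc _ N N, hNN, Matrix.mul_zero,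
            Matrix.zero_mul]
    · have : ((γ : Matrix (Fin 2) (Fin 2) ℂ) * N *
          ((γ⁻¹ : SL(2, ℂ)) : Matrix (Fin 2) (Fin 2) ℂ)) *ᵥ (c • lift (mobPerm γ p)) = 0 := by
        rw [← e, Matrix.mulVec_mulVec, Matrix.mul_assoc, coe_inv_mul_coe, Matrix.mul_one,
          ← Matrix.mulVec_mulVec, hNp, Matrix.mulVec_zero]
      rw [Matrix.mulVec_smul] at this
      exact (smul_eq_zero.1 this).resolve_left hc
  · by_contra hnp
    -- `M h X adj(M h)` lies in `t`, has square zero and kills the image of `M`. As the point is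
    -- assumed not to be such a kernel, it vanishes for every `h`.
    have hzero : ∀ h ∈ Γ, M * (h : Matrix (Fin 2) (Fin 2) ℂ) * (g : Matrix (Fin 2) (Fin 2) ℂ) *
        (((h⁻¹ : SL(2, ℂ)) : Matrix (Fin 2) (Fin 2) ℂ) * M.adjugate) = 0 := by
      intro h hh
      have hMh := mul_mem_limitMatrices hM hh
      have hN := mul_mul_adjugate_mem ht hMh hX
      have hadj : (M * (h : Matrix (Fin 2) (Fin 2) ℂ)).adjugate =
          ((h⁻¹ : SL(2, ℂ)) : Matrix (Fin 2) (Fin 2) ℂ) * M.adjugate := by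
        rw [Matrix.adjugate_mul_distrib, Matrix.SpecialLinearGroup.coe_inv]
      have hz := mul_adjugate_of_mem_limitMatrices hMh
      have hz' := adjugate_mul_of_mem_limitMatrices hMh
      have hN0 : M * (h : Matrix (Fin 2) (Fin 2) ℂ) * X *
          (M * (h : Matrix (Fin 2) (Fin 2) ℂ)).adjugate = 0 := by
        by_contra hne
        refine hnp ⟨_, hN, hne, ?_, ?_⟩
        · generalize M * (h : Matrix (Fin 2) (Fin 2) ℂ) = B at *
          rw [Matrix.mul_assoc, ← Matrix.mul_assoc B.adjugate, ← Matrix.mul_assoc B.adjugate, hz']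
          simp
        · obtain ⟨c, hc, e⟩ := exists_smul_lift_proj hv
          have : (M * (h : Matrix (Fin 2) (Fin 2) ℂ) * X *
              (M * (h : Matrix (Fin 2) (Fin 2) ℂ)).adjugate) *ᵥ (c • lift (proj (M *ᵥ v))) = 0 := by
            rw [← e, Matrix.mulVec_mulVec, Matrix.mul_assoc, hadj, Matrix.mul_assoc _ M.adjugate,
              adjugate_mul_of_mem_limitMatrices hM]
            simp
          rw [Matrix.mulVec_smul] at this
          exact (smul_eq_zero.1 this).resolve_left hc
      rw [← hadj, hgX, Matrix.mul_add, Matrix.add_mul, Matrix.mul_smul, Matrix.mul_smul,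
        Matrix.smul_mul, Matrix.smul_mul, Matrix.mul_one, hz, hN0, smul_zero, smul_zero, add_zero]
    have hA := adjugate_mem_limitMatrices hM
    obtain ⟨w, hw⟩ : ∃ w, M.adjugate *ᵥ w ≠ 0 := by
      by_contra! hw
      exact hA.1 (Matrix.ext_of_mulVec_single fun i => by rw [hw, Matrix.zero_mulVec])
    -- The vanishing says that `g` fixes the point of `k w` for every `k` in `Γ`, where `w` is now
    -- any nonzero vector in the image of `adj M`.
    refine hnot fun h hh => conj_eq_or_eq_inv hΓ hg htr hw (fun k hk => ?_) hh
    have hkw := mulVec_ne_zero k hw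
    refine exists_eq_smul hkw ?_
    have hMk := mul_mem_limitMatrices hM (Γ.inv_mem hk)
    refine mul_eq_mul_of_mulVec_eq_zero hMk.1 ?_ ?_
    · rw [Matrix.mulVec_mulVec, Matrix.mulVec_mulVec, Matrix.mul_assoc M, coe_inv_mul_coe,
        Matrix.mul_one, mul_adjugate_of_mem_limitMatrices hM, Matrix.zero_mulVec]
    · have := hzero k⁻¹ (Γ.inv_mem hk)
      rw [inv_inv] at this
      rw [Matrix.mulVec_mulVec, Matrix.mulVec_mulVec, Matrix.mulVec_mulVec, Matrix.mul_assoc,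
        ← Matrix.mul_assoc _ _ M.adjugate]
      rw [Matrix.mul_assoc] at this
      simp only [Matrix.mul_assoc] at this ⊢
      rw [this, Matrix.zero_mulVec]

end

end

/-! ### Weak Apollonian groups -/

theorem rho_slToMob (γ : SL(2, ℂ)) : rho (slToMob γ) = slRho γ := rho_toPerm _

section

variable {K : Type*} [Field K] [NumberField K] [Algebra.IsQuadraticExtension ℚ K]
  [NumberField.IsTotallyComplex K] {φ : K →+* ℂ} {A : Subgroup Mob}

/-- The matrices over the integers of `K` whose Möbius transformations belong to `A`. -/
def integralLift (φ : K →+* ℂ) (A : Subgroup Mob) : Subgroup SL(2, ℂ) :=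
  A.comap slToMob ⊓ (slEmb φ).range

/-- The orientation-preserving part of `A` has index at most two, so the orbit of `0` under `A` lies
in at most two of its orbits: that of `0` and that of the image of `0` under one reflection. -/
theorem limitSet_subset_accumulationSet (hA : A ≤ extendedBianchiGroup φ) :
    limitSet A ⊆ accumulationSet (integralLift φ A) := by
  have key : ∀ e ∈ extBianchi φ, e.right = 1 → toPerm.rangeRestrict e ∈ A →
      ∃ γ ∈ integralLift φ A, mobPerm γ = toPerm e := by
    intro e he hr hA
    have h : e = SemidirectProduct.inl e.left := by
      ext1
      · rfl
      · exact hr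
    refine ⟨e.left, ⟨?_, he⟩, ?_⟩
    · rw [h] at hA
      exact hA
    · rw [← toPerm_inl, ← h]
  have two : ∀ σ τ : ℂ ≃ₐ[ℝ] ℂ, σ ≠ 1 → τ ≠ 1 → σ = τ := by
    have h1 : ∀ σ : ℂ ≃ₐ[ℝ] ℂ, σ ≠ 1 → σ = Complex.conjAe := by
      intro σ hσ
      rcases Complex.real_algHom_eq_id_or_conj (σ : ℂ →ₐ[ℝ] ℂ) with h | h
      · exact absurd (AlgEquiv.ext fun w => DFunLike.congr_fun h w) hσ
      · exact AlgEquiv.ext fun w => DFunLike.congr_fun h w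
    intro σ τ hσ hτ
    rw [h1 σ hσ, h1 τ hτ]
  obtain ⟨x, hx⟩ : ∃ x : OnePoint ℂ, {z | ∃ g ∈ A, (g : Equiv.Perm (OnePoint ℂ))
      ((0 : ℂ) : OnePoint ℂ) = z} ⊆ {z | ∃ γ ∈ integralLift φ A, mobPerm γ
        ((0 : ℂ) : OnePoint ℂ) = z} ∪ {z | ∃ γ ∈ integralLift φ A, mobPerm γ x = z} := by
    by_cases hf : ∃ f ∈ extBianchi φ, f.right ≠ 1 ∧ toPerm.rangeRestrict f ∈ A
    · obtain ⟨f, hf, hfr, hfA⟩ := hf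
      refine ⟨toPerm f ((0 : ℂ) : OnePoint ℂ), ?_⟩
      rintro _ ⟨g, hg, rfl⟩
      obtain ⟨e, he, rfl⟩ := extendedBianchiGroup_le (hA hg)
      by_cases her : e.right = 1
      · left
        obtain ⟨γ, hγ, h⟩ := key e he her hg
        exact ⟨γ, hγ, by rw [h]; rfl⟩
      · right
        obtain ⟨γ, hγ, h⟩ := key (e * f⁻¹) (mul_mem he (inv_mem hf))
          (by
            rw [SemidirectProduct.mul_right, SemidirectProduct.inv_right, two _ _ her hfr,
              mul_inv_cancel])
          (by
            rw [map_mul, map_inv]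
            exact mul_mem hg (inv_mem hfA))
        refine ⟨γ, hγ, ?_⟩
        rw [h, ← Equiv.Perm.mul_apply, ← map_mul, inv_mul_cancel_right]
        rfl
    · refine ⟨∞, ?_⟩
      rintro _ ⟨g, hg, rfl⟩
      obtain ⟨e, he, rfl⟩ := extendedBianchiGroup_le (hA hg)
      left
      obtain ⟨γ, hγ, h⟩ := key e he (by
        by_contra her
        exact hf ⟨e, he, her, hg⟩) hg
      exact ⟨γ, hγ, by rw [h]; rfl⟩
  intro p hp
  have := derivedSet_mono _ _ hx hp
  rw [derivedSet_union] at this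
  exact this.elim (fun h => Set.mem_iUnion.2 ⟨_, h⟩) fun h => Set.mem_iUnion.2 ⟨_, h⟩

/-- The points `0`, `1`, `∞` come from the real line and `1 - h i` from the line tangent to it; the
square of the last has imaginary part `-2 h`. -/
theorem SOM_le_zariskiClosure_of_isWeakApollonian (hK : NumberField.discr K ≠ -3)
    (hA : IsWeakApollonian φ A) : SOM ≤ zariskiClosure (A.map rho) := by
  obtain ⟨h, ω, h1, hω, hg⟩ := exists_one_le_generator φ hK
  have hline : ∀ z ∈ (lineOriented h).carrier, z ∈ accumulationSet (integralLift φ A) := by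
    intro z hz
    refine limitSet_subset_accumulationSet hA.le ?_
    rw [hA.limitSet_eq]
    exact subset_closure (Set.mem_biUnion (show lineOriented h ∈ fundamentalPacking φ from
      Relation.ReflTransGen.single (immediatelyTangent_lineOriented h1 hg hω)) hz)
  have hreal : ∀ z ∈ realCircle, z ∈ accumulationSet (integralLift φ A) := by
    intro z hz
    refine limitSet_subset_accumulationSet hA.le ?_
    rw [hA.limitSet_eq]
    exact subset_closure (Set.mem_biUnion (show realOriented ∈ fundamentalPacking φ from
      Relation.ReflTransGen.refl) hz)
  have h0 := hreal ((0 : ℂ) : OnePoint ℂ) (Or.inr ⟨0, by simp⟩)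
  have h1' := hreal ((1 : ℂ) : OnePoint ℂ) (Or.inr ⟨1, by simp⟩)
  have hi := hreal ∞ (Or.inl rfl)
  have hq := hline ((1 - h * Complex.I : ℂ) : OnePoint ℂ)
    ((mem_carrier_lineOriented h _).2 (Or.inr ⟨_, by simp, rfl⟩))
  have hsub := accumulationSet_subset_nilpotentKernels (Γ := integralLift φ A)
    (t := tangentSL (A.map rho)) inf_le_right
    (fun γ hγ X hX => conj_mem_tangentSL hX ⟨slToMob γ, hγ.1, rho_slToMob γ⟩)
    (fun S μ hμ hμ1 hS => conj_mem_tangentSL_of_loxodromic hμ hμ1 S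
      ⟨slToMob _, hS.1, rho_slToMob _⟩) h0 h1' hi
  obtain ⟨hU, hL⟩ := triangular_mem_of_nilpotentKernels
    (fun X hX Y hY => lie_mem_tangentSL hX hY) (hsub h0) (hsub h1') (hsub hi) (hsub hq) (by
      simp [sq]
      linarith)
  exact SOM_le_zariskiClosure hU hL

end

end Apollonian

end

theorem mainTheorem4 {K : Type*} [Field K] [NumberField K] [Algebra.IsQuadraticExtension ℚ K]
    [NumberField.IsTotallyComplex K] (hK : NumberField.discr K ≠ -3) (φ : K →+* ℂ)
    (A : Subgroup Apollonian.Mob) (hA : Apollonian.IsWeakApollonian φ A) :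
    Apollonian.IsThin (Apollonian.hermLattice φ) (A.map Apollonian.rho) ∧
      (Apollonian.zariskiClosure (A.map Apollonian.rho) = Apollonian.OM ∨
        Apollonian.zariskiClosure (A.map Apollonian.rho) = Apollonian.SOM) ∧
      A.map Apollonian.rho ≤ Apollonian.OMInt φ ∧
      ¬ (A.map Apollonian.rho).IsFiniteRelIndex (Apollonian.OMInt φ) := by
  have hle := Apollonian.map_rho_le hA.le
  have hSOM := Apollonian.SOM_le_zariskiClosure_of_isWeakApollonian hK hA
  -- One element `x` of `SO_M(ℤ)` witnesses infinite index both in the integral points of the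
  -- Zariski closure and in `O_M(ℤ)`.
  obtain ⟨x, hx, hindex⟩ := Apollonian.exists_forall_not_isFiniteRelIndex (φ := φ) (A := A) (by
    rw [hA.limitSet_eq]
    exact Apollonian.disjoint_closure_fundamentalPacking)
  exact ⟨⟨fun g hg => (hle hg).2, hindex _ ⟨hSOM hx.1, hx.2⟩⟩,
    Apollonian.eq_OM_or_eq_SOM hSOM (Apollonian.zariskiClosure_le_OM fun g hg => (hle hg).1), hle,
    hindex _ ⟨(Apollonian.mem_SOM_iff.1 hx.1).1, hx.2⟩⟩
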